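/- **Setting.** Let $\omega=(\alpha,\beta)$ be a point of the Thoma simplex: $\alpha=(\alpha_1\ge\alpha_2\ge\cdots\ge 0)$, $\beta=(\beta_1\ge\beta_2\ge\cdots\ge0)$ real sequences with $\gamma:=1-\sum_i\alpha_i-\sum_i\beta_i\ge 0$. Let $n\ge 0$. *Compositions.* A composition $c=(c_1,\dots,c_r)$ of $n$ is encoded by its descent set $D(c)=\{c_1,c_1+c_2,\dots,c_1+\cdots+c_{r-1}\}\subset\{1,\dots,n-1\}$. For $0\le i\le j\le n$, $c_{[i+1,j]}$ is the composition of $j-i$ with descent set $(D(c)\cap[i+1,j-1])-i$; the conjugate $\overline c$ is the composition of $n$ with $D(\overline c)=\{1,\dots,n-1\}\setminus\{n-d : d\in D(c)\}$. For $\sigma\in\mathfrak S_n$, the recoil composition $c(\sigma^{-1})$ has descent set $\{d : \sigma^{-1}(d)>\sigma^{-1}(d+1)\}$. *Quasi-symmetric functions.* $\mathbf{QSym}$ is the space of quasi-symmetric power series of bounded degree in ordered commuting variables $x_1,x_2,\dots$, with basis $L_c=\sum x_{i_1}\cdots x_{i_n}$, the sum being over $i_1\le\cdots\le i_n$ with $i_d<i_{d+1}$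 for $d\in D(c)$. Let $\Delta:\mathbf{QSym}\to\mathbf{QSym}\otimes\mathbf{QSym}$ be the coproduct $\Delta f(X,Y)=f(X+Y)$ ($X+Y$ being the ordered sum of the two ordered alphabets), and let $\nu$ be the linear map with $\nu(L_c)=L_{\overline c}$. Let $f\mapsto f(\alpha)$ and $f\mapsto f(\beta)$ be the substitutions $x_i=\alpha_i$ and $x_i=\beta_i$, and let $f\mapsto f(\gamma E)$ be the linear form with $L_c(\gamma E)=\gamma^m/m!$ for $c$ a composition of $m$. Set $$f(A-B+\gamma E)=\big[(\mathrm{id}\otimes\nu\otimes\mathrm{id})\circ(\Delta\otimes\mathrm{id})\circ\Delta\big]f\,(\alpha,\beta,\gamma E),\qquad f\in\mathbf{QSym}.$$ For $\sigma\in\mathfrak S_n$, let $G_\sigma=\sum_{\mathrm{Std}(w)=\sigma}w$ be the sum of the words $w$ in noncommuting letters $x_1,x_2,\dots$ whose standardization is $\sigma$ (the $k$-th letter of $w$ has rank $\sigma(k)$, equal letters being ranked from left to right). Making the letters commute turns $G_\sigma$ into an element of $\mathbf{QSym}$, and $G_\sigma(A-B+\gamma E)$ denotes the specialization of this element. *The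 measure on partitions.* For a partition $\lambda$ of $n$ with conjugate $\lambda'$, let $\Delta^{\lambda'}$ be the product of the Vandermonde products $\prod_{j<k}(x_j-x_k)$ of the consecutive blocks of sizes $\lambda'_1,\lambda'_2,\dots$ of the variables $x_1,\dots,x_n$. Let $V^\lambda\subset\mathbb C[x_1,\dots,x_n]$ be the $\mathfrak S_n$-module spanned by the polynomials obtained from $\Delta^{\lambda'}$ by permutation of the variables, and let $\chi^\lambda$ be its character divided by $\dim V^\lambda$. For $\sigma\in\mathfrak S_n$ with cycle lengths $l_1,\dots,l_s$ (fixed points included) put $\chi^\omega(\sigma)=\prod_{j}p_{l_j}$, where $p_1=1$ and $p_k=\sum_i\alpha_i^k+(-1)^{k-1}\sum_i\beta_i^k$ for $k\ge2$. The weights $\mathbb P_{n,\omega}[\lambda]$ are the coefficients of the expansion $\chi^\omega|_{\mathfrak S_n}=\sum_{\lambda}\mathbb P_{n,\omega}[\lambda]\,\chi^\lambda$ over the partitions $\lambda$ of $n$. **Proposition.** Set $\mathbb Q_{n,\omega}[\sigma]=G_\sigma(A-B+\gamma E)$ for $\sigma\in\mathfrak S_n$. 1. $\mathbb Q_{n,\omega}$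 is a probability measure on $\mathfrak S_n$, and its push-forward under the map $\Lambda$ that sends $\sigma$ to the shape of its Robinson–Schensted–Knuth tableaux is $\mathbb P_{n,\omega}$: the expansion above exists and is unique, and for every partition $\lambda$ of $n$, $$\mathbb P_{n,\omega}[\lambda]=\sum_{\sigma\,:\,\Lambda(\sigma)=\lambda}\mathbb Q_{n,\omega}[\sigma].$$ 2. For every $\sigma\in\mathfrak S_n$ with recoil composition $c$, $$\mathbb Q_{n,\omega}[\sigma]=\sum_{i+j+k=n}\frac{\gamma^k}{k!}\,L_{c_{[1,i]}}(\alpha)\,L_{\overline{c_{[i+1,i+j]}}}(\beta).$$ -/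

import Mathlib

open Finset

namespace ThomaShuffle

noncomputable section

/-! ### Compositions and descent sets -/

/-- Compositions of `n` correspond bijectively to subsets of `{1, …, n - 1}` through their partial
sums `c₁, c₁ + c₂, …, c₁ + ⋯ + c_{r-1}`; here `k : Fin (n - 1)` stands for `k + 1`. -/
def descentEquiv (n : ℕ) : Composition n ≃ Finset (Fin (n - 1)) :=
  (compositionEquiv n).trans (compositionAsSetEquiv n)

/-- The descent set `D(c) = {c₁, c₁ + c₂, …, c₁ + ⋯ + c_{r-1}} ⊆ {1, …, n - 1}`. -/
def descentSet {n : ℕ} (c : Composition n) : Finset ℕ :=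
  (descentEquiv n c).image fun k : Fin (n - 1) => (k : ℕ) + 1

/-- The composition of `n` whose descent set is `S ∩ {1, …, n - 1}`. -/
def ofDescentSet (n : ℕ) (S : Finset ℕ) : Composition n :=
  (descentEquiv n).symm (univ.filter fun k : Fin (n - 1) => (k : ℕ) + 1 ∈ S)

theorem mem_descentSet_ofDescentSet {n : ℕ} {S : Finset ℕ} {d : ℕ} :
    d ∈ descentSet (ofDescentSet n S) ↔ 0 < d ∧ d < n ∧ d ∈ S := by
  simp only [descentSet, ofDescentSet, Equiv.apply_symm_apply, mem_image, mem_filter, mem_univ,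
    true_and]
  constructor
  · rintro ⟨k, hk, rfl⟩
    exact ⟨by omega, by omega, hk⟩
  · rintro ⟨h0, hn, hS⟩
    exact ⟨⟨d - 1, by omega⟩, by simpa [Nat.sub_add_cancel h0] using hS, by simp; omega⟩

/-- `segment c i l` is the composition `c_{⟦i+1, i+l⟧}` of size `l`, whose descent set is
`(D(c) ∩ ⟦i+1, i+l-1⟧) - i`: one cuts the ribbon of `c` before the box `i + 1` and after the box
`i + l`. -/
def segment {n : ℕ} (c : Composition n) (i l : ℕ) : Composition l :=
  ofDescentSet l ((range l).filter fun d => d + i ∈ descentSet c)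

/-- The reverse composition `c*`, whose descent set is `{n - d | d ∈ D(c)}`. -/
def reverseComposition {n : ℕ} (c : Composition n) : Composition n :=
  ofDescentSet n ((descentSet c).image fun d => n - d)

/-- The conjugate composition, whose descent set is the complement of `D(c*)` in
`{1, …, n - 1}`. -/
def conjugate {n : ℕ} (c : Composition n) : Composition n :=
  ofDescentSet n (Ioo 0 n \ descentSet (reverseComposition c))

/-- The descents of a permutation: the `i ∈ {1, …, n - 1}` with `σ(i) > σ(i + 1)`. The set
`{1, …, n}` is modelled by `Fin n`, and `q : Fin n` is the letter or the position `q + 1`. -/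
def permDescents {n : ℕ} (σ : Equiv.Perm (Fin n)) : Finset ℕ :=
  (range n).filter fun d => ∃ p q : Fin n, (p : ℕ) + 1 = d ∧ (q : ℕ) = d ∧ σ q < σ p

/-- The composition `c(σ)` with the same descents as the permutation `σ`. -/
def permComposition {n : ℕ} (σ : Equiv.Perm (Fin n)) : Composition n :=
  ofDescentSet n (permDescents σ)

/-- The composition that encodes the recoils of `σ`, i.e. the descents of `σ⁻¹`. -/
def recoilComposition {n : ℕ} (σ : Equiv.Perm (Fin n)) : Composition n :=
  permComposition σ⁻¹

/-! ### Quasi-symmetric functions -/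

/-- A formal power series in commuting variables `x₀, x₁, …` is quasi-symmetric if the monomials
`x_{i₁}^{a₁} ⋯ x_{i_r}^{a_r}` and `x_{j₁}^{a₁} ⋯ x_{j_r}^{a_r}` have the same coefficient whenever
`i₁ < ⋯ < i_r` and `j₁ < ⋯ < j_r`. -/
def IsQuasiSymmetric (f : MvPowerSeries ℕ ℝ) : Prop :=
  ∀ (r : ℕ) (a i j : Fin r → ℕ), StrictMono i → StrictMono j →
    MvPowerSeries.coeff (∑ k, Finsupp.single (i k) (a k)) f =
      MvPowerSeries.coeff (∑ k, Finsupp.single (j k) (a k)) f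

/-- The space `QSym` of quasi-symmetric functions: quasi-symmetric power series of bounded
degree. -/
def QSym : Submodule ℝ (MvPowerSeries ℕ ℝ) where
  carrier := {f | (∃ N : ℕ, ∀ m : ℕ →₀ ℕ, N < m.degree → MvPowerSeries.coeff m f = 0) ∧
    IsQuasiSymmetric f}
  add_mem' := by
    rintro f g ⟨⟨N, hN⟩, hf⟩ ⟨⟨M, hM⟩, hg⟩
    refine ⟨⟨max N M, fun m hm => ?_⟩, fun r a i j hi hj => ?_⟩
    · rw [map_add, hN m (lt_of_le_of_lt (le_max_left _ _) hm),
        hM m (lt_of_le_of_lt (le_max_right _ _) hm), add_zero]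
    · rw [map_add, map_add, hf r a i j hi hj, hg r a i j hi hj]
  zero_mem' := ⟨⟨0, fun m _ => by simp⟩, fun r a i j _ _ => by simp⟩
  smul_mem' := by
    rintro x f ⟨⟨N, hN⟩, hf⟩
    refine ⟨⟨N, fun m hm => ?_⟩, fun r a i j hi hj => ?_⟩
    · rw [map_smul, hN m hm, smul_zero]
    · rw [map_smul, map_smul, hf r a i j hi hj]

/-- The exponent of the monomial `x_{t₁} x_{t₂} ⋯ x_{t_n}`. -/
def content {n : ℕ} (t : Fin n → ℕ) : ℕ →₀ ℕ := ∑ p, Finsupp.single (t p) 1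

/-- The sequence `t₁, …, t_n` satisfies `t_d < t_{d+1}` for every `d ∈ S`. -/
def StrictAt {n : ℕ} (S : Finset ℕ) (t : Fin n → ℕ) : Prop :=
  ∀ p q : Fin n, (p : ℕ) + 1 = q → (q : ℕ) ∈ S → t p < t q

/-- The fundamental quasi-symmetric series
`L_c = ∑ x_{i₁} ⋯ x_{i_n}`, over `i₁ ≤ ⋯ ≤ i_n` with `i_d < i_{d+1}` if `d ∈ D(c)`. -/
def fundamentalSeries {n : ℕ} (c : Composition n) : MvPowerSeries ℕ ℝ := fun m =>
  (Set.ncard {t : Fin n → ℕ | Monotone t ∧ StrictAt (descentSet c) t ∧ content t = m} : ℝ)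

theorem toMultiset_inj {m m' : ℕ →₀ ℕ} (h : Finsupp.toMultiset m = Finsupp.toMultiset m') :
    m = m' := by
  simpa using congrArg Multiset.toFinsupp h

theorem degree_content {n : ℕ} (t : Fin n → ℕ) : (content t).degree = n := by
  simp [content, map_sum]

theorem toMultiset_content {n : ℕ} (t : Fin n → ℕ) :
    Finsupp.toMultiset (content t) = (List.ofFn t : Multiset ℕ) := by
  rw [content, map_sum]
  simp only [Finsupp.toMultiset_single, one_smul]
  rw [← Fin.univ_val_map]
  change (univ.val.map fun p => ({t p} : Multiset ℕ)).sum = _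
  rw [show (fun p => ({t p} : Multiset ℕ)) = (fun a => ({a} : Multiset ℕ)) ∘ t from rfl,
    ← Multiset.map_map, Multiset.sum_map_singleton]

theorem content_injOn {n : ℕ} {s t : Fin n → ℕ} (hs : Monotone s) (ht : Monotone t)
    (h : content s = content t) : s = t := by
  have h1 : (List.ofFn s : Multiset ℕ) = (List.ofFn t : Multiset ℕ) := by
    rw [← toMultiset_content, ← toMultiset_content, h]
  exact List.ofFn_injective (List.Perm.eq_of_sortedLE (List.sortedLE_ofFn_iff.2 hs)
    (List.sortedLE_ofFn_iff.2 ht) (Multiset.coe_eq_coe.1 h1))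

theorem exists_content_eq (m : ℕ →₀ ℕ) :
    ∃ t : Fin m.degree → ℕ, Monotone t ∧ content t = m := by
  set l := (Finsupp.toMultiset m).sort (· ≤ ·) with hl
  have hlen : l.length = m.degree := by
    rw [hl, Multiset.length_sort, Finsupp.card_toMultiset]; rfl
  have hsort : l.SortedLE := (Multiset.pairwise_sort _ _).sortedLE
  refine ⟨fun p => l.get (p.cast hlen.symm), fun p q h => hsort.monotone_get h, ?_⟩
  apply toMultiset_inj
  rw [toMultiset_content]
  have : List.ofFn (fun p : Fin m.degree => l.get (p.cast hlen.symm)) = l := by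
    apply List.ext_get
    · simp [hlen]
    · intro k h1 h2; simp
  rw [this, hl, Multiset.sort_eq]

open Classical in
theorem coeff_fundamentalSeries {n : ℕ} (c : Composition n) {t : Fin n → ℕ} (ht : Monotone t) :
    MvPowerSeries.coeff (content t) (fundamentalSeries c) =
      if StrictAt (descentSet c) t then 1 else 0 := by
  change ((Set.ncard _ : ℕ) : ℝ) = _
  split_ifs with h
  · have : {s : Fin n → ℕ | Monotone s ∧ StrictAt (descentSet c) s ∧ content s = content t}
        = {t} := by
      ext s
      constructor
      · rintro ⟨h1, -, h3⟩
        exact content_injOn h1 ht h3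
      · rintro rfl
        exact ⟨ht, h, rfl⟩
    rw [this]; simp
  · have : {s : Fin n → ℕ | Monotone s ∧ StrictAt (descentSet c) s ∧ content s = content t}
        = ∅ := by
      ext s
      simp only [Set.mem_ofPred_eq, Set.mem_empty_iff_false, iff_false]
      rintro ⟨h1, h2, h3⟩
      exact h (content_injOn h1 ht h3 ▸ h2)
    rw [this]; simp

theorem coeff_fundamentalSeries_of_ne {n : ℕ} (c : Composition n) {m : ℕ →₀ ℕ}
    (h : m.degree ≠ n) : MvPowerSeries.coeff m (fundamentalSeries c) = 0 := by
  change ((Set.ncard _ : ℕ) : ℝ) = _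
  have : {s : Fin n → ℕ | Monotone s ∧ StrictAt (descentSet c) s ∧ content s = m} = ∅ := by
    ext s
    simp only [Set.mem_ofPred_eq, Set.mem_empty_iff_false, iff_false]
    rintro ⟨-, -, rfl⟩
    exact h (degree_content s)
  rw [this]; simp

/-- The coefficients of a quasi-symmetric series only depend on the relative order of the letters
of the word. -/
theorem IsQuasiSymmetric.coeff_content_eq {f : MvPowerSeries ℕ ℝ} (hf : IsQuasiSymmetric f) {n : ℕ}
    {s t : Fin n → ℕ} (h : ∀ p q, s p < s q ↔ t p < t q) :
    MvPowerSeries.coeff (content s) f = MvPowerSeries.coeff (content t) f := by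
  have heq : ∀ p q, s p = s q ↔ t p = t q := by
    intro p q
    have h1 := h p q
    have h2 := h q p
    constructor <;> intro <;> omega
  set A : Finset ℕ := univ.image s with hA
  set e : Fin A.card ↪o ℕ := A.orderEmbOfFin rfl with he
  have hex : ∀ k, ∃ p, s p = e k := by
    intro k
    have hk : e k ∈ univ.image s := A.orderEmbOfFin_mem rfl k
    obtain ⟨p, -, hp⟩ := Finset.mem_image.1 hk
    exact ⟨p, hp⟩
  choose pk hpk using hex
  have hex' : ∀ p, ∃ k, e k = s p := by
    intro p
    have : s p ∈ Set.range e := by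
      rw [he, Finset.range_orderEmbOfFin]; simp [hA]
    exact this
  choose rho hrho using hex'
  have hmono : StrictMono fun k => t (pk k) := by
    intro k l hkl
    rw [← h, hpk, hpk]
    exact e.strictMono hkl
  have ht : ∀ p, t (pk (rho p)) = t p := by
    intro p
    rw [← heq, hpk, hrho]
  have key := hf A.card (fun k => #{p | rho p = k}) e (fun k => t (pk k)) e.strictMono hmono
  have gen : ∀ (g : Fin A.card → ℕ),
      ∑ k, Finsupp.single (g k) (#{p | rho p = k}) = content fun p => g (rho p) := by
    intro g
    rw [content, ← Finset.sum_fiberwise univ rho]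
    refine Finset.sum_congr rfl fun k _ => ?_
    rw [Finset.sum_congr rfl (g := fun _ => Finsupp.single (g k) 1)
      (fun p hp => by rw [(Finset.mem_filter.1 hp).2])]
    simp
  rw [gen, gen] at key
  simpa only [hrho, ht] using key

theorem isQuasiSymmetric_of_content {f : MvPowerSeries ℕ ℝ}
    (hf : ∀ (n : ℕ) (s t : Fin n → ℕ), Monotone s → Monotone t →
      (∀ p q, s p < s q ↔ t p < t q) →
      MvPowerSeries.coeff (content s) f = MvPowerSeries.coeff (content t) f) :
    IsQuasiSymmetric f := by
  intro r a i j hi hj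
  set l := (∑ k : Fin r, a k • ({k} : Multiset (Fin r))).sort (· ≤ ·) with hl
  have hsort : l.SortedLE := (Multiset.pairwise_sort _ _).sortedLE
  have hmono : Monotone l.get := hsort.monotone_get
  have gen : ∀ g : Fin r → ℕ, ∑ k, Finsupp.single (g k) (a k) = content fun p => g (l.get p) := by
    intro g
    apply toMultiset_inj
    rw [toMultiset_content, map_sum]
    have h1 : List.ofFn (fun p => g (l.get p)) = l.map g := by
      conv_rhs => rw [← List.ofFn_get l, List.map_ofFn]
      rfl
    have h2 : (l.map g : Multiset ℕ) = Multiset.map g (l : Multiset (Fin r)) := rfl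
    rw [h1, h2, hl, Multiset.sort_eq, ← Multiset.coe_mapAddMonoidHom, map_sum]
    refine Finset.sum_congr rfl fun k _ => ?_
    rw [Finsupp.toMultiset_single, map_nsmul]; rfl
  rw [gen, gen]
  refine hf _ _ _ (hi.monotone.comp hmono) (hj.monotone.comp hmono) fun p q => ?_
  rw [hi.lt_iff_lt, hj.lt_iff_lt]

theorem fundamentalSeries_mem {n : ℕ} (c : Composition n) : fundamentalSeries c ∈ QSym := by
  refine ⟨⟨n, fun m hm => coeff_fundamentalSeries_of_ne c hm.ne'⟩,
    isQuasiSymmetric_of_content fun k s t hs ht h => ?_⟩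
  by_cases hk : k = n
  · subst hk
    classical
    rw [coeff_fundamentalSeries c hs, coeff_fundamentalSeries c ht]
    refine if_congr ?_ rfl rfl
    exact forall₂_congr fun p q => by rw [h]
  · rw [coeff_fundamentalSeries_of_ne c (by rwa [degree_content]),
      coeff_fundamentalSeries_of_ne c (by rwa [degree_content])]

/-- `L_c` as an element of `QSym`. -/
def fundamental {n : ℕ} (c : Composition n) : QSym := ⟨fundamentalSeries c, fundamentalSeries_mem c⟩


/-- The weakly increasing sequence of length `n` that increases exactly after the positions in
`T`. -/
def stepSeq {n : ℕ} (T : Finset (Fin (n - 1))) (p : Fin n) : ℕ :=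
  #(T.filter fun k : Fin (n - 1) => (k : ℕ) < p)

theorem stepSeq_mono {n : ℕ} (T : Finset (Fin (n - 1))) : Monotone (stepSeq T) := by
  intro p q h
  refine Finset.card_le_card fun k hk => ?_
  rw [Finset.mem_filter] at hk ⊢
  exact ⟨hk.1, lt_of_lt_of_le hk.2 h⟩

theorem stepSeq_lt_iff {n : ℕ} {T : Finset (Fin (n - 1))} {p q : Fin n} :
    stepSeq T p < stepSeq T q ↔ ∃ k ∈ T, (p : ℕ) ≤ k ∧ (k : ℕ) < q := by
  constructor
  · intro h
    by_contra hcon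
    push Not at hcon
    refine absurd h (not_lt.2 (Finset.card_le_card fun k hk => ?_))
    rw [Finset.mem_filter] at hk ⊢
    refine ⟨hk.1, ?_⟩
    by_contra h2
    exact absurd hk.2 (not_lt.2 (hcon k hk.1 (not_lt.1 h2)))
  · rintro ⟨k, hk, h1, h2⟩
    refine Finset.card_lt_card (Finset.ssubset_iff_of_subset ?_ |>.2 ⟨k, ?_, ?_⟩)
    · intro l hl
      rw [Finset.mem_filter] at hl ⊢
      exact ⟨hl.1, by omega⟩
    · simp [hk, h2]
    · simp; intro; omega

theorem strictAt_iff_of_monotone {n : ℕ} (c : Composition n) (T : Finset (Fin (n - 1))) :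
    StrictAt (descentSet c) (stepSeq T) ↔ descentEquiv n c ⊆ T := by
  constructor
  · intro h k hk
    have := h ⟨k, by omega⟩ ⟨k + 1, by omega⟩ rfl (Finset.mem_image.2 ⟨k, hk, rfl⟩)
    obtain ⟨l, hl, h1, h2⟩ := stepSeq_lt_iff.1 this
    have : l = k := by ext; simp at h1 h2; omega
    exact this ▸ hl
  · intro h p q hpq hq
    obtain ⟨k, hk, hkq⟩ := Finset.mem_image.1 hq
    exact stepSeq_lt_iff.2 ⟨k, h hk, by omega, by omega⟩

/-- The set of positions after which the sequence `t` increases. -/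
def ascents {n : ℕ} (t : Fin n → ℕ) : Finset (Fin (n - 1)) :=
  univ.filter fun k => t ⟨k, by omega⟩ < t ⟨k + 1, by omega⟩

theorem lt_iff_exists_ascent {n : ℕ} {t : Fin n → ℕ} (ht : Monotone t) {p q : Fin n} :
    t p < t q ↔ ∃ k ∈ ascents t, (p : ℕ) ≤ k ∧ (k : ℕ) < q := by
  constructor
  · intro h
    by_contra hcon
    push Not at hcon
    have key : ∀ d : ℕ, ∀ hd : p.val + d < n, p.val + d ≤ q.val → t ⟨p.val + d, hd⟩ = t p := by
      intro d
      induction d with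
      | zero => intro _ _; rfl
      | succ d ih =>
        intro hd hle
        rw [← ih (by omega) (by omega)]
        refine le_antisymm ?_ (ht (by simp [Fin.le_def]))
        by_contra h3
        have : (⟨p.val + d, by omega⟩ : Fin (n - 1)) ∈ ascents t := by
          simp only [ascents, Finset.mem_filter, Finset.mem_univ, true_and]
          exact not_le.1 h3
        have := hcon _ this (by simp)
        simp at this
        omega
    have hpq : p ≤ q := by
      by_contra h4
      exact absurd h (not_lt.2 (ht (not_le.1 h4).le))
    have := key (q - p) (by omega) (by omega)
    have hq : (⟨p.val + (q.val - p.val), by omega⟩ : Fin n) = q := by ext; simp; omega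
    rw [hq] at this
    omega
  · rintro ⟨k, hk, h1, h2⟩
    simp only [ascents, Finset.mem_filter, Finset.mem_univ, true_and] at hk
    refine lt_of_le_of_lt (ht ?_) (lt_of_lt_of_le hk (ht ?_))
    · simpa [Fin.le_def] using h1
    · simpa [Fin.le_def] using h2

theorem coeff_eq_stepSeq {f : MvPowerSeries ℕ ℝ} (hf : IsQuasiSymmetric f) {n : ℕ}
    {t : Fin n → ℕ} (ht : Monotone t) :
    MvPowerSeries.coeff (content t) f = MvPowerSeries.coeff (content (stepSeq (ascents t))) f :=
  hf.coeff_content_eq fun _ _ => by rw [lt_iff_exists_ascent ht, stepSeq_lt_iff]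

theorem QSym_ext {f g : MvPowerSeries ℕ ℝ} (hf : IsQuasiSymmetric f) (hg : IsQuasiSymmetric g)
    (h : ∀ (n : ℕ) (T : Finset (Fin (n - 1))), MvPowerSeries.coeff (content (stepSeq T)) f =
      MvPowerSeries.coeff (content (stepSeq T)) g) : f = g := by
  ext m
  obtain ⟨t, ht, htm⟩ := exists_content_eq m
  rw [← htm, coeff_eq_stepSeq hf ht, coeff_eq_stepSeq hg ht, h]

theorem coeff_stepSeq_fundamental {n k : ℕ} (c : Composition k) (T : Finset (Fin (n - 1))) :
    MvPowerSeries.coeff (content (stepSeq T)) (fundamentalSeries c) =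
      if h : k = n then if descentEquiv n (h ▸ c) ⊆ T then 1 else 0 else 0 := by
  classical
  split_ifs with h h2
  · subst h
    rw [coeff_fundamentalSeries c (stepSeq_mono T), if_pos ((strictAt_iff_of_monotone c T).2 h2)]
  · subst h
    rw [coeff_fundamentalSeries c (stepSeq_mono T),
      if_neg fun h3 => h2 ((strictAt_iff_of_monotone c T).1 h3)]
  · rw [coeff_fundamentalSeries_of_ne c (by rw [degree_content]; exact fun h' => h h'.symm)]

/-- Summation over subsets. -/
def zetaMap (k : ℕ) : (Finset (Fin k) → ℝ) →ₗ[ℝ] (Finset (Fin k) → ℝ) where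
  toFun a T := ∑ S ∈ T.powerset, a S
  map_add' a b := by ext T; simp [Finset.sum_add_distrib]
  map_smul' x a := by ext T; simp [Finset.mul_sum]

theorem zetaMap_injective (k : ℕ) : Function.Injective (zetaMap k) := by
  rw [injective_iff_map_eq_zero]
  intro a ha
  ext T
  induction T using Finset.strongInduction with
  | H T ih =>
    have h : ∑ S ∈ T.powerset, a S = 0 := congrFun ha T
    rw [Finset.sum_eq_single T] at h
    · exact h
    · intro S hS hne
      exact ih S (lt_of_le_of_ne (Finset.mem_powerset.1 hS) hne)
    · simp

theorem zetaMap_surjective (k : ℕ) : Function.Surjective (zetaMap k) :=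
  LinearMap.injective_iff_surjective.1 (zetaMap_injective k)

/-- The family `(L_c)`, indexed by all compositions. -/
def fundamentalFamily (x : Σ n, Composition n) : QSym := fundamental x.2

theorem coeff_sum_fundamental {n : ℕ} (a : Finset (Fin (n - 1)) → ℝ) (T : Finset (Fin (n - 1))) :
    ∑ c : Composition n, a (descentEquiv n c) *
      MvPowerSeries.coeff (content (stepSeq T)) (fundamentalSeries c) = zetaMap (n - 1) a T := by
  rw [← (descentEquiv n).symm.sum_comp]
  simp only [coeff_stepSeq_fundamental, dite_true, Equiv.apply_symm_apply, mul_ite, mul_one,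
    mul_zero]
  rw [← Finset.sum_filter]
  change _ = ∑ S ∈ T.powerset, a S
  refine Finset.sum_congr ?_ fun _ _ => rfl
  ext S; simp

theorem fundamentalFamily_linearIndependent : LinearIndependent ℝ fundamentalFamily := by
  classical
  rw [linearIndependent_iff']
  rintro s g hg
  have hg' : ∀ m, ∑ x ∈ s, g x * MvPowerSeries.coeff m (fundamentalSeries x.2) = 0 := by
    intro m
    have := congrArg (fun f : QSym => MvPowerSeries.coeff m (f : MvPowerSeries ℕ ℝ)) hg
    simpa [fundamentalFamily, fundamental] using this
  rintro ⟨n, c⟩ hc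
  set a : Finset (Fin (n - 1)) → ℝ := fun S =>
    if (⟨n, (descentEquiv n).symm S⟩ : Σ n, Composition n) ∈ s then
      g ⟨n, (descentEquiv n).symm S⟩ else 0 with ha
  have h0 : zetaMap (n - 1) a = 0 := by
    ext T
    have e1 : ∑ c : Composition n, a (descentEquiv n c) *
        MvPowerSeries.coeff (content (stepSeq T)) (fundamentalSeries c) =
        ∑ c : Composition n with (⟨n, c⟩ : Σ n, Composition n) ∈ s, g ⟨n, c⟩ *
          MvPowerSeries.coeff (content (stepSeq T)) (fundamentalSeries c) := by
      rw [Finset.sum_filter]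
      refine Finset.sum_congr rfl fun c _ => ?_
      simp only [ha, Equiv.symm_apply_apply]
      split_ifs <;> simp
    rw [← coeff_sum_fundamental, Pi.zero_apply, ← hg' (content (stepSeq T)), e1]
    refine Finset.sum_of_injOn (Sigma.mk n) (sigma_mk_injective.injOn) ?_ ?_ fun _ _ => rfl
    · intro c hc
      simpa using hc
    · rintro ⟨k, d⟩ hx hnot
      rw [coeff_fundamentalSeries_of_ne, mul_zero]
      rw [degree_content]
      rintro rfl
      exact hnot ⟨d, by simpa using hx, rfl⟩
  have := congrFun (zetaMap_injective _ (h0.trans (map_zero _).symm)) (descentEquiv n c)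
  simpa [ha, hc] using this

theorem quasiSymmetric_coe (f : QSym) : IsQuasiSymmetric (f : MvPowerSeries ℕ ℝ) := f.2.2

theorem fundamentalFamily_span : ⊤ ≤ Submodule.span ℝ (Set.range fundamentalFamily) := by
  rintro f -
  obtain ⟨⟨N, hN⟩, hq⟩ := f.2
  have hex : ∀ n : ℕ, ∃ a : Finset (Fin (n - 1)) → ℝ, zetaMap (n - 1) a =
      fun T => MvPowerSeries.coeff (content (stepSeq (n := n) T)) (f : MvPowerSeries ℕ ℝ) :=
    fun n => zetaMap_surjective _ _
  choose a ha using hex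
  have : f = ∑ n ∈ range (N + 1), ∑ c : Composition n,
      a n (descentEquiv n c) • fundamentalFamily ⟨n, c⟩ := by
    apply Subtype.ext
    refine QSym_ext hq (quasiSymmetric_coe _) fun n T => ?_
    have e1 : MvPowerSeries.coeff (content (stepSeq T)) ((∑ n ∈ range (N + 1), ∑ c : Composition n,
        a n (descentEquiv n c) • fundamentalFamily ⟨n, c⟩ : QSym) : MvPowerSeries ℕ ℝ) =
        ∑ k ∈ range (N + 1), ∑ c : Composition k, a k (descentEquiv k c) *
          MvPowerSeries.coeff (content (stepSeq T)) (fundamentalSeries c) := by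
      simp [fundamentalFamily, fundamental]
    rw [e1]
    by_cases hn : n ≤ N
    · rw [Finset.sum_eq_single n]
      · rw [coeff_sum_fundamental, ha]
      · intro k _ hk
        refine Finset.sum_eq_zero fun c _ => ?_
        rw [coeff_fundamentalSeries_of_ne c (by rw [degree_content]; exact hk.symm), mul_zero]
      · intro h; exact absurd (Finset.mem_range.2 (by omega)) h
    · rw [hN _ (by rw [degree_content]; omega)]
      symm
      refine Finset.sum_eq_zero fun k hk => Finset.sum_eq_zero fun c _ => ?_
      rw [Finset.mem_range] at hk
      rw [coeff_fundamentalSeries_of_ne c (by rw [degree_content]; omega), mul_zero]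
  rw [this]
  exact Submodule.sum_mem _ fun n _ => Submodule.sum_mem _ fun c _ =>
    Submodule.smul_mem _ _ (Submodule.subset_span ⟨_, rfl⟩)

/-- The fundamental basis `(L_c)` of `QSym`, indexed by all compositions. -/
def fundamentalBasis : Module.Basis (Σ n, Composition n) ℝ QSym :=
  Module.Basis.mk fundamentalFamily_linearIndependent fundamentalFamily_span

theorem fundamentalBasis_apply (x : Σ n, Composition n) :
    fundamentalBasis x = fundamental x.2 := by
  rw [fundamentalBasis, Module.Basis.mk_apply]; rfl

/-! ### The coproduct -/

open TensorProduct

/-- For `t = ∑ f ⊗ g` in `QSym ⊗ QSym`, the coefficient of `x^a y^b` in `∑ f(X) g(Y)`. -/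
def tensorCoeff (a b : ℕ →₀ ℕ) : QSym ⊗[ℝ] QSym →ₗ[ℝ] ℝ :=
  LinearMap.mul' ℝ ℝ ∘ₗ TensorProduct.map
    ((MvPowerSeries.coeff a).comp QSym.subtype) ((MvPowerSeries.coeff b).comp QSym.subtype)

theorem tensorCoeff_tmul (a b : ℕ →₀ ℕ) (f g : QSym) :
    tensorCoeff a b (f ⊗ₜ g) = MvPowerSeries.coeff a (f : MvPowerSeries ℕ ℝ) *
      MvPowerSeries.coeff b (g : MvPowerSeries ℕ ℝ) := by
  simp [tensorCoeff]

theorem eq_zero_of_tensorCoeff {t : QSym ⊗[ℝ] QSym} (h : ∀ a b, tensorCoeff a b t = 0) :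
    t = 0 := by
  classical
  have h1 : ∀ b, (TensorProduct.rid ℝ QSym)
      (((MvPowerSeries.coeff b).comp QSym.subtype : QSym →ₗ[ℝ] ℝ).lTensor QSym t) = 0 := by
    intro b
    apply Subtype.ext
    ext a
    refine Eq.trans ?_ (h a b)
    clear h
    induction t with
    | zero => simp
    | tmul f g => rw [tensorCoeff_tmul]; simp [mul_comm]
    | add x y hx hy => simp only [map_add, Submodule.coe_add, hx, hy]
  apply (TensorProduct.equivFinsuppOfBasisLeft fundamentalBasis).injective
  rw [map_zero]
  ext x
  rw [Finsupp.zero_apply]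
  congr 1
  ext b
  have h2 := congrArg (fundamentalBasis.coord x) (h1 b)
  rw [map_zero] at h2
  rw [ZeroMemClass.coe_zero, map_zero, ← h2]
  clear h h1 h2
  induction t with
  | zero => simp
  | tmul f g => simp [mul_comm]
  | add x y hx hy => simp only [map_add, Submodule.coe_add, Finsupp.add_apply, hx, hy]

/-- `D` is the coproduct `Δf(X, Y) = f(X + Y)`: the coefficient of `x^a y^b` in `D f` is its
coefficient in `f(X + Y)`, where in the ordered sum `X + Y` the letters `y₀ < y₁ < ⋯` come after all
the letters `x₀ < x₁ < ⋯`. If only letters `x_i` with `i < M` occur in `x^a`, one may rename `y_j` as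
`x_{j + M}`, for `f` is quasi-symmetric. -/
def IsCoproduct (D : QSym →ₗ[ℝ] QSym ⊗[ℝ] QSym) : Prop :=
  ∀ (f : QSym) (a b : ℕ →₀ ℕ) (M : ℕ), (∀ i ∈ a.support, i < M) →
    tensorCoeff a b (D f) =
      MvPowerSeries.coeff (a + b.mapDomain (· + M)) (f : MvPowerSeries ℕ ℝ)

theorem content_append {i j : ℕ} (s : Fin i → ℕ) (t : Fin j → ℕ) (M : ℕ) :
    content s + (content t).mapDomain (· + M) = content (Fin.append s fun p => t p + M) := by
  simp [content, Fin.sum_univ_add, Finsupp.mapDomain_finsetSum, Finsupp.mapDomain_single]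

theorem descentSet_segment {n : ℕ} {c : Composition n} {i l d : ℕ} :
    d ∈ descentSet (segment c i l) ↔ 0 < d ∧ d < l ∧ d + i ∈ descentSet c := by
  simp [segment, mem_descentSet_ofDescentSet]

theorem strictAt_append {i j : ℕ} (c : Composition (i + j)) {s : Fin i → ℕ} {t : Fin j → ℕ} {M : ℕ}
    (hM : ∀ p, s p < M) :
    StrictAt (descentSet c) (Fin.append s fun p => t p + M) ↔
      StrictAt (descentSet (segment c 0 i)) s ∧ StrictAt (descentSet (segment c i j)) t := by
  constructor
  · intro h
    refine ⟨fun p q hpq hq => ?_, fun p q hpq hq => ?_⟩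
    · have := h (Fin.castAdd j p) (Fin.castAdd j q) (by simpa using hpq)
        (by simpa using (descentSet_segment.1 hq).2.2)
      simpa using this
    · have := h (Fin.natAdd i p) (Fin.natAdd i q) (by simp; omega)
        (by simpa [add_comm] using (descentSet_segment.1 hq).2.2)
      simpa using this
  · rintro ⟨h1, h2⟩ p q hpq hq
    induction p using Fin.addCases with
    | left p =>
      induction q using Fin.addCases with
      | left q =>
        simp only [Fin.append_left]
        simp only [Fin.val_castAdd] at hpq hq
        exact h1 p q hpq (descentSet_segment.2 ⟨by omega, q.2, by simpa using hq⟩)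
      | right q =>
        simp only [Fin.append_left, Fin.append_right]
        have := hM p
        omega
    | right p =>
      induction q using Fin.addCases with
      | left q =>
        simp only [Fin.val_castAdd, Fin.val_natAdd] at hpq
        omega
      | right q =>
        simp only [Fin.append_right]
        simp only [Fin.val_natAdd] at hpq hq
        have := h2 p q (by omega) (descentSet_segment.2 ⟨by omega, q.2, by simpa only [add_comm (q : ℕ) i] using hq⟩)
        omega

theorem exists_isCoproduct : ∃ D, IsCoproduct D := by
  classical
  refine ⟨fundamentalBasis.constr ℝ fun x => ∑ ij ∈ antidiagonal x.1,
    fundamental (segment x.2 0 ij.1) ⊗ₜ[ℝ] fundamental (segment x.2 ij.1 ij.2), ?_⟩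
  intro f a b M hM
  obtain ⟨s, hs, hsa⟩ := exists_content_eq a
  obtain ⟨t, ht, htb⟩ := exists_content_eq b
  generalize a.degree = i at s hs hsa
  generalize b.degree = j at t ht htb
  subst hsa htb
  have hM' : ∀ p, s p < M := by
    intro p
    refine hM _ ?_
    rw [Finsupp.mem_support_iff, content, Finsupp.finsetSum_apply]
    refine (Finset.sum_pos' (fun _ _ => Nat.zero_le _) ⟨p, Finset.mem_univ _, by simp⟩).ne'
  have hmono : Monotone (Fin.append s fun p => t p + M) := by
    intro p q hpq
    induction p using Fin.addCases with
    | left p =>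
      induction q using Fin.addCases with
      | left q => simpa only [Fin.append_left] using hs (Fin.le_def.2 (Fin.le_def.1 hpq))
      | right q => simp only [Fin.append_left, Fin.append_right]; have := hM' p; omega
    | right p =>
      induction q using Fin.addCases with
      | left q => simp [Fin.le_def] at hpq; omega
      | right q => 
        simp only [Fin.append_right]
        have h1 := Fin.le_def.1 hpq
        simp only [Fin.val_natAdd] at h1
        have h2 := ht (Fin.le_def.2 (by omega : (p : ℕ) ≤ q))
        omega
  rw [content_append]
  rw [← fundamentalBasis.linearCombination_repr f]
  induction fundamentalBasis.repr f using Finsupp.induction_linear with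
  | zero => simp
  | add x y hx hy => simp only [map_add, Submodule.coe_add, hx, hy]
  | single x r =>
    obtain ⟨n, c⟩ := x
    rw [Finsupp.linearCombination_single, map_smul, Module.Basis.constr_basis, map_smul, map_sum,
      Submodule.coe_smul, map_smul, fundamentalBasis_apply]
    congr 1
    simp only [fundamental, tensorCoeff_tmul]
    by_cases hn : i + j = n
    · subst hn
      rw [Finset.sum_eq_single (i, j)]
      · rw [coeff_fundamentalSeries _ hs, coeff_fundamentalSeries _ ht,
          coeff_fundamentalSeries _ hmono, if_congr (strictAt_append c hM') rfl rfl]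
        by_cases h1 : StrictAt (descentSet (segment c 0 i)) s <;>
          by_cases h2 : StrictAt (descentSet (segment c i j)) t <;> simp [h1, h2]
      · rintro ⟨k, l⟩ hkl hne
        rw [Finset.HasAntidiagonal.mem_antidiagonal] at hkl
        simp only at hkl
        have : i ≠ k := by
          rintro rfl
          exact hne (by simp; omega)
        rw [coeff_fundamentalSeries_of_ne _ (by rwa [degree_content]), zero_mul]
      · intro h
        exact absurd (by simp) h
    · rw [coeff_fundamentalSeries_of_ne c (by rwa [degree_content])]
      refine Finset.sum_eq_zero ?_
      rintro ⟨k, l⟩ hkl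
      rw [Finset.HasAntidiagonal.mem_antidiagonal] at hkl
      simp only at hkl
      by_cases h1 : i = k
      · have h2 : j ≠ l := by omega
        rw [coeff_fundamentalSeries_of_ne (segment c k l) (by rwa [degree_content]), mul_zero]
      · rw [coeff_fundamentalSeries_of_ne _ (by rwa [degree_content]), zero_mul]

theorem existsUnique_isCoproduct : ∃! D, IsCoproduct D := by
  obtain ⟨D, hD⟩ := exists_isCoproduct
  refine ⟨D, hD, fun D' hD' => LinearMap.ext fun f => sub_eq_zero.1 ?_⟩
  refine eq_zero_of_tensorCoeff fun a b => ?_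
  have hM : ∀ i ∈ a.support, i < a.support.sup id + 1 := fun i hi =>
    Nat.lt_succ_of_le (Finset.le_sup (f := id) hi)
  rw [map_sub, hD f a b _ hM, hD' f a b _ hM, sub_self]

/-- The coproduct `Δ : QSym → QSym ⊗ QSym`, characterised by `Δf(X, Y) = f(X + Y)`. -/
def coproduct : QSym →ₗ[ℝ] QSym ⊗[ℝ] QSym := existsUnique_isCoproduct.choose

theorem isCoproduct_coproduct : IsCoproduct coproduct := existsUnique_isCoproduct.choose_spec.1

/-! ### Specializations of `QSym` -/

/-- The involution `ν` of `QSym` with `ν(L_c) = L_{c̄}`, the antipode up to sign. -/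
def conjugation : QSym →ₗ[ℝ] QSym :=
  fundamentalBasis.constr ℝ fun x => fundamental (conjugate x.2)

/-- The value of the monomial `x^m` at `x = α`. -/
def monomialValue (α : ℕ → ℝ) (m : ℕ →₀ ℕ) : ℝ := m.prod fun i k => α i ^ k

theorem summable_pi_prod {α : ℕ → ℝ} (h0 : ∀ i, 0 ≤ α i) (hs : Summable α) (n : ℕ) :
    Summable fun t : Fin n → ℕ => ∏ p, α (t p) := by
  induction n with
  | zero => exact (hasSum_fintype _).summable
  | succ n ih =>
    rw [← (Fin.consEquiv fun _ : Fin (n + 1) => ℕ).summable_iff]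
    have := hs.mul_of_nonneg ih h0 fun t => Finset.prod_nonneg fun p _ => h0 _
    refine this.congr fun x => ?_
    simp [Fin.consEquiv, Fin.prod_univ_succ]

theorem monomialValue_content (α : ℕ → ℝ) {n : ℕ} (t : Fin n → ℕ) :
    monomialValue α (content t) = ∏ p, α (t p) := by
  rw [monomialValue, content, ← Finsupp.prod_finsetSum_index]
  · simp
  · simp
  · intro i a b; exact pow_add _ _ _

theorem summable_evaluation {α : ℕ → ℝ} (h0 : ∀ i, 0 ≤ α i) (hs : Summable α) (f : QSym) :
    Summable fun m => MvPowerSeries.coeff m (f : MvPowerSeries ℕ ℝ) * monomialValue α m := by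
  classical
  rw [← fundamentalBasis.linearCombination_repr f]
  induction fundamentalBasis.repr f using Finsupp.induction_linear with
  | zero => simp [summable_zero]
  | add x y hx hy =>
    refine (hx.add hy).congr fun m => ?_
    simp only [map_add, Submodule.coe_add, add_mul]
  | single x r =>
    obtain ⟨n, c⟩ := x
    rw [Finsupp.linearCombination_single, fundamentalBasis_apply, Submodule.coe_smul]
    simp only [map_smul, smul_eq_mul, mul_assoc]
    refine Summable.mul_left r ?_
    have hinj : Set.InjOn (content (n := n)) {t | Monotone t} :=
      fun s hs t ht h => content_injOn hs ht h
    have hcomp : Function.Injective fun t : {t : Fin n → ℕ | Monotone t} => content t.1 :=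
      fun s t h => Subtype.ext (content_injOn s.2 t.2 h)
    rw [← hcomp.summable_iff]
    · refine Summable.of_nonneg_of_le ?_ ?_
        ((summable_pi_prod h0 hs n).subtype {t : Fin n → ℕ | Monotone t})
      · intro t
        simp only [Function.comp, fundamental, coeff_fundamentalSeries c t.2, monomialValue_content]
        split_ifs
        · rw [one_mul]; exact Finset.prod_nonneg fun p _ => h0 _
        · simp
      · intro t
        simp only [Function.comp, fundamental, coeff_fundamentalSeries c t.2, monomialValue_content]
        have := Finset.prod_nonneg (s := univ) fun p _ => h0 (t.1 p)
        split_ifs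
        · simp
        · simpa using this
    · intro m hm
      by_cases hd : m.degree = n
      · subst hd
        obtain ⟨t, ht, htm⟩ := exists_content_eq m
        exact absurd ⟨⟨t, ht⟩, htm⟩ hm
      · simp only [fundamental]
        rw [coeff_fundamentalSeries_of_ne c hd, zero_mul]

/-- The specialization `f ↦ f(α₀, α₁, …)` of `QSym`, an absolutely convergent series. -/
def evaluation (α : ℕ → ℝ) (h0 : ∀ i, 0 ≤ α i) (hs : Summable α) : QSym →ₗ[ℝ] ℝ where
  toFun f := ∑' m, MvPowerSeries.coeff m (f : MvPowerSeries ℕ ℝ) * monomialValue α m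
  map_add' f g := by
    rw [← (summable_evaluation h0 hs f).tsum_add (summable_evaluation h0 hs g)]
    simp only [Submodule.coe_add, map_add, add_mul]
  map_smul' x f := by
    rw [RingHom.id_apply, smul_eq_mul, ← tsum_mul_left]
    simp only [Submodule.coe_smul, map_smul, smul_eq_mul, mul_assoc]

/-- The specialization of `QSym` at the exponential alphabet `γE`: `L_c(γE) = γ^n / n!` for `c` of
size `n`. -/
def exponentialSpecialization (γ : ℝ) : QSym →ₗ[ℝ] ℝ :=
  fundamentalBasis.constr ℝ fun x => γ ^ x.1 / (x.1.factorial : ℝ)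

/-- Points `ω = (α, β)` of the Thoma simplex; the sequences are indexed from `0`. -/
structure ThomaSimplex where
  α : ℕ → ℝ
  β : ℕ → ℝ
  α_antitone : Antitone α
  β_antitone : Antitone β
  α_nonneg : ∀ i, 0 ≤ α i
  β_nonneg : ∀ i, 0 ≤ β i
  α_summable : Summable α
  β_summable : Summable β
  sum_le_one : ∑' i, α i + ∑' i, β i ≤ 1

namespace ThomaSimplex

variable (ω : ThomaSimplex)

/-- `γ = 1 - ∑ αᵢ - ∑ βᵢ`. -/
def γ : ℝ := 1 - (∑' i, ω.α i + ∑' i, ω.β i)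

/-- The specialization `f ↦ f(α)` of `QSym`. -/
def evalα : QSym →ₗ[ℝ] ℝ := evaluation ω.α ω.α_nonneg ω.α_summable

/-- The specialization `f ↦ f(β)` of `QSym`. -/
def evalβ : QSym →ₗ[ℝ] ℝ := evaluation ω.β ω.β_nonneg ω.β_summable

/-- The specialization `f ↦ f(A - B + γE)` of `QSym`, where `A = α` and `B̄ = β`:
`[(id ⊗ ν ⊗ id) ∘ (Δ ⊗ id) ∘ Δ] f (A, B̄, γE)`. -/
def specialization : QSym →ₗ[ℝ] ℝ :=
  LinearMap.mul' ℝ ℝ ∘ₗ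
    TensorProduct.map (LinearMap.mul' ℝ ℝ ∘ₗ TensorProduct.map ω.evalα ω.evalβ)
      (exponentialSpecialization ω.γ) ∘ₗ
    TensorProduct.map (TensorProduct.map LinearMap.id conjugation) LinearMap.id ∘ₗ
    TensorProduct.map coproduct LinearMap.id ∘ₗ coproduct

end ThomaSimplex

/-! ### Free quasi-symmetric functions -/

/-- `Std(w) = σ`: the word `w = w₁ ⋯ w_n` has length `n`, and `σ(k)` is the rank of the `k`-th letter
of `w`, where equal letters are ranked from left to right. -/
def IsStandardization {n : ℕ} (w : List ℕ) (σ : Equiv.Perm (Fin n)) : Prop :=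
  ∃ h : w.length = n, ∀ k : Fin n, (σ k : ℕ) = #{l : Fin n |
    w.get (l.cast h.symm) < w.get (k.cast h.symm) ∨
      (w.get (l.cast h.symm) = w.get (k.cast h.symm) ∧ l < k)}

open Classical in
/-- The free quasi-symmetric function `G_σ = ∑_{Std(w) = σ} w`, as a formal series in noncommuting
letters, i.e. as a function on the set of words. -/
def freeG {n : ℕ} (σ : Equiv.Perm (Fin n)) : List ℕ → ℝ := fun w =>
  if IsStandardization w σ then 1 else 0

/-- The map that makes the letters commute: the coefficient of a monomial in the image is the sum of
the coefficients of the (finitely many) words that are rearrangements of it. -/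
def commutativeImage (f : List ℕ → ℝ) : MvPowerSeries ℕ ℝ := fun m =>
  ∑ w ∈ (Multiset.lists (Finsupp.toMultiset m)).toFinset, f w

theorem std_lt_iff {n : ℕ} {w : Fin n → ℕ} {σ : Equiv.Perm (Fin n)}
    (h : ∀ k : Fin n, (σ k : ℕ) = #{l : Fin n | w l < w k ∨ (w l = w k ∧ l < k)}) (p q : Fin n) :
    σ p < σ q ↔ (w p < w q ∨ (w p = w q ∧ p < q)) := by
  have mono : ∀ p q : Fin n, (w p < w q ∨ (w p = w q ∧ p < q)) → σ p < σ q := by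
    intro p q hpq
    rw [Fin.lt_def, h p, h q]
    refine Finset.card_lt_card (Finset.ssubset_iff_of_subset ?_ |>.2 ⟨p, ?_, ?_⟩)
    · intro l hl
      simp only [Finset.mem_filter, Finset.mem_univ, true_and] at hl ⊢
      omega
    · simpa using hpq
    · simp
  refine ⟨fun hlt => ?_, mono p q⟩
  by_contra hcon
  rcases eq_or_ne p q with rfl | hne
  · exact lt_irrefl _ hlt
  · refine lt_asymm hlt (mono q p ?_)
    have : p.val ≠ q.val := fun h => hne (Fin.ext h)
    simp only [Fin.lt_def] at hcon ⊢
    omega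

theorem std_iff {n : ℕ} {w : Fin n → ℕ} {σ : Equiv.Perm (Fin n)} :
    (∀ k : Fin n, (σ k : ℕ) = #{l : Fin n | w l < w k ∨ (w l = w k ∧ l < k)}) ↔
      ∀ p q : Fin n, σ p < σ q ↔ (w p < w q ∨ (w p = w q ∧ p < q)) := by
  refine ⟨std_lt_iff, fun h k => ?_⟩
  have : #{l : Fin n | w l < w k ∨ (w l = w k ∧ l < k)} = #{l : Fin n | σ l < σ k} := by
    congr 1; ext l; simp [h]
  rw [this, ← Finset.card_map σ.toEmbedding]
  have : Finset.map σ.toEmbedding {l : Fin n | σ l < σ k} = Finset.Iio (σ k) := by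
    ext x
    simp only [Finset.mem_map_equiv, Finset.mem_filter, Finset.mem_univ, true_and,
      Equiv.apply_symm_apply, Finset.mem_Iio]
  rw [this, Fin.card_Iio]

theorem isStandardization_ofFn {n : ℕ} {w : Fin n → ℕ} {σ : Equiv.Perm (Fin n)} :
    IsStandardization (List.ofFn w) σ ↔
      ∀ p q : Fin n, σ p < σ q ↔ (w p < w q ∨ (w p = w q ∧ p < q)) := by
  rw [← std_iff]
  simp [IsStandardization]

open Classical in
theorem coeff_commutativeImage_freeG {n : ℕ} (σ : Equiv.Perm (Fin n)) {t : Fin n → ℕ}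
    (ht : Monotone t) :
    MvPowerSeries.coeff (content t) (commutativeImage (freeG σ)) =
      if IsStandardization (List.ofFn (t ∘ σ)) σ then 1 else 0 := by
  change ∑ w ∈ (Multiset.lists (Finsupp.toMultiset (content t))).toFinset, freeG σ w = _
  have hcontent : content (t ∘ σ) = content t := by
    rw [content, content]
    exact Equiv.sum_comp σ fun p => Finsupp.single (t p) 1
  rw [Finset.sum_eq_single (List.ofFn (t ∘ σ))]
  · rfl
  · intro w hw hne
    rw [Multiset.mem_toFinset, Multiset.mem_lists_iff] at hw
    refine if_neg fun hstd => hne ?_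
    obtain ⟨hlen, -⟩ := id hstd
    subst hlen
    have hw' : content w.get = content t := by
      apply toMultiset_inj
      rw [hw, toMultiset_content, List.ofFn_get]; rfl
    have hstd' : IsStandardization (List.ofFn w.get) σ := by rwa [List.ofFn_get]
    rw [isStandardization_ofFn] at hstd'
    have hmono : Monotone (w.get ∘ σ.symm) := by
      intro a b hab
      have := hstd' (σ.symm b) (σ.symm a)
      rw [Equiv.apply_symm_apply, Equiv.apply_symm_apply] at this
      by_contra hlt
      exact absurd (this.2 (Or.inl (not_le.1 hlt))) (not_lt.2 hab)
    have hc : content (w.get ∘ σ.symm) = content t := by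
      rw [← hw', content, content]
      exact Equiv.sum_comp σ.symm fun p => Finsupp.single (w.get p) 1
    have hfin := content_injOn hmono ht hc
    rw [← hfin]
    have : (w.get ∘ σ.symm) ∘ σ = w.get := by ext p; simp
    rw [this, List.ofFn_get]
  · intro hnot
    refine absurd ?_ hnot
    rw [Multiset.mem_toFinset, Multiset.mem_lists_iff, ← hcontent, toMultiset_content]; rfl

theorem commutativeImage_freeG_mem {n : ℕ} (σ : Equiv.Perm (Fin n)) :
    commutativeImage (freeG σ) ∈ QSym := by
  classical
  have hdeg : ∀ m : ℕ →₀ ℕ, m.degree ≠ n →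
      MvPowerSeries.coeff m (commutativeImage (freeG σ)) = 0 := by
    intro m hm
    change ∑ w ∈ (Multiset.lists (Finsupp.toMultiset m)).toFinset, freeG σ w = _
    refine Finset.sum_eq_zero fun w hw => if_neg ?_
    rintro ⟨hlen, -⟩
    rw [Multiset.mem_toFinset, Multiset.mem_lists_iff] at hw
    have := congrArg Multiset.card hw
    rw [Finsupp.card_toMultiset] at this
    exact hm (this.trans hlen)
  refine ⟨⟨n, fun m hm => hdeg m hm.ne'⟩, isQuasiSymmetric_of_content fun k s t hs ht h => ?_⟩
  by_cases hk : k = n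
  · subst hk
    rw [coeff_commutativeImage_freeG σ hs, coeff_commutativeImage_freeG σ ht]
    refine if_congr ?_ rfl rfl
    rw [isStandardization_ofFn, isStandardization_ofFn]
    have heq : ∀ p q, s p = s q ↔ t p = t q := by
      intro p q
      have h1 := h p q
      have h2 := h q p
      constructor <;> intro <;> omega
    simp only [Function.comp, h, heq]
  · rw [hdeg _ (by rwa [degree_content]), hdeg _ (by rwa [degree_content])]

/-- The weight `Q_{n,ω}[σ] = G_σ(A - B + γE)`: the specialization of the quasi-symmetric function
obtained from `G_σ` by making the letters commute. -/
def shuffleWeight (ω : ThomaSimplex) {n : ℕ} (σ : Equiv.Perm (Fin n)) : ℝ :=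
  ω.specialization ⟨commutativeImage (freeG σ), commutativeImage_freeG_mem σ⟩

/-! ### The Robinson-Schensted-Knuth shape -/

/-- Insert the letter `a` in a row: if some entry is greater than `a`, the first such entry `b` is
replaced by `a`, and `some b` is returned; otherwise `a` is added at the end of the row. -/
def rowInsert (a : ℕ) : List ℕ → List ℕ × Option ℕ
  | [] => ([a], none)
  | b :: r => if a < b then (a :: r, some b) else (b :: (rowInsert a r).1, (rowInsert a r).2)

/-- Insert a letter in a tableau, given as the list of its rows: insert it in the first row, and
insert the replaced letter, if there is one, in the tableau formed by the other rows. -/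
def tableauInsert : List (List ℕ) → ℕ → List (List ℕ)
  | [], a => [[a]]
  | r :: T, a =>
    match (rowInsert a r).2 with
    | none => (rowInsert a r).1 :: T
    | some b => (rowInsert a r).1 :: tableauInsert T b

/-- The tableau `P(σ)`: the letters `σ(1), …, σ(n)` are inserted from left to right in the empty
tableau. -/
def insertionTableau {n : ℕ} (σ : Equiv.Perm (Fin n)) : List (List ℕ) :=
  (List.ofFn fun k => (σ k : ℕ)).foldl tableauInsert []

theorem length_rowInsert (a : ℕ) (r : List ℕ) :
    (rowInsert a r).1.length = r.length + if (rowInsert a r).2 = none then 1 else 0 := by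
  induction r with
  | nil => simp [rowInsert]
  | cons b r ih =>
    by_cases h : a < b
    · simp [rowInsert, h]
    · simp only [rowInsert, h, if_false, List.length_cons, ih]; omega

theorem sum_length_tableauInsert (T : List (List ℕ)) (a : ℕ) :
    ((tableauInsert T a).map List.length).sum = (T.map List.length).sum + 1 := by
  induction T generalizing a with
  | nil => simp [tableauInsert]
  | cons r T ih =>
    have h := length_rowInsert a r
    rw [tableauInsert]
    split <;> rename_i h2
    · rw [if_pos h2] at h
      simp only [List.map_cons, List.sum_cons, h]; omega
    · rw [h2] at h
      simp only [List.map_cons, List.sum_cons, ih]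
      simp at h
      omega

theorem sum_length_insertionTableau {n : ℕ} (σ : Equiv.Perm (Fin n)) :
    ((insertionTableau σ).map List.length : Multiset ℕ).sum = n := by
  have key : ∀ (l : List ℕ) (T : List (List ℕ)), ((l.foldl tableauInsert T).map List.length).sum =
      (T.map List.length).sum + l.length := by
    intro l
    induction l with
    | nil => simp
    | cons a l ih =>
      intro T
      rw [List.foldl_cons, ih, sum_length_tableauInsert, List.length_cons]; omega
  rw [Multiset.sum_coe, insertionTableau, key]
  simp

/-- The shape `Λ(σ)` of the tableau `P(σ)`: its parts are the lengths of the rows. -/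
def rskShape {n : ℕ} (σ : Equiv.Perm (Fin n)) : n.Partition :=
  Nat.Partition.ofSums n ((insertionTableau σ).map List.length : Multiset ℕ)
    (sum_length_insertionTableau σ)

/-! ### Irreducible characters of the symmetric groups, and the measures `P_{n,ω}` -/

/-- The conjugate partition `λ'`, followed by some zeros: `λ'_j` is the number of parts of `λ` that
are at least `j`. -/
def conjugateParts {n : ℕ} (lam : n.Partition) : List ℕ :=
  (List.range n).map fun j => lam.parts.countP fun a => j < a

/-- If `{0, …, n - 1}` is cut in consecutive blocks of sizes `b₁, b₂, …`, the number of blocks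
that end before or at `p`; it labels the block that contains `p`. -/
def blockIndex (b : List ℕ) (p : ℕ) : ℕ :=
  #{i ∈ range b.length | (b.take (i + 1)).sum ≤ p}

/-- The polynomial `Δ^b(x₁, …, x_n)`: the product of the Vandermonde products
`∏_{j < k} (x_j - x_k)` of the consecutive blocks of variables of sizes `b₁, b₂, …`. -/
def blockVandermonde (n : ℕ) (b : List ℕ) : MvPolynomial (Fin n) ℂ :=
  ∏ p : Fin n, ∏ q : Fin n with p < q ∧ blockIndex b p = blockIndex b q,
    (MvPolynomial.X p - MvPolynomial.X q)

/-- The action of the symmetric group on `ℂ[x₁, …, x_n]` by permutation of the variables. -/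
def permuteVariables (n : ℕ) :
    Representation ℂ (Equiv.Perm (Fin n)) (MvPolynomial (Fin n) ℂ) where
  toFun σ := (MvPolynomial.rename σ).toLinearMap
  map_one' := by
    exact LinearMap.ext fun f => MvPolynomial.rename_id_apply f
  map_mul' σ τ := by
    exact LinearMap.ext fun f => (MvPolynomial.rename_rename τ σ f).symm

/-- The irreducible module `V^λ`: the space spanned by the polynomials obtained from `Δ^{λ'}` by
permutation of the variables. -/
def irreducibleModule {n : ℕ} (lam : n.Partition) : Subrepresentation (permuteVariables n) where
  toSubmodule := Submodule.span ℂ (Set.range fun σ : Equiv.Perm (Fin n) =>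
    permuteVariables n σ (blockVandermonde n (conjugateParts lam)))
  apply_mem_toSubmodule := by
    intro τ v hv
    induction hv using Submodule.span_induction with
    | mem x hx =>
      obtain ⟨σ, rfl⟩ := hx
      refine Submodule.subset_span ⟨τ * σ, ?_⟩
      simp
    | zero => simp
    | add x y _ _ hx hy => rw [map_add]; exact Submodule.add_mem _ hx hy
    | smul a x _ hx => rw [map_smul]; exact Submodule.smul_mem _ _ hx

/-- The normalized irreducible character `χ^λ = ζ^λ / dim V^λ`. -/
def normalizedCharacter {n : ℕ} (lam : n.Partition) (σ : Equiv.Perm (Fin n)) : ℂ :=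
  (irreducibleModule lam).toRepresentation.character σ /
    Module.finrank ℂ (irreducibleModule lam).toSubmodule

/-- The power sums `p_k(A - B + γE)`: one has `p_1(A - B + γE) = ∑ αᵢ + ∑ βᵢ + γ = 1`, and
`p_k(A - B + γE) = ∑ αᵢ^k + (-1)^{k-1} ∑ βᵢ^k` for `k ≥ 2`. -/
def powerSum (ω : ThomaSimplex) (k : ℕ) : ℝ :=
  ∑' i, ω.α i ^ k + (-1) ^ (k - 1) * ∑' i, ω.β i ^ k + if k = 1 then ω.γ else 0

/-- The restriction to `S_n` of the extremal character `χ^ω` of the infinite symmetric group: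
`χ^ω(σ) = p_μ(A - B + γE)`, where `μ` is the cycle type of `σ` (fixed points included). -/
def extremalCharacter (ω : ThomaSimplex) {n : ℕ} (σ : Equiv.Perm (Fin n)) : ℝ :=
  (σ.partition.parts.map (powerSum ω)).prod

/-- `P` is the family of the coefficients `P_{n,ω}[λ]` of the expansion
`χ^ω|_{S_n} = ∑_λ P_{n,ω}[λ] χ^λ` in normalized irreducible characters. -/
def IsCharacterExpansion (ω : ThomaSimplex) {n : ℕ} (P : n.Partition → ℝ) : Prop :=
  ∀ σ : Equiv.Perm (Fin n),
    (extremalCharacter ω σ : ℂ) = ∑ lam, (P lam : ℂ) * normalizedCharacter lam σ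

end

end ThomaShuffle

open Finset

namespace ThomaShuffle

noncomputable section

open TensorProduct

/-! For a permutation g let p_g be the product of the power sums p_l over the cycle lengths l of g,
fixed points included. Its coefficient at x^m is the number of words of content m fixed by g
(`ncard_letterFamilies_cycleLength`). The heart of the proof is the identity p_g = ∑_λ χ^λ(g)
∑_{Λ(σ) = λ} G_σ with commuting letters; specializing it at A - B + γE gives the expansion of χ^ω.

The left side specializes to χ^ω(g) (`specialization_powerProduct`): the coproduct of a product of
power sums distributes the factors over the two alphabets, and ν acts on power sums by the sign
(-1)^(l-1), because L_c ↦ (-1)^n L_c̄ evaluated at an alphabet is the convolution inverse of the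
evaluation itself (`sum_evaluation_mul_evaluation_conjugate`, an alternating sum over words that
telescopes).

For the right side, compare coefficients at the content of an increasing word t. The coefficient of
the sum of the G_σ of shape λ counts the σ of shape λ whose recoils avoid the runs of t. By the
Robinson-Schensted correspondence (`bijOn_robinsonSchensted`) this is the Kostka number K(λ,t) times
the number of standard tableaux of shape λ, which is dim V^λ (`kostka_val`). So what is needed is
Young's rule, that the number of fixed words is ∑_λ K(λ,t) ζ^λ(g) (`wordCharacter_eq_sum_kostka`).

Young's rule comes from a uniqueness of triangular factorizations, without a basis of V^λ. Let
M(λ,t) be the multiplicity of V^λ in the module of words. Both K and M are unitriangular for the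
weight ∑ i·m_i of contents: K because a Yamanouchi word that decreases along the runs of t is
bounded by t, and M because a homomorphism sends Δ^{λ'} to a polynomial antisymmetric in every
block, whose exponents cannot have a smaller sum. Both have the same Gram matrix, namely the scalar
products of the characters of the modules of words: for M this is orthogonality, for K it is
Burnside's lemma on words in pairs of letters, whose increasing representatives are encoded by
permutations and counted by Robinson-Schensted. An induction on the weight then gives K = M
(`wordMultiplicity_content`).

Uniqueness of the expansion is the linear independence of the characters, and total mass one is the
identity at g = 1. The explicit formula holds because G_σ becomes L_c, with c the recoil composition
(`commutativeImage_freeG`), and because the coproduct cuts the ribbon of c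
(`coproduct_fundamental`); positivity is visible on that formula.

Standardness of a tableau is encoded by counts: rows increase and, for each k, a row has at least as
many letters below k as the next one. Read on the word of the rows of the letters 0, 1, …, this is
the Yamanouchi condition. -/

/-! ### Row insertion -/

/-- The row in which the insertion of a letter in a tableau creates a new box. -/
def insertionRow : List (List ℕ) → ℕ → ℕ
  | [], _ => 0
  | r :: T, a =>
    match (rowInsert a r).2 with
    | none => 0
    | some b => insertionRow T b + 1

/-- The rows of `T` are nonempty and increasing, and for every `k` the restriction of `T` to the
letters `< k` has weakly decreasing row lengths. -/
def IsTableau : List (List ℕ) → Prop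
  | [] => True
  | r :: T => r ≠ [] ∧ r.Pairwise (· < ·) ∧
      (∀ k, (T.headD []).countP (· < k) ≤ r.countP (· < k)) ∧ IsTableau T

/-- The rows of a tableau, read from bottom to top. -/
def readingWord : List (List ℕ) → List ℕ
  | [] => []
  | r :: T => readingWord T ++ r

theorem rowInsert_append_of_lt {a : ℕ} {u : List ℕ} (hu : ∀ x ∈ u, x < a) (v : List ℕ) :
    rowInsert a (u ++ v) = (u ++ (rowInsert a v).1, (rowInsert a v).2) := by
  induction u with
  | nil => simp
  | cons x u ih =>
    have hx := hu x (by simp)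
    simp [rowInsert, not_lt.2 hx.le, ih fun y hy => hu y (by simp [hy])]

theorem rowInsert_none {a : ℕ} {r : List ℕ} (h : ∀ x ∈ r, x < a) :
    rowInsert a r = (r ++ [a], none) := by
  simpa [rowInsert] using rowInsert_append_of_lt h []

theorem rowInsert_some {a b : ℕ} {u : List ℕ} (h : ∀ x ∈ u, x < a) (hab : a < b) (v : List ℕ) :
    rowInsert a (u ++ b :: v) = (u ++ a :: v, some b) := by
  rw [rowInsert_append_of_lt h]
  simp [rowInsert, hab]

/-- Either all the letters of a row are smaller than `a`, or the row splits at the letter replaced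
by `a`. -/
theorem forall_lt_or_exists_split {r : List ℕ} (hr : r.Pairwise (· < ·)) {a : ℕ} (ha : a ∉ r) :
    (∀ x ∈ r, x < a) ∨
      ∃ u b v, r = u ++ b :: v ∧ (∀ x ∈ u, x < a) ∧ a < b ∧ ∀ x ∈ v, b < x := by
  induction r with
  | nil => simp
  | cons x r ih =>
    simp only [List.mem_cons, not_or] at ha
    rw [List.pairwise_cons] at hr
    rcases lt_or_gt_of_ne ha.1 with h | h
    · exact Or.inr ⟨[], x, r, rfl, by simp, h, hr.1⟩
    · rcases ih hr.2 ha.2 with h1 | ⟨u, b, v, rfl, hu, hb, hv⟩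
      · left; simpa using ⟨h, h1⟩
      · exact Or.inr ⟨x :: u, b, v, rfl, by simpa using ⟨h, hu⟩, hb, hv⟩

theorem tableauInsert_none {a : ℕ} {r : List ℕ} (h : ∀ x ∈ r, x < a) (T : List (List ℕ)) :
    tableauInsert (r :: T) a = (r ++ [a]) :: T := by
  rw [tableauInsert, rowInsert_none h]

theorem tableauInsert_some {a b : ℕ} {u : List ℕ} (h : ∀ x ∈ u, x < a) (hab : a < b) (v : List ℕ)
    (T : List (List ℕ)) :
    tableauInsert ((u ++ b :: v) :: T) a = (u ++ a :: v) :: tableauInsert T b := by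
  rw [tableauInsert, rowInsert_some h hab]

theorem insertionRow_none {a : ℕ} {r : List ℕ} (h : ∀ x ∈ r, x < a) (T : List (List ℕ)) :
    insertionRow (r :: T) a = 0 := by
  rw [insertionRow, rowInsert_none h]

theorem insertionRow_some {a b : ℕ} {u : List ℕ} (h : ∀ x ∈ u, x < a) (hab : a < b) (v : List ℕ)
    (T : List (List ℕ)) :
    insertionRow ((u ++ b :: v) :: T) a = insertionRow T b + 1 := by
  rw [insertionRow, rowInsert_some h hab]

theorem pairwise_lt_split {u v : List ℕ} {b : ℕ} :
    (u ++ b :: v).Pairwise (· < ·) ↔ u.Pairwise (· < ·) ∧ v.Pairwise (· < ·) ∧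
      (∀ x ∈ u, x < b) ∧ (∀ x ∈ v, b < x) ∧ ∀ x ∈ u, ∀ y ∈ v, x < y := by
  simp only [List.pairwise_append, List.pairwise_cons, List.mem_cons, forall_eq_or_imp, imp_and,
    forall_and]
  tauto

/-- A case analysis for the insertion of a letter in the first row of a tableau. -/
theorem IsTableau.insert_cases {r : List ℕ} {T : List (List ℕ)} (h : IsTableau (r :: T)) {a : ℕ}
    (ha : (a :: (r :: T).flatten).Nodup) :
    ((∀ x ∈ r, x < a) ∧ tableauInsert (r :: T) a = (r ++ [a]) :: T ∧
        insertionRow (r :: T) a = 0) ∨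
      ∃ u b v, r = u ++ b :: v ∧ (∀ x ∈ u, x < a) ∧ a < b ∧ (∀ x ∈ v, b < x) ∧
        (b :: T.flatten).Nodup ∧
        tableauInsert (r :: T) a = (u ++ a :: v) :: tableauInsert T b ∧
        insertionRow (r :: T) a = insertionRow T b + 1 := by
  have har : a ∉ r := by
    rw [List.nodup_cons] at ha
    intro h'; exact ha.1 (by simp [h'])
  rcases forall_lt_or_exists_split h.2.1 har with h1 | ⟨u, b, v, rfl, hu, hb, hv⟩
  · exact Or.inl ⟨h1, tableauInsert_none h1 T, insertionRow_none h1 T⟩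
  · refine Or.inr ⟨u, b, v, rfl, hu, hb, hv, ?_, tableauInsert_some hu hb v T,
      insertionRow_some hu hb v T⟩
    rw [List.flatten_cons, List.nodup_cons, List.nodup_append] at ha
    rw [List.nodup_cons]
    exact ⟨fun hbT => ha.2.2.2 b (by simp) b hbT rfl, ha.2.2.1⟩

theorem flatten_tableauInsert_perm {T : List (List ℕ)} (hT : IsTableau T) {a : ℕ}
    (ha : (a :: T.flatten).Nodup) : (tableauInsert T a).flatten.Perm (a :: T.flatten) := by
  induction T generalizing a with
  | nil => simp [tableauInsert]
  | cons r T ih =>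
    rcases hT.insert_cases ha with ⟨-, h, -⟩ | ⟨u, b, v, rfl, -, -, -, hb, h, -⟩
    · rw [h, List.flatten_cons, List.flatten_cons, List.append_assoc]
      exact List.perm_middle
    · rw [h, List.flatten_cons, List.flatten_cons]
      have h1 := ih hT.2.2.2 hb
      refine (List.Perm.append_left _ h1).trans ?_
      simp only [List.append_assoc, List.cons_append]
      refine List.perm_middle.trans (List.Perm.cons a ?_)
      exact List.Perm.append_left u List.perm_middle

theorem countP_lt_eq_length {u : List ℕ} {k : ℕ} (h : ∀ x ∈ u, x < k) :
    u.countP (· < k) = u.length := by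
  rw [List.countP_eq_length]; simpa using h

theorem countP_lt_eq_zero {u : List ℕ} {k : ℕ} (h : ∀ x ∈ u, k ≤ x) :
    u.countP (· < k) = 0 := by
  rw [List.countP_eq_zero]; simpa using h

theorem countP_lt_mono (u : List ℕ) {k l : ℕ} (h : k ≤ l) :
    u.countP (· < k) ≤ u.countP (· < l) :=
  List.countP_mono_left fun x _ hx => by simp only [decide_eq_true_eq] at hx ⊢; omega

/-- The effect of an insertion on the numbers of small letters in the first row. -/
theorem IsTableau.countP_head_tableauInsert {T : List (List ℕ)} (hT : IsTableau T) {a : ℕ}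
    (ha : (a :: T.flatten).Nodup) (k : ℕ) :
    (T.headD []).countP (· < k) ≤ ((tableauInsert T a).headD []).countP (· < k) ∧
    (k ≤ a → ((tableauInsert T a).headD []).countP (· < k) = (T.headD []).countP (· < k)) ∧
    (a < k → ((tableauInsert T a).headD []).countP (· < k) ≤
      max ((T.headD []).countP (· < k)) ((T.headD []).countP (· < a) + 1)) ∧
    (a < k → (T.headD []).countP (· < a) + 1 ≤
      ((tableauInsert T a).headD []).countP (· < k)) := by
  cases T with
  | nil =>
    simp only [tableauInsert, List.headD_cons, List.headD_nil, List.countP_nil]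
    by_cases h : a < k <;> simp [h]
  | cons r T =>
    rcases hT.insert_cases ha with ⟨hr, h, -⟩ | ⟨u, b, v, rfl, hu, hab, hv, -, h, -⟩
    · rw [h]
      simp only [List.headD_cons, List.countP_append, List.countP_singleton, decide_eq_true_eq]
      have h1 := countP_lt_eq_length hr
      have h2 := r.countP_le_length (p := (· < k))
      by_cases hk : a < k
      · rw [if_pos hk]
        have h3 := countP_lt_mono r hk.le
        omega
      · rw [if_neg hk]; omega
    · rw [h]
      simp only [List.headD_cons, List.countP_append, List.countP_cons, decide_eq_true_eq]
      have h1 := countP_lt_eq_length hu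
      have h2 := u.countP_le_length (p := (· < k))
      have h3 := countP_lt_eq_zero (u := v) (k := a) fun x hx => (hab.trans (hv x hx)).le
      have h4 : k ≤ b → v.countP (· < k) = 0 := fun hk =>
        countP_lt_eq_zero fun x hx => hk.trans (hv x hx).le
      have h5 := fun hk : a ≤ k => countP_lt_mono u hk
      split_ifs <;> omega

/-- Rows stay increasing because the replaced letter is the first one greater than `a`; the only
real check is the comparison of the counts of the first two rows, both of which have changed. -/
theorem IsTableau.tableauInsert {T : List (List ℕ)} (hT : IsTableau T) {a : ℕ}
    (ha : (a :: T.flatten).Nodup) : IsTableau (tableauInsert T a) := by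
  induction T generalizing a with
  | nil => simp [ThomaShuffle.tableauInsert, IsTableau]
  | cons r T ih =>
    rcases hT.insert_cases ha with ⟨hr, h, -⟩ | ⟨u, b, v, rfl, hu, hab, hv, hb, h, -⟩
    · rw [h]
      refine ⟨by simp, ?_, fun k => ?_, hT.2.2.2⟩
      · rw [List.pairwise_append]
        exact ⟨hT.2.1, by simp, by simpa using hr⟩
      · rw [List.countP_append]
        exact (hT.2.2.1 k).trans (Nat.le_add_right _ _)
    · rw [h]
      have hp := pairwise_lt_split.1 hT.2.1
      refine ⟨by simp, ?_, fun k => ?_, ih hT.2.2.2 hb⟩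
      · exact pairwise_lt_split.2 ⟨hp.1, hp.2.1, hu, fun x hx => hab.trans (hv x hx), hp.2.2.2.2⟩
      · obtain ⟨-, h2, h3, -⟩ := hT.2.2.2.countP_head_tableauInsert hb k
        have h4 := hT.2.2.1 k
        have h5 := hT.2.2.1 b
        simp only [List.countP_append, List.countP_cons, decide_eq_true_eq, lt_irrefl, if_false]
          at h4 h5 ⊢
        -- For `k ≤ b` the second row is unchanged below `k`. For `k > b` its count may reach its
        -- old count below `b` plus one, and the letter `a`, which took the place of `b`, supplies
        -- that one in the first row.
        by_cases hk : k ≤ b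
        · rw [h2 hk]
          split_ifs at h4 ⊢ <;> omega
        · have h6 := h3 (by omega)
          have h7 := countP_lt_mono u (by omega : b ≤ k)
          have h8 := countP_lt_mono v (by omega : b ≤ k)
          rw [if_pos (by omega)] at h4 ⊢
          omega

/-! ### Row lengths and row bumping. -/

/-- The length of the `i`-th row of a tableau. -/
def rowLength (T : List (List ℕ)) (i : ℕ) : ℕ := (T.getD i []).length

@[simp] theorem rowLength_nil (i : ℕ) : rowLength [] i = 0 := by simp [rowLength]

@[simp] theorem rowLength_cons_zero (r : List ℕ) (T : List (List ℕ)) :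
    rowLength (r :: T) 0 = r.length := by simp [rowLength]

@[simp] theorem rowLength_cons_succ (r : List ℕ) (T : List (List ℕ)) (i : ℕ) :
    rowLength (r :: T) (i + 1) = rowLength T i := by simp [rowLength]

theorem rowLength_tableauInsert (T : List (List ℕ)) (a i : ℕ) :
    rowLength (tableauInsert T a) i = rowLength T i + if i = insertionRow T a then 1 else 0 := by
  induction T generalizing a i with
  | nil =>
    rcases i with _ | i <;> simp [tableauInsert, insertionRow]
  | cons r T ih =>
    have h := length_rowInsert a r
    rw [tableauInsert, insertionRow]
    cases h2 : (rowInsert a r).2 with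
    | none =>
      rw [if_pos h2] at h
      rcases i with _ | i <;> simp [h]
    | some b =>
      rw [h2] at h
      rcases i with _ | i
      · simpa using h
      · simp [ih]

theorem IsTableau.rowLength_succ_le {T : List (List ℕ)} (hT : IsTableau T) (i : ℕ) :
    rowLength T (i + 1) ≤ rowLength T i := by
  induction T generalizing i with
  | nil => simp
  | cons r T ih =>
    rcases i with _ | i
    · rw [rowLength_cons_zero, rowLength_cons_succ]
      have h : rowLength T 0 = (T.headD []).length := by cases T <;> simp
      rw [h]
      -- A bound that exceeds every letter of both rows turns the counts into lengths; the sum of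
      -- all these letters plus one is such a bound.
      have h1 := hT.2.2.1 (((T.headD []).sum + r.sum) + 1)
      rw [countP_lt_eq_length, countP_lt_eq_length] at h1
      · exact h1
      · intro x hx; have := List.le_sum_of_mem hx; omega
      · intro x hx; have := List.le_sum_of_mem hx; omega
    · simpa using ih hT.2.2.2 i

/-- Row bumping: of two letters inserted successively, the second creates a strictly lower box if
and only if it is smaller. -/
theorem IsTableau.insertionRow_le_iff {T : List (List ℕ)} (hT : IsTableau T) {a b : ℕ}
    (h : (b :: a :: T.flatten).Nodup) :
    insertionRow (ThomaShuffle.tableauInsert T a) b ≤ insertionRow T a ↔ a < b := by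
  induction T generalizing a b with
  | nil =>
    simp only [List.flatten_nil, List.nodup_cons, List.mem_cons, not_or] at h
    have h' : b ≠ a := h.1.1
    rcases lt_or_gt_of_ne h' with h1 | h1
    · simp [ThomaShuffle.tableauInsert, insertionRow, rowInsert, h1, h1.le]
    · simp [ThomaShuffle.tableauInsert, insertionRow, rowInsert, h1, not_lt.2 h1.le]
  | cons r T ih =>
    have ha := (List.nodup_cons.1 h).2
    have hb : (b :: (ThomaShuffle.tableauInsert (r :: T) a).flatten).Nodup :=
      ((flatten_tableauInsert_perm hT ha).cons b).nodup_iff.2 h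
    have hne : b ≠ a := fun h' => (List.nodup_cons.1 h).1 (by simp [h'])
    have hT' := hT.tableauInsert ha
    rcases hT.insert_cases ha with ⟨hr, hi, hz⟩ | ⟨u, c, v, rfl, hu, hac, hv, hc, hi, hz⟩
    · rw [hi] at hT' hb ⊢
      rw [hz]
      rcases hT'.insert_cases hb with ⟨h1, -, h2⟩ | ⟨u, c, v, h1, h2, h3, h4, -, -, h5⟩
      · rw [h2]; simpa using h1 a (by simp)
      · rw [h5]
        -- The letter `c` replaced by `b` lies in the row `r ++ [a]`, whose maximum is `a`; hence `b
        -- < c ≤ a`.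
        have hca : c ≤ a := by
          have : c ∈ r ++ [a] := by rw [h1]; simp
          simp only [List.mem_append, List.mem_singleton] at this
          rcases this with h6 | h6
          · exact (hr c h6).le
          · exact h6.le
        omega
    · rw [hi] at hT' hb ⊢
      rw [hz]
      have hp := pairwise_lt_split.1 hT.2.1
      have hnb : ∀ x ∈ u ++ c :: v, x ≠ b := by
        intro x hx hxb
        refine (List.nodup_cons.1 h).1 ?_
        rw [List.mem_cons, List.flatten_cons, List.mem_append]
        exact Or.inr (Or.inl (hxb ▸ hx))
      rcases hT'.insert_cases hb with ⟨h1, -, h2⟩ | ⟨u', c', v', h1, h2, h3, h4, h5, -, h6⟩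
      · rw [h2]
        have := h1 a (by simp)
        omega
      -- Both insertions bump: `a` expels `c` and `b` expels `c'`. The induction hypothesis compares
      -- the insertions of `c` and `c'` in the rows below, so it remains to see that `c < c'`
      -- exactly when `a < b`.
      · rw [h6, Nat.add_le_add_iff_right]
        have hc' : c' ∈ u ++ a :: v := by rw [h1]; simp
        have hnd : (c' :: c :: T.flatten).Nodup := by
          rw [List.nodup_cons] at h5
          have h7 := (flatten_tableauInsert_perm hT.2.2.2 hc).mem_iff (a := c')
          rw [List.nodup_cons]
          exact ⟨fun h8 => h5.1 (h7.2 h8), hc⟩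
        rw [ih hT.2.2.2 hnd]
        rcases lt_or_gt_of_ne hne with h7 | h7
        · have : c' ≤ a := by
            by_contra h8
            have h9 : a ∈ u' ++ c' :: v' := by rw [← h1]; simp
            simp only [List.mem_append, List.mem_cons] at h9
            rcases h9 with h9 | h9 | h9
            · have := h2 a h9; omega
            · omega
            · have := h4 a h9; omega
          omega
        · have : c' ∈ v := by
            simp only [List.mem_append, List.mem_cons] at hc'
            rcases hc' with h9 | h9 | h9
            · have := hu c' h9; omega
            · omega
            · exact h9
          have := hv c' this
          omega

/-! ### Reverse insertion -/

/-- No letter of the row equals `b`, and the letters below `b` form the prefix `u ++ [a]`; so the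
letter that `b` displaces in a reverse insertion, and its place, are determined by `b`. -/
theorem split_unique {u v u' v' : List ℕ} {a a' b : ℕ} (h : u ++ a :: v = u' ++ a' :: v')
    (ha : a < b) (ha' : a' < b) (hu : ∀ x ∈ u, x < b) (hu' : ∀ x ∈ u', x < b)
    (hv : ∀ x ∈ v, b < x) (hv' : ∀ x ∈ v', b < x) : u = u' ∧ a = a' ∧ v = v' := by
  have key : ∀ {u v : List ℕ} {a : ℕ}, a < b → (∀ x ∈ u, x < b) → (∀ x ∈ v, b < x) →
      (u ++ a :: v).filter (· < b) = u ++ [a] := by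
    intro u v a ha hu hv
    rw [List.filter_append, List.filter_cons_of_pos (by simpa using ha),
      List.filter_eq_self.2 (by simpa using hu),
      List.filter_eq_nil_iff.2 (by simpa using fun x hx => (hv x hx).le)]
  have h1 := key ha hu hv
  rw [h, key ha' hu' hv'] at h1
  obtain ⟨h2, h3⟩ := List.append_inj' h1 rfl
  subst h2
  rw [List.cons.injEq] at h3
  obtain rfl := h3.1
  simpa using h

/-- The tableau and the inserted letter can be recovered from the result of an insertion and the
position of the new box. -/
theorem tableauInsert_injective {T U : List (List ℕ)} (hT : IsTableau T) (hU : IsTableau U)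
    {a b : ℕ} (ha : (a :: T.flatten).Nodup) (hb : (b :: U.flatten).Nodup)
    (h : tableauInsert T a = tableauInsert U b) (hi : insertionRow T a = insertionRow U b) :
    T = U ∧ a = b := by
  induction T generalizing U a b with
  | nil =>
    cases U with
    | nil => simpa [tableauInsert] using h
    | cons s U =>
      exfalso
      rcases hU.insert_cases hb with ⟨-, h1, -⟩ | ⟨u, c, v, -, -, -, -, -, -, h1⟩
      · rw [h1, tableauInsert, List.cons.injEq] at h
        have := congrArg List.length h.1
        exact hU.1 (by simpa using this)
      · rw [h1] at hi
        simp [insertionRow] at hi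
  | cons r T ih =>
    cases U with
    | nil =>
      exfalso
      rcases hT.insert_cases ha with ⟨-, h1, -⟩ | ⟨u, c, v, -, -, -, -, -, -, h1⟩
      · rw [h1, tableauInsert, List.cons.injEq] at h
        have := congrArg List.length h.1
        exact hT.1 (by simpa using this)
      · rw [h1] at hi
        simp [insertionRow] at hi
    | cons s U =>
      rcases hT.insert_cases ha with ⟨-, h1, h2⟩ | ⟨u, c, v, rfl, hu, hac, hv, hc, h1, h2⟩ <;>
        rcases hU.insert_cases hb with ⟨-, h3, h4⟩ | ⟨u', c', v', rfl, hu', hac', hv', hc', h3, h4⟩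
      · rw [h1, h3, List.cons.injEq] at h
        obtain ⟨h5, h6⟩ := List.append_inj' h.1 rfl
        rw [h5, h.2]
        simpa using h6
      · omega
      · omega
      · rw [h1, h3, List.cons.injEq] at h
        obtain ⟨rfl, rfl⟩ := ih hT.2.2.2 hU.2.2.2 hc hc' h.2 (by omega)
        obtain ⟨rfl, rfl, rfl⟩ := split_unique h.1 hac hac' (fun x hx => (hu x hx).trans hac)
          (fun x hx => (hu' x hx).trans hac') hv hv'
        exact ⟨rfl, rfl⟩

/-- `a` is the last letter smaller than `b`, the one that `b` replaces when it moves up in a reverse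
insertion. -/
theorem exists_split_of_countP_pos {r : List ℕ} (hr : r.Pairwise (· < ·)) {b : ℕ} (hb : b ∉ r)
    (h : 0 < r.countP (· < b)) : ∃ u a v, r = u ++ a :: v ∧ a < b ∧ ∀ x ∈ v, b < x := by
  induction r with
  | nil => simp at h
  | cons x r ih =>
    rw [List.pairwise_cons] at hr
    simp only [List.mem_cons, not_or] at hb
    by_cases h0 : 0 < r.countP (· < b)
    · obtain ⟨u, a, v, rfl, h1, h2⟩ := ih hr.2 hb.2 h0
      exact ⟨x :: u, a, v, rfl, h1, h2⟩
    · refine ⟨[], x, r, rfl, ?_, fun y hy => ?_⟩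
      · rw [List.countP_cons] at h
        by_contra h1
        simp [h1] at h
        exact h0 (List.countP_pos_iff.2 (by simpa using h))
      · by_contra h1
        refine h0 (List.countP_pos_iff.2 ⟨y, hy, ?_⟩)
        have : y ≠ b := fun h2 => hb.2 (h2 ▸ hy)
        simp; omega

/-- Reverse insertion: the hypothesis says that row `i` ends in a corner. In the top row the last
letter is removed. Otherwise the rows below give up a letter `b` by induction, and `b` replaces the
largest smaller letter of the first row, which is the letter sought. -/
theorem exists_tableauInsert_eq {T' : List (List ℕ)} (hT' : IsTableau T') (hn : T'.flatten.Nodup)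
    {i : ℕ} (hi : rowLength T' (i + 1) < rowLength T' i) :
    ∃ T a, IsTableau T ∧ (a :: T.flatten).Nodup ∧ tableauInsert T a = T' ∧
      insertionRow T a = i := by
  induction T' generalizing i with
  | nil => simp at hi
  | cons r T' ih =>
    rcases i with _ | i
    · obtain ⟨u, a, rfl⟩ := (List.eq_nil_or_concat r).resolve_left hT'.1
      rw [List.concat_eq_append] at *
      have hp := hT'.2.1
      rw [List.pairwise_append] at hp
      have hua : ∀ x ∈ u, x < a := fun x hx => hp.2.2 x hx a (by simp)
      simp only [rowLength_cons_zero, rowLength_cons_succ, List.length_append,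
        List.length_singleton] at hi
      by_cases hu : u = []
      · subst hu
        have : T' = [] := by
          cases T' with
          | nil => rfl
          | cons s T' =>
            exact absurd (by simpa using hi) hT'.2.2.2.1
        subst this
        exact ⟨[], a, trivial, by simp, by simp [tableauInsert], by simp [insertionRow]⟩
      · have hnd : (a :: (u :: T').flatten).Nodup := by
          refine List.Perm.nodup_iff ?_ |>.1 hn
          rw [List.flatten_cons, List.flatten_cons, List.append_assoc]
          exact List.perm_middle
        refine ⟨u :: T', a, ⟨hu, hp.1, fun k => ?_, hT'.2.2.2⟩, hnd,
          tableauInsert_none hua T', insertionRow_none hua T'⟩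
        have h1 := hT'.2.2.1 k
        rw [List.countP_append] at h1
        by_cases hk : k ≤ a
        · rwa [countP_lt_eq_zero (u := [a]) (by simpa using hk), add_zero] at h1
        · rw [countP_lt_eq_length (u := u) fun x hx => (hua x hx).trans (by omega)]
          refine (List.countP_le_length).trans ?_
          have : (T'.headD []).length = rowLength T' 0 := by cases T' <;> simp
          omega
    · simp only [rowLength_cons_succ] at hi
      rw [List.flatten_cons, List.nodup_append] at hn
      obtain ⟨T, b, hT, hb, hTb, hrow⟩ := ih hT'.2.2.2 hn.2.1 hi
      have hmem : ∀ x, x ∈ T'.flatten ↔ x ∈ b :: T.flatten := by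
        intro x; rw [← hTb]; exact (flatten_tableauInsert_perm hT hb).mem_iff
      have hbr : b ∉ r := fun h => hn.2.2 b h b ((hmem b).2 (by simp)) rfl
      have hhead : (b :: T.flatten).Nodup → (T.headD []).countP (· < b) + 1 ≤
          (T'.headD []).countP (· < b + 1) := by
        intro _
        have := (hT.countP_head_tableauInsert hb (b + 1)).2.2.2 (by omega)
        rwa [hTb] at this
      -- The bound `b + 1` is chosen to count `b` itself, which stands in the first row of `T'`. As
      -- `b` is not in `r`, the column condition there provides a letter of `r` smaller than `b`.
      have hcol := hT'.2.2.1 (b + 1)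
      have hbb : r.countP (· < b + 1) = r.countP (· < b) := by
        refine List.countP_congr fun x hx => ?_
        have : x ≠ b := fun h => hbr (h ▸ hx)
        simp; omega
      have hpos : 0 < r.countP (· < b) := by have := hhead hb; omega
      obtain ⟨u, a, v, rfl, hab, hv⟩ := exists_split_of_countP_pos hT'.2.1 hbr hpos
      have hp := pairwise_lt_split.1 hT'.2.1
      have hmemr : ∀ x, x ∈ u ++ b :: v → x = b ∨ x ∈ u ++ a :: v := by
        intro x hx; simp at hx ⊢; tauto
      have haT : a ∉ T.flatten := fun h =>
        hn.2.2 a (by simp) a ((hmem a).2 (by simp [h])) rfl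
      refine ⟨(u ++ b :: v) :: T, a, ⟨by simp, ?_, fun k => ?_, hT⟩, ?_, ?_, ?_⟩
      · exact pairwise_lt_split.2 ⟨hp.1, hp.2.1, fun x hx => (hp.2.2.1 x hx).trans hab, hv,
          hp.2.2.2.2⟩
      · obtain ⟨h1, h2, h3, h4⟩ := hT.countP_head_tableauInsert hb k
        rw [hTb] at h1 h2 h3 h4
        have h5 := hT'.2.2.1 k
        have h6 := hhead hb
        have h7 : k ≤ b → (T.headD []).countP (· < k) ≤ (T.headD []).countP (· < b) :=
          countP_lt_mono _
        have h8 := countP_lt_eq_length hp.2.2.1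
        simp only [List.countP_append, List.countP_cons, decide_eq_true_eq] at h5 hcol ⊢
        have h9 : a < k → u.countP (· < k) = u.length := fun h =>
          countP_lt_eq_length fun x hx => (hp.2.2.1 x hx).trans h
        have h10 : u.countP (· < b + 1) = u.length :=
          countP_lt_eq_length fun x hx => (hp.2.2.1 x hx).trans (by omega)
        have h11 : v.countP (· < b + 1) = 0 := countP_lt_eq_zero fun x hx => hv x hx
        rw [h10, h11, if_pos (by omega)] at hcol
        split_ifs at h5 ⊢ <;> omega
      · rw [List.nodup_cons, List.flatten_cons, List.mem_append, not_or]
        refine ⟨⟨?_, haT⟩, ?_⟩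
        · intro h
          simp only [List.mem_append, List.mem_cons] at h
          rcases h with h | h | h
          · exact lt_irrefl _ (hp.2.2.1 a h)
          · omega
          · exact lt_irrefl _ (hp.2.2.2.1 a h)
        · rw [List.nodup_append]
          refine ⟨?_, (List.nodup_cons.1 hb).2, fun x hx y hy hxy => ?_⟩
          · have : (u ++ b :: v).Pairwise (· < ·) := pairwise_lt_split.2
              ⟨hp.1, hp.2.1, fun x hx => (hp.2.2.1 x hx).trans hab, hv, hp.2.2.2.2⟩
            exact this.imp fun h => h.ne
          · subst hxy
            rcases hmemr x hx with rfl | h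
            · exact (List.nodup_cons.1 hb).1 hy
            · exact hn.2.2 x h x ((hmem x).2 (by simp [hy])) rfl
      · rw [tableauInsert_some hp.2.2.1 hab, hTb]
      · rw [insertionRow_some hp.2.2.1 hab, hrow]

/-! ### The recording word -/

/-- The rows of the boxes created by the successive insertions of the letters of `w` in `T`. -/
def recordingWord : List (List ℕ) → List ℕ → List ℕ
  | _, [] => []
  | T, a :: w => insertionRow T a :: recordingWord (tableauInsert T a) w

theorem length_recordingWord (T : List (List ℕ)) (w : List ℕ) :
    (recordingWord T w).length = w.length := by
  induction w generalizing T with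
  | nil => rfl
  | cons a w ih => simp [recordingWord, ih]

theorem recordingWord_append (T : List (List ℕ)) (w w' : List ℕ) :
    recordingWord T (w ++ w') = recordingWord T w ++ recordingWord (w.foldl tableauInsert T) w' := by
  induction w generalizing T with
  | nil => rfl
  | cons a w ih => simp [recordingWord, ih]

/-- Words all of whose prefixes contain the letter `i` at least as often as `i + 1`. -/
def IsYamanouchi (r : List ℕ) : Prop :=
  ∀ k i, (r.take k).count (i + 1) ≤ (r.take k).count i

theorem isTableau_foldl {w : List ℕ} (hw : w.Nodup) :
    IsTableau (w.foldl tableauInsert []) ∧ (w.foldl tableauInsert []).flatten.Perm w := by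
  induction w using List.reverseRecOn with
  | nil => simp [IsTableau]
  | append_singleton w a ih =>
    have h1 : (a :: w).Nodup := (List.perm_append_singleton a w).nodup_iff.1 hw
    obtain ⟨h2, h3⟩ := ih (List.nodup_cons.1 h1).2
    have h4 : (a :: (w.foldl tableauInsert []).flatten).Nodup := (h3.cons a).nodup_iff.2 h1
    rw [List.foldl_append, List.foldl_cons, List.foldl_nil]
    exact ⟨h2.tableauInsert h4, (flatten_tableauInsert_perm h2 h4).trans
      ((h3.cons a).trans (List.perm_append_singleton a w).symm)⟩

theorem rowLength_foldl (w : List ℕ) (i : ℕ) :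
    rowLength (w.foldl tableauInsert []) i = (recordingWord [] w).count i := by
  induction w using List.reverseRecOn with
  | nil => simp [recordingWord]
  | append_singleton w a ih =>
    rw [List.foldl_append, List.foldl_cons, List.foldl_nil, rowLength_tableauInsert, ih,
      recordingWord_append, List.count_append, recordingWord, recordingWord, List.count_singleton]
    simp only [beq_iff_eq, @eq_comm _ i]

theorem take_recordingWord (w : List ℕ) (k : ℕ) :
    (recordingWord [] w).take k = recordingWord [] (w.take k) := by
  conv_lhs => rw [← List.take_append_drop k w, recordingWord_append]
  rcases le_total k w.length with h | h
  · rw [List.take_left' (by rw [length_recordingWord, List.length_take, min_eq_left h])]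
  · rw [List.drop_eq_nil_of_le h]
    simp only [recordingWord, List.append_nil]
    rw [List.take_of_length_le]
    rw [length_recordingWord, List.length_take]
    exact min_le_left _ _

/-- A prefix of the recording word records the insertion of a prefix of `w`, so its letter counts
are the row lengths of a tableau. -/
theorem isYamanouchi_recordingWord {w : List ℕ} (hw : w.Nodup) :
    IsYamanouchi (recordingWord [] w) := by
  intro k i
  rw [take_recordingWord, ← rowLength_foldl, ← rowLength_foldl]
  exact (isTableau_foldl (hw.sublist (List.take_sublist k w))).1.rowLength_succ_le i

/-- The last letter of the recording word is the row of the last box created, which is what is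
needed to undo the last insertion; hence an induction from the right. -/
theorem recordingWord_injective {w w' : List ℕ} (hw : w.Nodup) (hw' : w'.Nodup)
    (h : w.foldl tableauInsert [] = w'.foldl tableauInsert [])
    (hr : recordingWord [] w = recordingWord [] w') : w = w' := by
  induction w using List.reverseRecOn generalizing w' with
  | nil =>
    have := congrArg List.length hr
    rw [length_recordingWord, length_recordingWord] at this
    exact (List.length_eq_zero_iff.1 this.symm).symm
  | append_singleton w a ih =>
    rcases List.eq_nil_or_concat w' with rfl | ⟨w', a', rfl⟩
    · have := congrArg List.length hr
      simp [length_recordingWord] at this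
    · rw [List.concat_eq_append] at *
      have h1 := (List.perm_append_singleton a w).nodup_iff.1 hw
      have h1' := (List.perm_append_singleton a' w').nodup_iff.1 hw'
      have hn := (List.nodup_cons.1 h1).2
      have hn' := (List.nodup_cons.1 h1').2
      obtain ⟨h2, h3⟩ := isTableau_foldl hn
      obtain ⟨h2', h3'⟩ := isTableau_foldl hn'
      simp only [List.foldl_append, List.foldl_cons, List.foldl_nil] at h
      simp only [recordingWord_append, recordingWord] at hr
      obtain ⟨h4, h5⟩ := List.append_inj' hr rfl
      obtain ⟨h6, rfl⟩ := tableauInsert_injective h2 h2' ((h3.cons a).nodup_iff.2 h1)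
        ((h3'.cons a').nodup_iff.2 h1') h (by simpa using h5)
      rw [ih hn hn' h6 h4]

theorem IsYamanouchi.of_append {r s : List ℕ} (h : IsYamanouchi (r ++ s)) : IsYamanouchi r := by
  intro k i
  have := h (min k r.length) i
  rw [List.take_append_of_le_length (min_le_right _ _)] at this
  rcases le_total k r.length with h1 | h1
  · rwa [min_eq_left h1] at this
  · rw [min_eq_right h1] at this
    rw [List.take_length] at this
    rwa [List.take_of_length_le h1]

/-- If the Yamanouchi word is `r` followed by `i`, then `r` has at least as many `i` as `i + 1`, so
the last box of row `i` of `T` is a corner and can be removed by reverse insertion. -/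
theorem exists_recordingWord_eq {r : List ℕ} (hr : IsYamanouchi r) {T : List (List ℕ)}
    (hT : IsTableau T) (hn : T.flatten.Nodup) (h : ∀ i, rowLength T i = r.count i) :
    ∃ w : List ℕ, w.Nodup ∧ w.foldl tableauInsert [] = T ∧ recordingWord [] w = r := by
  induction r using List.reverseRecOn generalizing T with
  | nil =>
    refine ⟨[], by simp, ?_, rfl⟩
    cases T with
    | nil => rfl
    | cons s T =>
      have := h 0
      have h3 := List.length_pos_of_ne_nil hT.1
      simp at this
      exact absurd this hT.1
  | append_singleton r i ih =>
    have hr' := hr.of_append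
    have hcount : ∀ j, rowLength T j = r.count j + if j = i then 1 else 0 := by
      intro j
      rw [h j, List.count_append, List.count_singleton]
      simp only [beq_iff_eq, @eq_comm _ i]
    have hle := hr' r.length i
    rw [List.take_length] at hle
    obtain ⟨T0, a, hT0, ha, rfl, rfl⟩ := exists_tableauInsert_eq hT hn (i := i) (by
      rw [hcount, hcount, if_neg (by omega), if_pos rfl]; omega)
    obtain ⟨w, hw, rfl, rfl⟩ := ih hr' hT0 (List.nodup_cons.1 ha).2 (by
      intro j
      have := hcount j
      rw [rowLength_tableauInsert] at this
      omega)
    refine ⟨w ++ [a], ?_, by simp, by simp [recordingWord_append, recordingWord]⟩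
    refine (List.perm_append_singleton a w).nodup_iff.2 ?_
    exact ((isTableau_foldl hw).2.cons a).nodup_iff.1 ha

/-! ### Recoils and the insertion tableau -/

/-- The words `w` and `w'` have the same letters, and for every `d` the letters `d` and `d + 1`
appear in this order in `w` if and only if they do in `w'`. -/
def SameRecoils (w w' : List ℕ) : Prop :=
  (∀ x, x ∈ w ↔ x ∈ w') ∧ ∀ d, [d, d + 1].Sublist w ↔ [d, d + 1].Sublist w'

theorem pair_sublist_append {a b : ℕ} {u v : List ℕ} :
    [a, b].Sublist (u ++ v) ↔ [a, b].Sublist u ∨ (a ∈ u ∧ b ∈ v) ∨ [a, b].Sublist v := by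
  induction u with
  | nil => simp
  | cons x u ih =>
    rw [List.cons_append]
    by_cases hx : a = x
    · subst hx
      simp only [List.cons_sublist_cons, List.singleton_sublist, List.mem_append, List.mem_cons,
        true_or, true_and]
      constructor
      · tauto
      · rintro (h | h | h)
        · exact Or.inl h
        · exact Or.inr h
        · exact Or.inr (h.subset (by simp))
    · have key : ∀ l : List ℕ, [a, b].Sublist (x :: l) ↔ [a, b].Sublist l := by
        intro l
        refine ⟨fun h => ?_, fun h => h.cons x⟩
        cases h with
        | cons _ h => exact h
        | cons_cons _ h => exact absurd rfl hx
      rw [key, key, ih]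
      simp [hx]

theorem SameRecoils.refl (w : List ℕ) : SameRecoils w w := ⟨fun _ => Iff.rfl, fun _ => Iff.rfl⟩

theorem SameRecoils.trans {w w' w'' : List ℕ} (h : SameRecoils w w') (h' : SameRecoils w' w'') :
    SameRecoils w w'' :=
  ⟨fun x => (h.1 x).trans (h'.1 x), fun d => (h.2 d).trans (h'.2 d)⟩

theorem SameRecoils.append {u u' v v' : List ℕ} (hu : SameRecoils u u') (hv : SameRecoils v v') :
    SameRecoils (u ++ v) (u' ++ v') := by
  refine ⟨fun x => ?_, fun d => ?_⟩
  · rw [List.mem_append, List.mem_append, hu.1, hv.1]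
  · rw [pair_sublist_append, pair_sublist_append, hu.1, hv.1, hu.2, hv.2]

/-- The letter `a` only crosses letters that differ from it by at least two, so no pair of
consecutive letters is reordered. -/
theorem sameRecoils_append_singleton {a : ℕ} {v : List ℕ} (h : ∀ x ∈ v, a + 1 < x ∨ x + 1 < a) :
    SameRecoils (v ++ [a]) ([a] ++ v) := by
  refine ⟨fun x => by simp [or_comm], fun d => ?_⟩
  rw [pair_sublist_append, pair_sublist_append]
  have h1 : ¬ (d ∈ v ∧ d + 1 ∈ [a]) := by
    rintro ⟨h1, h2⟩
    have := h d h1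
    simp at h2
    omega
  have h2 : ¬ (d ∈ [a] ∧ d + 1 ∈ v) := by
    rintro ⟨h1, h2⟩
    have := h (d + 1) h2
    simp at h1
    omega
  tauto

/-- When `a` expels `b` from the row `u b v`, the word `u b v a` becomes `b u a v`. Here `b` crosses
letters smaller than `a < b`, and `a` crosses letters greater than `b > a`, so consecutive letters
never cross. This suffices for recoils, and the full Knuth relations are not needed. -/
theorem sameRecoils_tableauInsert {T : List (List ℕ)} (hT : IsTableau T) {a : ℕ}
    (ha : (a :: T.flatten).Nodup) :
    SameRecoils (readingWord T ++ [a]) (readingWord (tableauInsert T a)) := by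
  induction T generalizing a with
  | nil => exact SameRecoils.refl _
  | cons r T ih =>
    rcases hT.insert_cases ha with ⟨-, h, -⟩ | ⟨u, b, v, rfl, hu, hab, hv, hb, h, -⟩
    · rw [h, readingWord, readingWord, List.append_assoc]
      exact SameRecoils.refl _
    · rw [h, readingWord, readingWord]
      have h1 : SameRecoils (u ++ [b]) ([b] ++ u) := sameRecoils_append_singleton fun x hx => by
        have := hu x hx; omega
      have h2 : SameRecoils (v ++ [a]) ([a] ++ v) := sameRecoils_append_singleton fun x hx => by
        have := hv x hx; omega
      have h3 := ((SameRecoils.refl (readingWord T)).append h1).append h2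
      have h4 := ((ih hT.2.2.2 hb).append (SameRecoils.refl u)).append
        (SameRecoils.refl ([a] ++ v))
      simpa using h3.trans (by simpa using h4)

theorem sameRecoils_foldl {w : List ℕ} (hw : w.Nodup) :
    SameRecoils w (readingWord (w.foldl tableauInsert [])) := by
  induction w using List.reverseRecOn with
  | nil => exact SameRecoils.refl _
  | append_singleton w a ih =>
    have h1 : (a :: w).Nodup := (List.perm_append_singleton a w).nodup_iff.1 hw
    have hn := (List.nodup_cons.1 h1).2
    obtain ⟨h2, h3⟩ := isTableau_foldl hn
    rw [List.foldl_append, List.foldl_cons, List.foldl_nil]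
    exact ((ih hn).append (SameRecoils.refl [a])).trans
      (sameRecoils_tableauInsert h2 ((h3.cons a).nodup_iff.2 h1))

/-- The row of a tableau that contains the letter `k`. -/
def rowOf : List (List ℕ) → ℕ → ℕ
  | [], _ => 0
  | r :: T, k => if k ∈ r then 0 else rowOf T k + 1

theorem mem_readingWord {T : List (List ℕ)} {k : ℕ} : k ∈ readingWord T ↔ k ∈ T.flatten := by
  induction T with
  | nil => simp [readingWord]
  | cons r T ih => simp only [readingWord, List.mem_append, ih, List.flatten_cons, or_comm]

/-- Lower rows are read first, and inside a row the smaller letter is read first; the assumption `d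
< e` settles the case of a common row. -/
theorem pair_sublist_readingWord {T : List (List ℕ)} (hT : IsTableau T) (hn : T.flatten.Nodup)
    {d e : ℕ} (hde : d < e) (hd : d ∈ T.flatten) (he : e ∈ T.flatten) :
    [d, e].Sublist (readingWord T) ↔ rowOf T e ≤ rowOf T d := by
  induction T with
  | nil => simp at hd
  | cons r T ih =>
    rw [readingWord, pair_sublist_append]
    rw [List.flatten_cons, List.nodup_append] at hn
    rw [List.flatten_cons, List.mem_append] at hd he
    have hr : ∀ x ∈ r, x ∉ T.flatten := fun x hx h => hn.2.2 x hx x h rfl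
    have hsub : ∀ {l : List ℕ}, [d, e].Sublist l → d ∈ l ∧ e ∈ l := fun h =>
      ⟨h.subset (by simp), h.subset (by simp)⟩
    by_cases h1 : d ∈ r <;> by_cases h2 : e ∈ r
    · simp only [rowOf, if_pos h1, if_pos h2, le_refl, iff_true]
      right; right
      rcases List.mem_iff_append.1 h1 with ⟨u, v, rfl⟩
      have hp := pairwise_lt_split.1 hT.2.1
      rw [pair_sublist_append]
      right; right
      simp only [List.cons_sublist_cons, List.singleton_sublist]
      simp only [List.mem_append, List.mem_cons] at h2
      rcases h2 with h2 | h2 | h2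
      · have := hp.2.2.1 e h2; omega
      · omega
      · exact h2
    · simp only [rowOf, if_pos h1, if_neg h2, nonpos_iff_eq_zero, Nat.succ_ne_zero, iff_false]
      rintro (h | h | h)
      · exact hr d h1 (mem_readingWord.1 (hsub h).1)
      · exact h2 h.2
      · exact h2 (hsub h).2
    · simp only [rowOf, if_neg h1, if_pos h2, Nat.zero_le, iff_true]
      exact Or.inr (Or.inl ⟨mem_readingWord.2 (hd.resolve_left h1), h2⟩)
    · simp only [rowOf, if_neg h1, if_neg h2, Nat.add_le_add_iff_right]
      rw [← ih hT.2.2.2 hn.2.1 (hd.resolve_left h1) (he.resolve_left h2)]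
      refine ⟨?_, Or.inl⟩
      rintro (h | h | h)
      · exact h
      · exact absurd h.2 h2
      · exact absurd (hsub h).2 h2

theorem pair_sublist_or {l : List ℕ} {d e : ℕ} (hd : d ∈ l) (he : e ∈ l) (hne : d ≠ e) :
    [d, e].Sublist l ∨ [e, d].Sublist l := by
  obtain ⟨u, v, rfl⟩ := List.mem_iff_append.1 hd
  simp only [List.mem_append, List.mem_cons] at he
  rcases he with h | h | h
  · right
    rw [pair_sublist_append]
    exact Or.inr (Or.inl ⟨h, by simp⟩)
  · exact absurd h.symm hne
  · left
    rw [pair_sublist_append]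
    exact Or.inr (Or.inr (by simpa using h))

/-- The word of values of a permutation. -/
def permWord {n : ℕ} (σ : Equiv.Perm (Fin n)) : List ℕ := List.ofFn fun k => (σ k : ℕ)

theorem permWord_nodup {n : ℕ} (σ : Equiv.Perm (Fin n)) : (permWord σ).Nodup :=
  List.nodup_ofFn.2 fun _ _ h => σ.injective (Fin.ext h)

theorem mem_permWord {n : ℕ} (σ : Equiv.Perm (Fin n)) {k : ℕ} : k ∈ permWord σ ↔ k < n := by
  rw [permWord, List.mem_ofFn]
  constructor
  · rintro ⟨i, rfl⟩; exact (σ i).2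
  · intro h; exact ⟨σ.symm ⟨k, h⟩, by simp⟩

theorem pair_sublist_permWord {n : ℕ} (σ : Equiv.Perm (Fin n)) (p q : Fin n) (hpq : p ≠ q) :
    [(p : ℕ), (q : ℕ)].Sublist (permWord σ) ↔ σ⁻¹ p < σ⁻¹ q := by
  have key : ∀ p q : Fin n, [(p : ℕ), (q : ℕ)].Sublist (permWord σ) → σ⁻¹ p < σ⁻¹ q := by
    intro p q h
    have h1 : (permWord σ).Pairwise fun x y => ∀ p q : Fin n, (p : ℕ) = x → (q : ℕ) = y →
        σ⁻¹ p < σ⁻¹ q := by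
      rw [permWord, List.pairwise_ofFn]
      intro i j hij p q hp hq
      obtain rfl := Fin.ext hp
      obtain rfl := Fin.ext hq
      simpa using hij
    exact List.pairwise_iff_forall_sublist.1 h1 h p q rfl rfl
  refine ⟨key p q, fun h => ?_⟩
  rcases pair_sublist_or ((mem_permWord σ).2 p.2) ((mem_permWord σ).2 q.2)
    (fun h => hpq (Fin.ext h)) with h1 | h1
  · exact h1
  · exact absurd (key q p h1) h.not_gt

theorem insertionTableau_eq {n : ℕ} (σ : Equiv.Perm (Fin n)) :
    insertionTableau σ = (permWord σ).foldl tableauInsert [] := rfl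

theorem isTableau_insertionTableau {n : ℕ} (σ : Equiv.Perm (Fin n)) :
    IsTableau (insertionTableau σ) := (isTableau_foldl (permWord_nodup σ)).1

theorem flatten_insertionTableau_perm {n : ℕ} (σ : Equiv.Perm (Fin n)) :
    (insertionTableau σ).flatten.Perm (permWord σ) := (isTableau_foldl (permWord_nodup σ)).2

theorem flatten_insertionTableau_nodup {n : ℕ} (σ : Equiv.Perm (Fin n)) :
    (insertionTableau σ).flatten.Nodup :=
  (flatten_insertionTableau_perm σ).nodup_iff.2 (permWord_nodup σ)

theorem mem_flatten_insertionTableau {n : ℕ} (σ : Equiv.Perm (Fin n)) {k : ℕ} :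
    k ∈ (insertionTableau σ).flatten ↔ k < n :=
  (flatten_insertionTableau_perm σ).mem_iff.trans (mem_permWord σ)

/-- The recoils of a permutation are the descents of its insertion tableau. -/
theorem inv_lt_inv_iff_rowOf_le {n : ℕ} (σ : Equiv.Perm (Fin n)) {p q : Fin n}
    (hpq : (p : ℕ) + 1 = q) :
    σ⁻¹ p < σ⁻¹ q ↔ rowOf (insertionTableau σ) q ≤ rowOf (insertionTableau σ) p := by
  rw [← pair_sublist_permWord σ p q (by rintro rfl; omega), ← hpq,
    (sameRecoils_foldl (permWord_nodup σ)).2, ← insertionTableau_eq]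
  exact pair_sublist_readingWord (isTableau_insertionTableau σ) (flatten_insertionTableau_nodup σ)
    (by omega) ((mem_flatten_insertionTableau σ).2 p.2)
    ((mem_flatten_insertionTableau σ).2 (by omega))

theorem getElem_recordingWord (w : List ℕ) (d : ℕ) (h : d < w.length) :
    (recordingWord [] w)[d]'(by rwa [length_recordingWord]) =
      insertionRow ((w.take d).foldl tableauInsert []) w[d] := by
  have h1 : recordingWord [] w = recordingWord [] (w.take d) ++
      recordingWord ((w.take d).foldl tableauInsert []) (w.drop d) := by
    rw [← recordingWord_append, List.take_append_drop]
  have h2 : (recordingWord [] (w.take d)).length = d := by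
    rw [length_recordingWord, List.length_take, min_eq_left h.le]
  simp only [h1]
  rw [List.getElem_append_right (by omega)]
  simp only [h2, Nat.sub_self]
  have h3 : w.drop d = w[d] :: w.drop (d + 1) := List.drop_eq_getElem_cons h
  simp only [h3, recordingWord, List.getElem_cons_zero]

/-- The descents of a permutation are the descents of its recording tableau. -/
theorem getElem_recordingWord_le_iff {w : List ℕ} (hw : w.Nodup) {d : ℕ} (h : d + 1 < w.length) :
    (recordingWord [] w)[d + 1]'(by rwa [length_recordingWord]) ≤
      (recordingWord [] w)[d]'(by rw [length_recordingWord]; omega) ↔ w[d] < w[d + 1] := by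
  rw [getElem_recordingWord w (d + 1) h, getElem_recordingWord w d (by omega)]
  rw [List.take_succ_eq_append_getElem (by omega), List.foldl_append, List.foldl_cons,
    List.foldl_nil]
  have hn := hw.sublist (List.take_sublist (d + 1 + 1) w)
  rw [List.take_succ_eq_append_getElem (by omega), List.take_succ_eq_append_getElem (by omega)] at hn
  obtain ⟨h2, h3⟩ := isTableau_foldl (hw.sublist (List.take_sublist d w))
  refine h2.insertionRow_le_iff ?_
  refine List.Perm.nodup_iff ?_ |>.1 hn
  refine (List.perm_append_singleton _ _).trans (List.Perm.cons _ ?_)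
  exact (List.perm_append_singleton _ _).trans (h3.symm.cons _)

/-! ### Shapes -/

/-- The number of parts of `λ` that are greater than `j`. -/
def conjugatePart {n : ℕ} (lam : n.Partition) (j : ℕ) : ℕ := lam.parts.countP fun a => j < a

theorem card_parts_le {n : ℕ} (lam : n.Partition) : lam.parts.card ≤ n := by
  have h : ∀ s : Multiset ℕ, (∀ a ∈ s, 0 < a) → s.card ≤ s.sum := by
    intro s
    induction s using Multiset.induction with
    | empty => simp
    | cons a s ih =>
      intro h
      have := h a (by simp)
      have := ih fun b hb => h b (by simp [hb])
      simp; omega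
  exact (h _ fun a ha => lam.parts_pos ha).trans lam.parts_sum.le

theorem conjugatePart_le {n : ℕ} (lam : n.Partition) (j : ℕ) : conjugatePart lam j ≤ n :=
  (Multiset.countP_le_card _ _).trans (card_parts_le lam)

theorem conjugatePart_antitone {n : ℕ} (lam : n.Partition) : Antitone (conjugatePart lam) := by
  intro i j hij
  unfold conjugatePart
  rw [Multiset.countP_eq_card_filter, Multiset.countP_eq_card_filter]
  refine Multiset.card_le_card (Multiset.monotone_filter_right _ fun a ha => ?_)
  omega

theorem conjugatePart_eq_zero {n : ℕ} (lam : n.Partition) {j : ℕ} (hj : n ≤ j) :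
    conjugatePart lam j = 0 := by
  rw [conjugatePart, Multiset.countP_eq_zero]
  intro a ha
  have := lam.le_of_mem_parts ha
  omega

/-- The exponent whose `i`-th coordinate is the part `λ_{i+1}`. -/
def shapeContent {n : ℕ} (lam : n.Partition) : ℕ →₀ ℕ :=
  Finsupp.onFinset (range n) (fun i => #{j ∈ range n | i < conjugatePart lam j}) (by
    intro i hi
    obtain ⟨j, hj⟩ := Finset.card_pos.1 (Nat.pos_of_ne_zero hi)
    have := (Finset.mem_filter.1 hj).2
    exact Finset.mem_range.2 (this.trans_le (conjugatePart_le lam j)))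

theorem shapeContent_apply {n : ℕ} (lam : n.Partition) (i : ℕ) :
    shapeContent lam i = #{j ∈ range n | i < conjugatePart lam j} := rfl

theorem shapeContent_antitone {n : ℕ} (lam : n.Partition) : Antitone (shapeContent lam) := by
  intro i j hij
  rw [shapeContent_apply, shapeContent_apply]
  exact Finset.card_le_card (Finset.monotone_filter_right _ fun k _ hk => hij.trans_lt hk)

/-- For antitone `f` the filtered set is an initial segment of `range n`. This is the duality
between a partition and its conjugate, and it also serves for the indices of blocks. -/
theorem card_filter_lt_iff {n : ℕ} {f : ℕ → ℕ} (hf : Antitone f) {i j : ℕ} (hj : j < n) :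
    j < #{k ∈ range n | i < f k} ↔ i < f j := by
  constructor
  · intro h
    by_contra h1
    have : #{k ∈ range n | i < f k} ≤ #(range j) := by
      refine Finset.card_le_card fun k hk => ?_
      rw [Finset.mem_filter] at hk
      rw [Finset.mem_range]
      by_contra h2
      have := hf (not_lt.1 h2)
      omega
    rw [Finset.card_range] at this
    omega
  · intro h
    have : #(range (j + 1)) ≤ #{k ∈ range n | i < f k} := by
      refine Finset.card_le_card fun k hk => ?_
      rw [Finset.mem_range] at hk
      rw [Finset.mem_filter, Finset.mem_range]
      exact ⟨by omega, h.trans_le (hf (by omega))⟩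
    rwa [Finset.card_range] at this

theorem conjugatePart_eq {n : ℕ} (lam : n.Partition) {j : ℕ} (hj : j < n) :
    conjugatePart lam j = #{i ∈ range n | j < shapeContent lam i} := by
  have : {i ∈ range n | j < shapeContent lam i} = range (conjugatePart lam j) := by
    ext i
    rw [Finset.mem_filter, Finset.mem_range, Finset.mem_range, shapeContent_apply,
      card_filter_lt_iff (conjugatePart_antitone lam) hj]
    have := conjugatePart_le lam j
    omega
  rw [this, Finset.card_range]

/-- The conjugate parts are recovered from the content by duality, and the multiplicity of a part `a
+ 1` is the difference of two consecutive conjugate parts. -/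
theorem shapeContent_injective {n : ℕ} :
    Function.Injective (shapeContent : n.Partition → ℕ →₀ ℕ) := by
  intro lam mu h
  have h1 : ∀ j, conjugatePart lam j = conjugatePart mu j := by
    intro j
    by_cases hj : j < n
    · rw [conjugatePart_eq lam hj, conjugatePart_eq mu hj, h]
    · rw [conjugatePart_eq_zero lam (not_lt.1 hj), conjugatePart_eq_zero mu (not_lt.1 hj)]
  have h2 : ∀ (nu : n.Partition) (a : ℕ),
      nu.parts.count (a + 1) + conjugatePart nu (a + 1) = conjugatePart nu a := by
    intro nu a
    unfold conjugatePart
    induction nu.parts using Multiset.induction with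
    | empty => simp
    | cons b s ih =>
      rw [Multiset.count_cons, Multiset.countP_cons, Multiset.countP_cons]
      split_ifs <;> omega
  apply Nat.Partition.ext
  ext a
  rcases a with _ | a
  · rw [Multiset.count_eq_zero.2, Multiset.count_eq_zero.2]
    · exact fun h => lt_irrefl _ (mu.parts_pos h)
    · exact fun h => lt_irrefl _ (lam.parts_pos h)
  · have h3 := h2 lam a
    have h4 := h2 mu a
    rw [h1, h1] at h3
    omega

/-- Row lengths decrease weakly, so the rows longer than `j` are the first ones. -/
theorem IsTableau.lt_rowLength_iff {T : List (List ℕ)} (hT : IsTableau T) {i j : ℕ} :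
    j < rowLength T i ↔ i < (T.map List.length).countP (j < ·) := by
  induction T generalizing i with
  | nil => simp
  | cons r T ih =>
    have h0 : ∀ i, rowLength (r :: T) i ≤ r.length := by
      intro i
      induction i with
      | zero => simp
      | succ i ih => exact (hT.rowLength_succ_le i).trans ih
    rw [List.map_cons, List.countP_cons]
    rcases i with _ | i
    · rw [rowLength_cons_zero]
      by_cases h : j < r.length
      · simp [h]
      · have h1 := ih hT.2.2.2 (i := 0)
        have h2 := h0 1
        rw [rowLength_cons_succ] at h2
        rw [if_neg (by simpa using h), add_zero, ← h1]
        omega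
    · rw [rowLength_cons_succ, ih hT.2.2.2]
      by_cases h : j < r.length
      · simp [h]
      · have h1 := ih hT.2.2.2 (i := i)
        have h2 := h0 (i + 1)
        rw [rowLength_cons_succ] at h2
        rw [if_neg (by simpa using h), add_zero, ← h1]
        omega

theorem parts_rskShape {n : ℕ} (σ : Equiv.Perm (Fin n)) :
    (rskShape σ).parts = ((insertionTableau σ).map List.length : Multiset ℕ) := by
  change ((insertionTableau σ).map List.length : Multiset ℕ).filter (· ≠ 0) = _
  rw [Multiset.filter_eq_self]
  intro a ha
  rw [Multiset.mem_coe, List.mem_map] at ha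
  obtain ⟨r, hr, rfl⟩ := ha
  have key : ∀ T : List (List ℕ), IsTableau T → ∀ r ∈ T, r.length ≠ 0 := by
    intro T
    induction T with
    | nil => simp
    | cons s T ih =>
      intro hT r hr
      rw [List.mem_cons] at hr
      rcases hr with rfl | hr
      · simpa using hT.1
      · exact ih hT.2.2.2 r hr
  exact key _ (isTableau_insertionTableau σ) r hr

theorem shapeContent_rskShape {n : ℕ} (σ : Equiv.Perm (Fin n)) (i : ℕ) :
    shapeContent (rskShape σ) i = rowLength (insertionTableau σ) i := by
  have h1 : ∀ j, i < conjugatePart (rskShape σ) j ↔ j < rowLength (insertionTableau σ) i := by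
    intro j
    rw [conjugatePart, parts_rskShape, Multiset.coe_countP,
      (isTableau_insertionTableau σ).lt_rowLength_iff]
  have h2 : rowLength (insertionTableau σ) i ≤ n := by
    by_contra h
    have h3 := (h1 n).2 (not_le.1 h)
    rw [conjugatePart_eq_zero _ le_rfl] at h3
    omega
  have h3 : {j ∈ range n | i < conjugatePart (rskShape σ) j} =
      range (rowLength (insertionTableau σ) i) := by
    ext j
    rw [Finset.mem_filter, h1, Finset.mem_range, Finset.mem_range]
    omega
  rw [shapeContent_apply, h3, Finset.card_range]

theorem rskShape_eq_iff {n : ℕ} (σ : Equiv.Perm (Fin n)) (lam : n.Partition) :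
    rskShape σ = lam ↔ ∀ i, rowLength (insertionTableau σ) i = shapeContent lam i := by
  constructor
  · rintro rfl i
    exact (shapeContent_rskShape σ i).symm
  · intro h
    refine shapeContent_injective (Finsupp.ext fun i => ?_)
    rw [shapeContent_rskShape, h]

/-! ### The Robinson-Schensted correspondence -/

theorem content_apply {n : ℕ} (r : Fin n → ℕ) (i : ℕ) : content r i = #{p | r p = i} := by
  rw [content, Finsupp.finsetSum_apply, Finset.card_filter]
  exact Finset.sum_congr rfl fun p _ => Finsupp.single_apply

theorem count_ofFn {n : ℕ} (r : Fin n → ℕ) (i : ℕ) : (List.ofFn r).count i = content r i := by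
  rw [← Multiset.coe_count, ← toMultiset_content, Finsupp.count_toMultiset]

/-- The permutation `σ` increases along the runs of equal letters of `t`. -/
def IncreasingOnRuns {n : ℕ} (t : Fin n → ℕ) (σ : Equiv.Perm (Fin n)) : Prop :=
  ∀ p q : Fin n, (p : ℕ) + 1 = q → t p = t q → σ p < σ q

/-- The Yamanouchi words of content `λ` that decrease weakly along the runs of equal letters
of `t`. -/
def yamanouchiWords {n : ℕ} (lam : n.Partition) (t : Fin n → ℕ) : Set (Fin n → ℕ) :=
  {r | IsYamanouchi (List.ofFn r) ∧ content r = shapeContent lam ∧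
    ∀ p q : Fin n, (p : ℕ) + 1 = q → t p = t q → r q ≤ r p}

/-- For weakly increasing `t`, this is the Kostka number of `λ` and of the content of `t`. -/
def kostka {n : ℕ} (lam : n.Partition) (t : Fin n → ℕ) : ℕ := (yamanouchiWords lam t).ncard

/-- The insertion tableau, as the word of the rows of its letters. -/
def insertionRows {n : ℕ} (σ : Equiv.Perm (Fin n)) (k : Fin n) : ℕ :=
  rowOf (insertionTableau σ) k

/-- The recording tableau, as the word of the rows of its letters. -/
def recordingRows {n : ℕ} (σ : Equiv.Perm (Fin n)) (k : Fin n) : ℕ :=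
  (recordingWord [] (permWord σ)).getD k 0

theorem ofFn_recordingRows {n : ℕ} (σ : Equiv.Perm (Fin n)) :
    List.ofFn (recordingRows σ) = recordingWord [] (permWord σ) := by
  have hl : (recordingWord [] (permWord σ)).length = n := by
    rw [length_recordingWord, permWord, List.length_ofFn]
  apply List.ext_getElem
  · rw [List.length_ofFn, hl]
  · intro i h1 h2
    rw [List.getElem_ofFn, recordingRows, List.getD_eq_getElem _ _ h2]

theorem content_recordingRows {n : ℕ} (σ : Equiv.Perm (Fin n)) (i : ℕ) :
    content (recordingRows σ) i = rowLength (insertionTableau σ) i := by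
  rw [← count_ofFn, ofFn_recordingRows, ← rowLength_foldl, insertionTableau_eq]

theorem recordingRows_le_iff {n : ℕ} (σ : Equiv.Perm (Fin n)) {p q : Fin n}
    (hpq : (p : ℕ) + 1 = q) : recordingRows σ q ≤ recordingRows σ p ↔ σ p < σ q := by
  have hl : (permWord σ).length = n := by rw [permWord, List.length_ofFn]
  have h := getElem_recordingWord_le_iff (permWord_nodup σ) (d := p) (by omega)
  obtain ⟨q, hq⟩ := q
  simp only at hpq
  subst hpq
  rw [recordingRows, recordingRows, List.getD_eq_getElem _ _ (by rw [length_recordingWord]; omega),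
    List.getD_eq_getElem _ _ (by rw [length_recordingWord]; omega)]
  rw [h]
  simp [permWord]

theorem mem_getD_iff {T : List (List ℕ)} (hn : T.flatten.Nodup) {i k : ℕ} :
    k ∈ T.getD i [] ↔ k ∈ T.flatten ∧ rowOf T k = i := by
  induction T generalizing i with
  | nil => simp
  | cons r T ih =>
    rw [List.flatten_cons, List.nodup_append] at hn
    have hr : k ∈ r → k ∉ T.flatten := fun hx h' => hn.2.2 k hx k h' rfl
    rcases i with _ | i
    · rw [List.getD_cons_zero, List.flatten_cons, List.mem_append, rowOf]
      by_cases h1 : k ∈ r <;> simp [h1]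
    · rw [List.getD_cons_succ, ih hn.2.1, List.flatten_cons, List.mem_append, rowOf]
      by_cases h1 : k ∈ r
      · simp only [h1, hr h1, false_and, true_or, if_true, true_and]
        simp
      · simp [h1]

theorem IsTableau.pairwise_getD {T : List (List ℕ)} (hT : IsTableau T) (i : ℕ) :
    (T.getD i []).Pairwise (· < ·) := by
  induction T generalizing i with
  | nil => simp
  | cons r T ih =>
    rcases i with _ | i
    · simpa using hT.2.1
    · simpa using ih hT.2.2.2 i

theorem IsTableau.countP_getD_succ_le {T : List (List ℕ)} (hT : IsTableau T) (i k : ℕ) :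
    (T.getD (i + 1) []).countP (· < k) ≤ (T.getD i []).countP (· < k) := by
  induction T generalizing i with
  | nil => simp
  | cons r T ih =>
    rcases i with _ | i
    · have := hT.2.2.1 k
      rw [List.getD_cons_zero, List.getD_cons_succ]
      refine le_of_eq_of_le ?_ this
      cases T <;> simp
    · simpa using ih hT.2.2.2 i

/-- Rows are increasing, so each is the sorted list of its letters; a tableau is thus determined by
the map from letters to rows. -/
theorem getD_eq_filter_rowOf {T : List (List ℕ)} (hT : IsTableau T) (hn : T.flatten.Nodup)
    {n : ℕ} (hm : ∀ k, k ∈ T.flatten ↔ k < n) (i : ℕ) :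
    T.getD i [] = (List.range n).filter fun k => rowOf T k = i := by
  have h1 := hT.pairwise_getD i
  have h2 : ((List.range n).filter fun k => rowOf T k = i).Pairwise (· < ·) :=
    List.Pairwise.filter _ List.pairwise_lt_range
  refine List.Perm.eq_of_pairwise (le := (· < ·))
    (fun a b _ _ hab hba => absurd hab hba.not_gt) h1 h2 ?_
  refine (List.perm_ext_iff_of_nodup (h1.imp fun h => h.ne) (h2.imp fun h => h.ne)).2 fun k => ?_
  rw [mem_getD_iff hn, List.mem_filter, List.mem_range, decide_eq_true_iff, hm]

theorem eq_of_getD_eq {T U : List (List ℕ)} (hT : IsTableau T) (hU : IsTableau U)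
    (h : ∀ i, T.getD i [] = U.getD i []) : T = U := by
  induction T generalizing U with
  | nil =>
    cases U with
    | nil => rfl
    | cons s U => exact absurd (by simpa using (h 0).symm) hU.1
  | cons r T ih =>
    cases U with
    | nil => exact absurd (by simpa using h 0) hT.1
    | cons s U =>
      rw [show r = s by simpa using h 0, ih hT.2.2.2 hU.2.2.2 fun i => by simpa using h (i + 1)]

theorem ofFn_eq_map_range {n : ℕ} (f : ℕ → ℕ) :
    (List.ofFn fun k : Fin n => f k) = (List.range n).map f := by
  apply List.ext_getElem <;> simp

theorem countP_range_lt (n k : ℕ) (q : ℕ → Bool) :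
    ((List.range n).filter q).countP (· < k) = ((List.range n).take k).countP q := by
  rw [List.take_range, List.countP_filter]
  induction n with
  | zero => simp
  | succ n ih =>
    rw [List.range_succ, List.countP_append, ih]
    by_cases h : n < k
    · rw [min_eq_right (by omega), min_eq_right (by omega), List.range_succ, List.countP_append]
      simp [h]
    · rw [min_eq_left (by omega), min_eq_left (by omega)]
      simp [h]

/-- The dictionary between the two forms of standardness: counting a letter in the first `k` places
of the word of rows is counting the letters below `k` in a row of the tableau. -/
theorem count_take_ofFn {n : ℕ} (f : ℕ → ℕ) (k i : ℕ) :
    ((List.ofFn fun p : Fin n => f p).take k).count i =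
      ((List.range n).filter fun x => f x = i).countP (· < k) := by
  rw [countP_range_lt, ofFn_eq_map_range, ← List.map_take, List.count, List.countP_map]
  refine List.countP_congr fun x _ => ?_
  simp

theorem content_eq_length_filter {n : ℕ} (f : ℕ → ℕ) (i : ℕ) :
    content (fun p : Fin n => f p) i = ((List.range n).filter fun x => f x = i).length := by
  have h := count_take_ofFn (n := n) f n i
  rw [List.take_of_length_le (by simp), count_ofFn] at h
  rw [h]
  exact countP_lt_eq_length fun x hx => List.mem_range.1 (List.mem_filter.1 hx).1

theorem content_insertionRows {n : ℕ} (σ : Equiv.Perm (Fin n)) (i : ℕ) :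
    content (insertionRows σ) i = rowLength (insertionTableau σ) i := by
  rw [rowLength, getD_eq_filter_rowOf (isTableau_insertionTableau σ)
    (flatten_insertionTableau_nodup σ) (n := n) (fun k => mem_flatten_insertionTableau σ)]
  exact content_eq_length_filter _ i

theorem isYamanouchi_insertionRows {n : ℕ} (σ : Equiv.Perm (Fin n)) :
    IsYamanouchi (List.ofFn (insertionRows σ)) := by
  have hT := isTableau_insertionTableau σ
  have h : ∀ i, _ := getD_eq_filter_rowOf hT (flatten_insertionTableau_nodup σ) (n := n)
    (fun k => mem_flatten_insertionTableau σ)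
  intro k i
  have h1 := hT.countP_getD_succ_le i k
  rw [h, h] at h1
  exact (count_take_ofFn (rowOf (insertionTableau σ)) k (i + 1)).le.trans
    (h1.trans (count_take_ofFn (rowOf (insertionTableau σ)) k i).ge)

theorem insertionTableau_injective {n : ℕ} {σ τ : Equiv.Perm (Fin n)}
    (h : insertionRows σ = insertionRows τ) : insertionTableau σ = insertionTableau τ := by
  refine eq_of_getD_eq (isTableau_insertionTableau σ) (isTableau_insertionTableau τ) fun i => ?_
  rw [getD_eq_filter_rowOf (isTableau_insertionTableau σ) (flatten_insertionTableau_nodup σ)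
    (n := n) (fun k => mem_flatten_insertionTableau σ),
    getD_eq_filter_rowOf (isTableau_insertionTableau τ) (flatten_insertionTableau_nodup τ)
    (n := n) (fun k => mem_flatten_insertionTableau τ)]
  refine List.filter_congr fun k hk => ?_
  have := congrFun h ⟨k, List.mem_range.1 hk⟩
  simp only [insertionRows] at this
  rw [this]

theorem isTableau_map_range {N : ℕ} {f : ℕ → List ℕ} (h0 : ∀ i < N, f i ≠ [])
    (hs : ∀ i, (f i).Pairwise (· < ·))
    (hc : ∀ i k, (f (i + 1)).countP (· < k) ≤ (f i).countP (· < k)) :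
    IsTableau ((List.range N).map f) := by
  induction N generalizing f with
  | zero => trivial
  | succ N ih =>
    rw [List.range_succ_eq_map, List.map_cons, List.map_map]
    refine ⟨h0 0 (by omega), hs 0, fun k => ?_, ih (fun i hi => h0 _ (by omega))
      (fun i => hs _) fun i k => hc _ k⟩
    rcases N with _ | N
    · simp
    · rw [List.range_succ_eq_map]
      exact hc 0 k

/-- Row `i` consists of the positions of the letter `i` in `r`; the Yamanouchi condition is exactly
the column condition. -/
theorem exists_tableau_of_isYamanouchi {n : ℕ} {r : Fin n → ℕ} (hr : IsYamanouchi (List.ofFn r)) :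
    ∃ T : List (List ℕ), IsTableau T ∧ T.flatten.Nodup ∧ (∀ k, k ∈ T.flatten ↔ k < n) ∧
      (∀ k : Fin n, rowOf T k = r k) ∧ ∀ i, rowLength T i = content r i := by
  obtain ⟨f, rfl⟩ : ∃ f : ℕ → ℕ, r = fun p : Fin n => f p :=
    ⟨fun k => if h : k < n then r ⟨k, h⟩ else 0, by ext p; simp⟩
  -- `N` is the largest letter plus one, or zero for the empty word. Since the lengths decrease, the
  -- rows before `N` are nonempty, and all later ones are empty.
  set N := univ.sup fun p : Fin n => f p + 1 with hN
  set row : ℕ → List ℕ := fun i => (List.range n).filter fun x => f x = i with hrow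
  have hlt : ∀ x < n, f x < N := fun x hx =>
    Finset.le_sup (f := fun p : Fin n => f p + 1) (Finset.mem_univ (⟨x, hx⟩ : Fin n))
  have hc : ∀ i k, (row (i + 1)).countP (· < k) ≤ (row i).countP (· < k) := by
    intro i k
    have := hr k i
    rwa [count_take_ofFn, count_take_ofFn] at this
  have hlen : ∀ i, (row (i + 1)).length ≤ (row i).length := by
    intro i
    have := hc i n
    rwa [countP_lt_eq_length, countP_lt_eq_length] at this <;>
      exact fun x hx => List.mem_range.1 (List.mem_filter.1 hx).1
  have hne : ∀ i < N, row i ≠ [] := by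
    intro i hi
    rw [hN, Finset.lt_sup_iff] at hi
    obtain ⟨p, -, hp⟩ := hi
    have h1 : 0 < (row (f p)).length :=
      List.length_pos_of_mem (List.mem_filter.2 ⟨List.mem_range.2 p.2, by simp⟩)
    have h2 : Antitone fun i => (row i).length := antitone_nat_of_succ_le hlen
    exact List.ne_nil_of_length_pos (h1.trans_le (h2 (by omega)))
  have hnil : ∀ i, N ≤ i → row i = [] := by
    intro i hi
    refine List.filter_eq_nil_iff.2 fun x hx => ?_
    have := hlt x (List.mem_range.1 hx)
    simp; omega
  have hs : ∀ i, (row i).Pairwise (· < ·) := fun i => List.Pairwise.filter _ List.pairwise_lt_range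
  have hgetD : ∀ i, ((List.range N).map row).getD i [] = row i := by
    intro i
    by_cases hi : i < N
    · rw [List.getD_eq_getElem _ _ (by simpa using hi)]; simp
    · rw [List.getD_eq_default _ _ (by simpa using hi), hnil i (not_lt.1 hi)]
  have hmem : ∀ k, k ∈ ((List.range N).map row).flatten ↔ k < n := by
    intro k
    rw [List.mem_flatten]
    constructor
    · rintro ⟨l, hl, hk⟩
      obtain ⟨i, -, rfl⟩ := List.mem_map.1 hl
      exact List.mem_range.1 (List.mem_filter.1 hk).1
    · intro hk
      exact ⟨row (f k), List.mem_map.2 ⟨f k, List.mem_range.2 (hlt k hk), rfl⟩,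
        List.mem_filter.2 ⟨List.mem_range.2 hk, by simp⟩⟩
  have hnd : ((List.range N).map row).flatten.Nodup := by
    rw [List.nodup_flatten]
    constructor
    · intro l hl
      obtain ⟨i, -, rfl⟩ := List.mem_map.1 hl
      exact (hs i).imp fun h => h.ne
    · rw [List.pairwise_map]
      refine List.nodup_range.imp fun {i j} hij x hx hy => hij ?_
      have h1 := (List.mem_filter.1 hx).2
      have h2 := (List.mem_filter.1 hy).2
      simp only [decide_eq_true_eq] at h1 h2
      omega
  refine ⟨(List.range N).map row, isTableau_map_range hne hs hc, hnd, hmem, fun k => ?_,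
    fun i => ?_⟩
  · refine ((mem_getD_iff hnd).1 ?_).2
    rw [hgetD]
    exact List.mem_filter.2 ⟨List.mem_range.2 k.2, by simp⟩
  · rw [rowLength, hgetD, content_eq_length_filter]

theorem exists_permWord_eq {n : ℕ} {w : List ℕ} (hn : w.Nodup) (hl : w.length = n)
    (hw : ∀ k ∈ w, k < n) : ∃ σ : Equiv.Perm (Fin n), permWord σ = w := by
  subst hl
  have hinj : Function.Injective fun k : Fin w.length =>
      (⟨w[k], hw _ (List.getElem_mem _)⟩ : Fin w.length) := by
    intro i j hij
    simp only [Fin.mk.injEq] at hij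
    exact Fin.ext ((hn.getElem_inj_iff).1 hij)
  refine ⟨Equiv.ofBijective _ (Finite.injective_iff_bijective.1 hinj), ?_⟩
  rw [permWord]
  apply List.ext_getElem <;> simp

/-- The Robinson-Schensted correspondence between permutations and pairs of standard tableaux of
the same shape, encoded by Yamanouchi words. -/
theorem bijOn_robinsonSchensted {n : ℕ} (lam : n.Partition) (t t' : Fin n → ℕ) :
    Set.BijOn (fun σ : Equiv.Perm (Fin n) => (insertionRows σ, recordingRows σ))
      {σ | rskShape σ = lam ∧ IncreasingOnRuns t σ⁻¹ ∧ IncreasingOnRuns t' σ}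
      (yamanouchiWords lam t ×ˢ yamanouchiWords lam t') := by
  refine ⟨?_, ?_, ?_⟩
  · rintro σ ⟨h1, h2, h3⟩
    rw [rskShape_eq_iff] at h1
    refine ⟨⟨isYamanouchi_insertionRows σ, Finsupp.ext fun i => ?_, fun p q hpq ht => ?_⟩,
      ⟨?_, Finsupp.ext fun i => ?_, fun p q hpq ht => ?_⟩⟩
    · rw [← h1, content_insertionRows]
    · exact (inv_lt_inv_iff_rowOf_le σ hpq).1 (h2 p q hpq ht)
    · rw [ofFn_recordingRows]
      exact isYamanouchi_recordingWord (permWord_nodup σ)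
    · rw [← h1, content_recordingRows]
    · exact (recordingRows_le_iff σ hpq).2 (h3 p q hpq ht)
  · rintro σ - τ - h
    rw [Prod.mk.injEq] at h
    have h1 := insertionTableau_injective h.1
    have h2 := recordingWord_injective (permWord_nodup σ) (permWord_nodup τ) h1
      (by rw [← ofFn_recordingRows, ← ofFn_recordingRows, h.2])
    refine Equiv.ext fun k => Fin.ext ?_
    exact congrFun (List.ofFn_injective h2) k
  · rintro ⟨r, s⟩ ⟨⟨hr, hrc, hrt⟩, ⟨hs, hsc, hst⟩⟩
    obtain ⟨T, hT, hnd, hmem, hrow, hlen⟩ := exists_tableau_of_isYamanouchi hr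
    obtain ⟨w, hw, hwT, hws⟩ := exists_recordingWord_eq hs hT hnd fun i => by
      rw [hlen, count_ofFn, hrc, hsc]
    have hperm := (isTableau_foldl hw).2
    rw [hwT] at hperm
    obtain ⟨σ, hσ⟩ := exists_permWord_eq hw
      (by rw [← length_recordingWord [] w, hws, List.length_ofFn])
      (fun k hk => (hmem k).1 (hperm.mem_iff.2 hk))
    have h1 : insertionTableau σ = T := by rw [insertionTableau_eq, hσ, hwT]
    have h2 : insertionRows σ = r := by
      ext k; rw [insertionRows, h1, hrow]
    have h3 : recordingRows σ = s := by
      apply List.ofFn_injective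
      rw [ofFn_recordingRows, hσ, hws]
    refine ⟨σ, ⟨?_, fun p q hpq ht => ?_, fun p q hpq ht => ?_⟩, Prod.ext h2 h3⟩
    · rw [rskShape_eq_iff]
      intro i
      rw [h1, hlen, hrc]
    · rw [inv_lt_inv_iff_rowOf_le σ hpq]
      have := hrt p q hpq ht
      rwa [← h2] at this
    · rw [← recordingRows_le_iff σ hpq, h3]
      exact hst p q hpq ht

/-- The run conditions for `t` and `t'` bear on the recoils and on the descents of `σ`, which are
read on the insertion tableau and on the recording tableau respectively; so the count factors. -/
theorem card_robinsonSchensted {n : ℕ} (lam : n.Partition) (t t' : Fin n → ℕ) :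
    {σ : Equiv.Perm (Fin n) | rskShape σ = lam ∧ IncreasingOnRuns t σ⁻¹ ∧
      IncreasingOnRuns t' σ}.ncard = kostka lam t * kostka lam t' := by
  have h := bijOn_robinsonSchensted lam t t'
  rw [kostka, kostka, ← Set.ncard_prod, ← h.image_eq, h.injOn.ncard_image]

/-! ### Triangularity of the Kostka numbers -/

/-- The sum of the letters of the words of content `m`. -/
def contentWeight (m : ℕ →₀ ℕ) : ℕ := Finsupp.weight id m

theorem contentWeight_content {n : ℕ} (w : Fin n → ℕ) : contentWeight (content w) = ∑ p, w p := by
  rw [contentWeight, content, map_sum]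
  simp [Finsupp.weight_single]

theorem IsYamanouchi.exists_lt {n : ℕ} {r : Fin n → ℕ} (hr : IsYamanouchi (List.ofFn r))
    {p : Fin n} {i : ℕ} (hp : r p = i + 1) : ∃ q < p, r q = i := by
  have h := hr (p + 1) i
  have h1 : i + 1 ∈ (List.ofFn r).take (p + 1) :=
    List.mem_take_iff_getElem.2 ⟨p, by simp, by simpa using hp⟩
  have h2 : i ∈ (List.ofFn r).take (p + 1) := by
    rw [← List.count_pos_iff] at h1 ⊢
    omega
  obtain ⟨j, hj, hji⟩ := List.mem_take_iff_getElem.1 h2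
  simp only [List.getElem_ofFn] at hji
  rw [List.length_ofFn] at hj
  refine ⟨⟨j, by omega⟩, ?_, hji⟩
  rw [Fin.lt_def]
  simp only
  by_contra h3
  have : (⟨j, by omega⟩ : Fin n) = p := Fin.ext (by simp only; omega)
  rw [this, hp] at hji
  omega

/-- A Yamanouchi word that decreases weakly along the runs of `t` is bounded by `t`. -/
theorem le_of_mem_yamanouchiWords {n : ℕ} {lam : n.Partition} {t r : Fin n → ℕ} (ht : Monotone t)
    (hr : r ∈ yamanouchiWords lam t) (p : Fin n) : r p ≤ t p := by
  have key : ∀ k (hk : k < n), ∀ q : Fin n, (q : ℕ) ≤ k → r q ≤ t ⟨k, hk⟩ := by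
    intro k
    induction k with
    | zero =>
      intro hk q hq
      rcases h : r q with _ | i
      · omega
      · obtain ⟨q', hq', -⟩ := hr.1.exists_lt h
        rw [Fin.lt_def] at hq'
        omega
    | succ k ih =>
      intro hk q hq
      have hle : t ⟨k, by omega⟩ ≤ t ⟨k + 1, hk⟩ := ht (by simp [Fin.le_def])
      rcases Nat.lt_or_ge q (k + 1) with h1 | h1
      · exact (ih (by omega) q (by omega)).trans hle
      · have hqk : q = ⟨k + 1, hk⟩ := Fin.ext (by simp only; omega)
        subst hqk
        -- Inside a run of `t` the word decreases weakly. Where `t` increases, a letter `i + 1` has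
        -- an `i` before it, bounded by the previous value of `t`, which leaves room for one more.
        rcases hle.eq_or_lt with h2 | h2
        · exact (hr.2.2 ⟨k, by omega⟩ _ rfl h2).trans (h2 ▸ ih (by omega) ⟨k, by omega⟩ le_rfl)
        · rcases h : r ⟨k + 1, hk⟩ with _ | i
          · omega
          · obtain ⟨q', hq', h3⟩ := hr.1.exists_lt h
            have := ih (by omega) q' (by rw [Fin.lt_def] at hq'; simp only at hq'; omega)
            omega
  exact key p p.2 p le_rfl

/-- A word `r` counted here satisfies `r ≤ t` letter by letter, so the weight inequality forces `r =
t` and equal contents. The weight is a numerical substitute for the dominance order. -/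
theorem kostka_eq_zero {n : ℕ} {lam : n.Partition} {t : Fin n → ℕ} (ht : Monotone t)
    (hw : contentWeight (content t) ≤ contentWeight (shapeContent lam))
    (hne : content t ≠ shapeContent lam) : kostka lam t = 0 := by
  have : yamanouchiWords lam t = ∅ := by
    rw [Set.eq_empty_iff_forall_notMem]
    intro r hr
    have hle := le_of_mem_yamanouchiWords ht hr
    rw [← hr.2.1, contentWeight_content, contentWeight_content] at hw
    have heq := (Finset.sum_eq_sum_iff_of_le fun p _ => hle p).1
      (le_antisymm (Finset.sum_le_sum fun p _ => hle p) hw)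
    refine hne ?_
    rw [← hr.2.1]
    congr 1
    ext p
    exact (heq p (Finset.mem_univ p)).symm
  rw [kostka, this, Set.ncard_empty]

/-- As soon as `i + 1` occurs in a prefix of an increasing word, every `i` of the word has been
read, so the counts are those of the whole content. -/
theorem isYamanouchi_of_monotone {n : ℕ} {t : Fin n → ℕ} (ht : Monotone t)
    (hc : Antitone (content t)) : IsYamanouchi (List.ofFn t) := by
  intro k i
  by_cases h : i + 1 ∈ (List.ofFn t).take k
  · have hs : (List.ofFn t).Pairwise (· ≤ ·) := (List.sortedLE_ofFn_iff.2 ht).pairwise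
    rw [← List.take_append_drop k (List.ofFn t), List.pairwise_append] at hs
    have h0 : ((List.ofFn t).drop k).count i = 0 := by
      rw [List.count_eq_zero]
      intro hi
      have := hs.2.2 _ h _ hi
      omega
    have h1 : ∀ j, ((List.ofFn t).take k).count j + ((List.ofFn t).drop k).count j =
        content t j := by
      intro j
      rw [← List.count_append, List.take_append_drop, count_ofFn]
    have h2 := h1 i
    have h3 := h1 (i + 1)
    have h4 := hc (Nat.le_succ i)
    simp only [Nat.succ_eq_add_one] at h4
    omega
  · rw [List.count_eq_zero.2 h]
    exact Nat.zero_le _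

theorem kostka_self {n : ℕ} {lam : n.Partition} {t : Fin n → ℕ} (ht : Monotone t)
    (hc : content t = shapeContent lam) : kostka lam t = 1 := by
  have : yamanouchiWords lam t = {t} := by
    ext r
    rw [Set.mem_singleton_iff]
    constructor
    · intro hr
      have hle := le_of_mem_yamanouchiWords ht hr
      have hw : ∑ p, r p = ∑ p, t p := by
        rw [← contentWeight_content, ← contentWeight_content, hc, hr.2.1]
      ext p
      exact (Finset.sum_eq_sum_iff_of_le fun p _ => hle p).1 hw p (Finset.mem_univ p)
    · rintro rfl
      exact ⟨isYamanouchi_of_monotone ht (hc ▸ shapeContent_antitone lam), hc,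
        fun p q _ h => h.ge⟩
  rw [kostka, this, Set.ncard_singleton]

/-! ### Pairs of words up to permutation -/

theorem IncreasingOnRuns.lt {n : ℕ} {t : Fin n → ℕ} (ht : Monotone t) {σ : Equiv.Perm (Fin n)}
    (h : IncreasingOnRuns t σ) {p q : Fin n} (hpq : p < q) (he : t p = t q) : σ p < σ q := by
  have key : ∀ d : ℕ, ∀ hd : p.val + d + 1 < n, p.val + d + 1 ≤ q.val →
      σ p < σ ⟨p.val + d + 1, hd⟩ := by
    intro d
    induction d with
    | zero =>
      intro hd hle
      refine h p _ rfl (le_antisymm (ht (by simp [Fin.le_def])) ?_)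
      rw [he]
      exact ht (Fin.le_def.2 hle)
    | succ d ih =>
      intro hd hle
      refine (ih (by omega) (by omega)).trans (h _ _ rfl (le_antisymm (ht (by simp [Fin.le_def])) ?_))
      refine (ht (Fin.le_def.2 hle)).trans ?_
      rw [← he]
      exact ht (by simp [Fin.le_def]; omega)
  have h1 := key (q - p - 1) (by have := Fin.lt_def.1 hpq; omega)
    (by have := Fin.lt_def.1 hpq; omega)
  have h2 : (⟨p.val + (q.val - p.val - 1) + 1, by have := Fin.lt_def.1 hpq; omega⟩ : Fin n) = q :=
    Fin.ext (by have := Fin.lt_def.1 hpq; simp only; omega)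
  rwa [h2] at h1

theorem content_comp_perm {n : ℕ} (t : Fin n → ℕ) (σ : Equiv.Perm (Fin n)) :
    content (t ∘ σ) = content t :=
  Equiv.sum_comp σ fun p => Finsupp.single (t p) 1

theorem finite_setOf_content_eq (n : ℕ) (m : ℕ →₀ ℕ) : {w : Fin n → ℕ | content w = m}.Finite := by
  refine (Set.Finite.pi' fun _ : Fin n => m.support.finite_toSet).subset ?_
  rintro w rfl p
  rw [Finset.mem_coe, Finsupp.mem_support_iff, content_apply]
  exact (Finset.card_pos.2 ⟨p, by simp⟩).ne'

/-- Words in pairs of letters; the first letters form a word of content `m'`, the second letters a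
word of content `m`. -/
abbrev BiWord (n : ℕ) (m m' : ℕ →₀ ℕ) : Type :=
  {x : Fin n → ℕ ×ₗ ℕ // content (fun p => (ofLex (x p)).2) = m ∧
    content (fun p => (ofLex (x p)).1) = m'}

theorem BiWord.ext {n : ℕ} {m m' : ℕ →₀ ℕ} {x y : BiWord n m m'}
    (h : ∀ p, x.1 p = y.1 p) : x = y := Subtype.ext (funext h)

instance (n : ℕ) (m m' : ℕ →₀ ℕ) : MulAction (Equiv.Perm (Fin n)) (BiWord n m m') where
  smul g x := ⟨x.1 ∘ ⇑g⁻¹, (content_comp_perm _ g⁻¹).trans x.2.1,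
    (content_comp_perm _ g⁻¹).trans x.2.2⟩
  one_smul _ := rfl
  mul_smul g h x := BiWord.ext fun p => congrArg x.1 (by rw [mul_inv_rev, Equiv.Perm.mul_apply])

theorem BiWord.smul_val {n : ℕ} {m m' : ℕ →₀ ℕ} (g : Equiv.Perm (Fin n)) (x : BiWord n m m') :
    (g • x).1 = x.1 ∘ ⇑g⁻¹ := rfl

instance (n : ℕ) (m m' : ℕ →₀ ℕ) : Finite (BiWord n m m') := by
  have h1 := (finite_setOf_content_eq n m).to_subtype
  have h2 := (finite_setOf_content_eq n m').to_subtype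
  refine Finite.of_injective (fun x : BiWord n m m' =>
    ((⟨_, x.2.1⟩, ⟨_, x.2.2⟩) : {w : Fin n → ℕ | content w = m} × {w : Fin n → ℕ | content w = m'}))
    fun x y h => ?_
  simp only [Prod.mk.injEq, Subtype.mk.injEq] at h
  exact BiWord.ext fun p => Prod.ext (congrFun h.2 p) (congrFun h.1 p)

/-- The number of words of content `m` fixed by the permutation `g` of the positions. -/
def wordCharacter {n : ℕ} (m : ℕ →₀ ℕ) (g : Equiv.Perm (Fin n)) : ℕ :=
  {w : Fin n → ℕ | content w = m ∧ w ∘ g = w}.ncard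

theorem ncard_fixedBy_biWord {n : ℕ} (m m' : ℕ →₀ ℕ) (g : Equiv.Perm (Fin n)) :
    Nat.card (MulAction.fixedBy (BiWord n m m') g) = wordCharacter m g * wordCharacter m' g := by
  rw [wordCharacter, wordCharacter, ← Set.ncard_prod, ← Nat.card_coe_set_eq]
  have hfix : ∀ {α : Type} {w : Fin n → α}, w ∘ ⇑g⁻¹ = w ↔ w ∘ g = w := by
    intro α w
    constructor
    · intro h
      nth_rewrite 1 [← h]
      ext p; simp
    · intro h
      nth_rewrite 1 [← h]
      ext p; simp
  refine Nat.card_congr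
    ⟨fun x => ⟨(fun p => (ofLex (x.1.1 p)).2, fun p => (ofLex (x.1.1 p)).1), ?_⟩,
      fun w => ⟨⟨fun p => toLex (w.1.2 p, w.1.1 p), w.2.1.1, w.2.2.1⟩, ?_⟩, fun _ => rfl,
      fun _ => rfl⟩
  · have h : x.1.1 ∘ g = x.1.1 := hfix.1 (congrArg Subtype.val x.2)
    exact ⟨⟨x.1.2.1, funext fun p => congrArg (fun y => (ofLex y).2) (congrFun h p)⟩,
      ⟨x.1.2.2, funext fun p => congrArg (fun y => (ofLex y).1) (congrFun h p)⟩⟩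
  · rw [MulAction.mem_fixedBy]
    refine Subtype.ext ((hfix (w := fun p => toLex (w.1.2 p, w.1.1 p))).2 (funext fun p => ?_))
    exact congrArg toLex (Prod.ext (congrFun w.2.2.2 p) (congrFun w.2.1.2 p))

/-- Every orbit contains exactly one increasing word. -/
theorem card_orbits_biWord (n : ℕ) (m m' : ℕ →₀ ℕ) :
    Nat.card (Quotient (MulAction.orbitRel (Equiv.Perm (Fin n)) (BiWord n m m'))) =
      Nat.card {x : BiWord n m m' // Monotone x.1} := by
  symm
  refine Nat.card_eq_of_bijective (fun x => Quotient.mk _ x.1) ⟨fun x y h => ?_, fun c => ?_⟩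
  · obtain ⟨g, hg⟩ := MulAction.orbitRel_apply.1 (Quotient.exact h)
    have hg' : y.1.1 ∘ ⇑g⁻¹ = x.1.1 := congrArg Subtype.val hg
    refine Subtype.ext (Subtype.ext ?_)
    rw [← hg']
    exact (Tuple.unique_monotone (σ := g⁻¹) (τ := 1) (by rw [hg']; exact x.2) y.2)
  · induction c using Quotient.inductionOn with
    | _ x =>
      refine ⟨⟨(Tuple.sort x.1)⁻¹ • x, ?_⟩, ?_⟩
      · rw [BiWord.smul_val, inv_inv]
        exact Tuple.monotone_sort x.1
      · exact Quotient.sound (MulAction.orbitRel_apply.2 ⟨_, rfl⟩)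

theorem inv_eq_sort {n : ℕ} {t : Fin n → ℕ} (ht : Monotone t) {σ : Equiv.Perm (Fin n)}
    (h : IncreasingOnRuns t σ⁻¹) : σ⁻¹ = Tuple.sort (t ∘ σ) := by
  rw [Tuple.eq_sort_iff]
  have : (t ∘ σ) ∘ ⇑σ⁻¹ = t := by ext p; simp
  exact ⟨by rw [this]; exact ht, fun i j hij he => h.lt ht hij (by simpa using he)⟩

/-- Increasing words in pairs of letters are encoded by permutations. -/
theorem card_monotone_biWord {n : ℕ} {t t' : Fin n → ℕ} (ht : Monotone t) (ht' : Monotone t') :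
    Nat.card {x : BiWord n (content t) (content t') // Monotone x.1} =
      {σ : Equiv.Perm (Fin n) | IncreasingOnRuns t σ⁻¹ ∧ IncreasingOnRuns t' σ}.ncard := by
  rw [← Nat.card_coe_set_eq]
  symm
  refine Nat.card_eq_of_bijective (fun σ => ⟨⟨fun p => toLex (t' p, t (σ.1 p)),
    content_comp_perm t σ.1, rfl⟩, fun p q hpq => ?_⟩) ⟨fun σ τ h => ?_, fun x => ?_⟩
  · rw [Prod.Lex.le_iff]
    rcases (ht' hpq).lt_or_eq with h | h
    · exact Or.inl h
    · refine Or.inr ⟨h, ht ?_⟩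
      rcases hpq.lt_or_eq with h1 | h1
      · exact (σ.2.2.lt ht' h1 h).le
      · rw [h1]
  · have h1 : t ∘ σ.1 = t ∘ τ.1 := by
      ext p
      have := congrFun (congrArg Subtype.val (congrArg Subtype.val h)) p
      exact congrArg (fun y => (ofLex y).2) this
    have h2 := inv_eq_sort ht σ.2.1
    rw [h1, ← inv_eq_sort ht τ.2.1] at h2
    exact Subtype.ext (inv_injective h2)
  · obtain ⟨⟨x, hx1, hx2⟩, hx⟩ := x
    set w : Fin n → ℕ := fun p => (ofLex (x p)).2 with hw
    set w' : Fin n → ℕ := fun p => (ofLex (x p)).1 with hw'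
    have hle : ∀ {p q}, p ≤ q → w' p < w' q ∨ w' p = w' q ∧ w p ≤ w q := fun hpq =>
      Prod.Lex.le_iff.1 (hx hpq)
    have hmono : Monotone w' := fun p q hpq => by
      rcases hle hpq with h | h
      · exact h.le
      · exact h.1.le
    obtain h1 : w' = t' := content_injOn hmono ht' hx2
    have hsort : w ∘ Tuple.sort w = t :=
      content_injOn (Tuple.monotone_sort w) ht ((content_comp_perm _ _).trans hx1)
    have hwt : w = t ∘ ⇑(Tuple.sort w)⁻¹ := by
      rw [← hsort]; ext p; simp
    have hinc : IncreasingOnRuns t ((Tuple.sort w)⁻¹)⁻¹ := by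
      intro p q hpq he
      rw [inv_inv]
      refine ((Tuple.eq_sort_iff (f := w) (σ := Tuple.sort w)).1 rfl).2 p q
        (Fin.lt_def.2 (by omega)) ?_
      rw [← hsort] at he
      exact he
    -- The permutation is the standardization of the word `w` of second letters, the inverse of its
    -- stable sort. A descent of it inside a run of `t'` would occur between equal letters of `w`,
    -- since `w` increases weakly there, and stability of the sort excludes this.
    refine ⟨⟨(Tuple.sort w)⁻¹, hinc, fun p q hpq he => ?_⟩, ?_⟩
    · have hlt : p < q := Fin.lt_def.2 (by omega)
      have h2 : w p ≤ w q := by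
        rcases hle hlt.le with h | h
        · rw [h1] at h; omega
        · exact h.2
      by_contra h3
      have h4 : (Tuple.sort w)⁻¹ q < (Tuple.sort w)⁻¹ p :=
        lt_of_le_of_ne (not_lt.1 h3) fun h => hlt.ne' ((Tuple.sort w)⁻¹.injective h)
      have h5 : t ((Tuple.sort w)⁻¹ q) = t ((Tuple.sort w)⁻¹ p) := by
        refine le_antisymm (ht h4.le) ?_
        have h6 := congrFun hwt p
        have h7 := congrFun hwt q
        simp only [Function.comp] at h6 h7
        omega
      have := hinc.lt ht h4 h5
      rw [inv_inv] at this
      have h6 : ∀ x, (Tuple.sort w) ((Tuple.sort w)⁻¹ x) = x := fun x => by simp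
      rw [h6, h6] at this
      exact absurd this hlt.not_gt
    · refine Subtype.ext (Subtype.ext (funext fun p => ?_))
      exact congrArg toLex (Prod.ext (congrFun h1 p).symm (congrFun hwt p).symm)

/-- The permutations on the right are classified by their shape. This is the combinatorial side of
the Gram matrix comparison. -/
theorem sum_kostka_mul_kostka {n : ℕ} (t t' : Fin n → ℕ) :
    ∑ lam : n.Partition, kostka lam t * kostka lam t' =
      {σ : Equiv.Perm (Fin n) | IncreasingOnRuns t σ⁻¹ ∧ IncreasingOnRuns t' σ}.ncard := by
  classical
  simp only [← card_robinsonSchensted]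
  simp only [Set.ncard_eq_toFinset_card']
  rw [Finset.card_eq_sum_card_fiberwise (f := rskShape) (t := univ) (fun _ _ => Finset.mem_univ _)]
  refine Finset.sum_congr rfl fun lam _ => congrArg _ ?_
  ext σ
  simp
  tauto

/-- The scalar products of the characters of the modules of words. -/
theorem sum_wordCharacter_mul_wordCharacter {n : ℕ} {t t' : Fin n → ℕ} (ht : Monotone t)
    (ht' : Monotone t') :
    ∑ g : Equiv.Perm (Fin n), wordCharacter (content t) g * wordCharacter (content t') g =
      (∑ lam : n.Partition, kostka lam t * kostka lam t') * n.factorial := by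
  classical
  -- Burnside's lemma: the fixed words in pairs of letters, summed over the group, count the orbits,
  -- each of which has a unique increasing representative.
  rw [sum_kostka_mul_kostka, ← card_monotone_biWord ht ht', ← card_orbits_biWord]
  have : Fintype (BiWord n (content t) (content t')) := Fintype.ofFinite _
  have h := MulAction.sum_card_fixedBy_eq_card_orbits_mul_card_group (Equiv.Perm (Fin n))
    (BiWord n (content t) (content t'))
  rw [Fintype.card_perm, Fintype.card_fin] at h
  rw [Nat.card_eq_fintype_card, ← h]
  refine Finset.sum_congr rfl fun g _ => ?_
  rw [← ncard_fixedBy_biWord, Nat.card_eq_fintype_card]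

/-! ### Positions in blocks -/

/-- The number of elements of the block of `p` that are smaller than `p`. -/
def posInBlock {n : ℕ} (blk : Fin n → ℕ) (p : Fin n) : ℕ := #{q | blk q = blk p ∧ q < p}

/-- The permutation `π` maps every block to itself. -/
def PreservesBlocks {n : ℕ} (blk : Fin n → ℕ) (π : Equiv.Perm (Fin n)) : Prop :=
  ∀ p, blk (π p) = blk p

/-- Each pair of distinct elements of a block is counted once, in the order that `f` gives it. The
sum therefore does not depend on `f`, as long as `f` is injective on every block. -/
theorem two_mul_sum_card_lt {n : ℕ} {α : Type*} [LinearOrder α] (blk : Fin n → ℕ) {f : Fin n → α}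
    (hf : ∀ p q, blk p = blk q → f p = f q → p = q) :
    2 * ∑ p, #{q | blk q = blk p ∧ f q < f p} = ∑ p, #{q | blk q = blk p ∧ q ≠ p} := by
  have h1 : ∑ p, #{q | blk q = blk p ∧ f q < f p} = ∑ p, #{q | blk q = blk p ∧ f p < f q} := by
    simp only [Finset.card_filter]
    rw [Finset.sum_comm]
    refine Finset.sum_congr rfl fun p _ => Finset.sum_congr rfl fun q _ => ?_
    simp only [@eq_comm _ (blk p)]
  rw [two_mul]
  conv_lhs => rw [h1]
  nth_rewrite 1 [← h1]
  rw [← Finset.sum_add_distrib]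
  refine Finset.sum_congr rfl fun p _ => ?_
  rw [← Finset.card_union_of_disjoint]
  · congr 1
    ext q
    simp only [Finset.mem_union, Finset.mem_filter, Finset.mem_univ, true_and]
    constructor
    · rintro (h | h)
      · exact ⟨h.1, fun hqp => by rw [hqp] at h; exact lt_irrefl _ h.2⟩
      · exact ⟨h.1, fun hqp => by rw [hqp] at h; exact lt_irrefl _ h.2⟩
    · rintro ⟨h, hne⟩
      rcases lt_trichotomy (f q) (f p) with h2 | h2 | h2
      · exact Or.inl ⟨h, h2⟩
      · exact absurd (hf q p h h2) hne
      · exact Or.inr ⟨h, h2⟩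
  · rw [Finset.disjoint_left]
    intro q hq hq'
    exact lt_asymm (Finset.mem_filter.1 hq).2.2 (Finset.mem_filter.1 hq').2.2

/-- The values of `e` at the counted elements are distinct natural numbers below `e p`. -/
theorem card_lt_le {n : ℕ} (blk : Fin n → ℕ) {e : Fin n → ℕ}
    (he : ∀ p q, blk p = blk q → e p = e q → p = q) (p : Fin n) :
    #{q | blk q = blk p ∧ e q < e p} ≤ e p := by
  refine (Finset.card_le_card_of_injOn e (t := range (e p)) ?_ ?_).trans (Finset.card_range _).le
  · intro q hq
    simp only [Finset.coe_filter, Finset.mem_univ, true_and, Set.mem_ofPred_eq] at hq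
    simpa using hq.2
  · intro q hq q' hq' h
    simp only [Finset.coe_filter, Finset.mem_univ, true_and, Set.mem_ofPred_eq] at hq hq'
    exact he q q' (hq.1.trans hq'.1.symm) h

/-- Exponents which are distinct on every block and whose sum is minimal. -/
theorem exists_perm_of_sum_le {n : ℕ} {blk : Fin n → ℕ} {e : Fin n → ℕ}
    (he : ∀ p q, blk p = blk q → e p = e q → p = q) (hsum : ∑ p, e p ≤ ∑ p, posInBlock blk p) :
    ∃ π : Equiv.Perm (Fin n), PreservesBlocks blk π ∧ ∀ p, e p = posInBlock blk (π p) := by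
  have h1 := two_mul_sum_card_lt blk he
  have h2 := two_mul_sum_card_lt blk (f := fun p : Fin n => p) fun p q _ h => h
  -- The ranks of the `e p` in their blocks have the same sum as the positions, which is the least
  -- possible sum of exponents. Equality must then hold termwise: on every block, `e` takes the
  -- values 0, 1, 2, … once each.
  have h3 : ∑ p, #{q | blk q = blk p ∧ e q < e p} = ∑ p, e p :=
    le_antisymm (Finset.sum_le_sum fun p _ => card_lt_le blk he p) (hsum.trans (by
      simp only [posInBlock]; omega))
  have h4 := (Finset.sum_eq_sum_iff_of_le fun p _ => card_lt_le blk he p).1 h3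
  have hlt : ∀ p, e p < #{q | blk q = blk p} := by
    intro p
    rw [← h4 p (Finset.mem_univ p)]
    refine Finset.card_lt_card (Finset.ssubset_iff_of_subset ?_ |>.2 ⟨p, by simp, by simp⟩)
    intro q hq
    simp only [Finset.mem_filter, Finset.mem_univ, true_and] at hq ⊢
    exact hq.1
  have hinj : ∀ p q, blk p = blk q → posInBlock blk p = posInBlock blk q → p = q := by
    have key : ∀ p q, blk p = blk q → p < q → posInBlock blk p < posInBlock blk q := by
      intro p q hb hpq
      refine Finset.card_lt_card (Finset.ssubset_iff_of_subset ?_ |>.2 ⟨p, ?_, by simp⟩)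
      · intro x hx
        simp only [Finset.mem_filter, Finset.mem_univ, true_and] at hx ⊢
        exact ⟨hx.1.trans hb, hx.2.trans hpq⟩
      · simp [hb, hpq]
    intro p q hb h
    rcases lt_trichotomy p q with h' | h' | h'
    · exact absurd h (key p q hb h').ne
    · exact h'
    · exact absurd h (key q p hb.symm h').ne'
  have hex : ∀ p, ∃ q, blk q = blk p ∧ posInBlock blk q = e p := by
    intro p
    have := Finset.surjOn_of_injOn_of_card_le (s := ({q | blk q = blk p} : Finset (Fin n)))
      (t := range #{q | blk q = blk p}) (posInBlock blk) ?_ ?_ (by rw [Finset.card_range])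
    · obtain ⟨q, hq, hqe⟩ := this (Finset.mem_coe.2 (Finset.mem_range.2 (hlt p)))
      exact ⟨q, by simpa using hq, hqe⟩
    · intro q hq
      simp only [Finset.coe_filter, Finset.mem_univ, true_and, Set.mem_ofPred_eq] at hq
      simp only [Finset.coe_range, Set.mem_Iio]
      rw [← hq]
      refine Finset.card_lt_card (Finset.ssubset_iff_of_subset ?_ |>.2 ⟨q, by simp, by simp⟩)
      intro x hx
      simp only [Finset.mem_filter, Finset.mem_univ, true_and] at hx ⊢
      exact hx.1
    · intro q hq q' hq' h
      simp only [Finset.coe_filter, Finset.mem_univ, true_and, Set.mem_ofPred_eq] at hq hq'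
      exact hinj q q' (hq.trans hq'.symm) h
  choose π hπ1 hπ2 using hex
  have hπ : Function.Injective π := by
    intro p q h
    refine he p q ?_ ?_
    · rw [← hπ1 p, ← hπ1 q, h]
    · rw [← hπ2 p, ← hπ2 q, h]
  exact ⟨Equiv.ofBijective π (Finite.injective_iff_bijective.1 hπ), hπ1, fun p => (hπ2 p).symm⟩

/-! ### Antisymmetric polynomials -/

theorem coe_mapDomain_perm {n : ℕ} (e : Fin n →₀ ℕ) (π : Equiv.Perm (Fin n)) :
    ⇑(e.mapDomain π) = e ∘ ⇑π⁻¹ := by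
  ext p
  rw [Finsupp.mapDomain_equiv_apply]
  rfl

/-- The polynomial `P` is antisymmetric in the variables of every block. -/
def IsBlockAntisymmetric {n : ℕ} (blk : Fin n → ℕ) (P : MvPolynomial (Fin n) ℂ) : Prop :=
  ∀ π, PreservesBlocks blk π → permuteVariables n π P = ((Equiv.Perm.sign π : ℤ) : ℂ) • P

theorem permuteVariables_apply {n : ℕ} (π : Equiv.Perm (Fin n)) (P : MvPolynomial (Fin n) ℂ) :
    permuteVariables n π P = MvPolynomial.rename π P := rfl

theorem IsBlockAntisymmetric.coeff_eq {n : ℕ} {blk : Fin n → ℕ} {P : MvPolynomial (Fin n) ℂ}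
    (hP : IsBlockAntisymmetric blk P) {π : Equiv.Perm (Fin n)} (hπ : PreservesBlocks blk π)
    (e : Fin n →₀ ℕ) :
    P.coeff e = ((Equiv.Perm.sign π : ℤ) : ℂ) * P.coeff (e.mapDomain π) := by
  rw [← MvPolynomial.coeff_rename_mapDomain π π.injective P e, ← permuteVariables_apply, hP π hπ,
    MvPolynomial.coeff_smul, smul_eq_mul]

/-- If two exponents in a block were equal, their transposition would fix the monomial and change
the sign of its coefficient. -/
theorem IsBlockAntisymmetric.injOn {n : ℕ} {blk : Fin n → ℕ} {P : MvPolynomial (Fin n) ℂ}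
    (hP : IsBlockAntisymmetric blk P) {e : Fin n →₀ ℕ} (he : P.coeff e ≠ 0) :
    ∀ p q, blk p = blk q → e p = e q → p = q := by
  intro p q hb h
  by_contra hne
  have h1 := hP.coeff_eq (π := Equiv.swap p q) (fun x => by
    rcases eq_or_ne x p with rfl | h1
    · rw [Equiv.swap_apply_left, hb]
    rcases eq_or_ne x q with rfl | h2
    · rw [Equiv.swap_apply_right, hb]
    rw [Equiv.swap_apply_of_ne_of_ne h1 h2]) e
  have h2 : e.mapDomain (Equiv.swap p q) = e := by
    apply DFunLike.coe_injective
    rw [coe_mapDomain_perm]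
    ext x
    rw [Function.comp, Equiv.swap_inv]
    rcases eq_or_ne x p with rfl | h1
    · rw [Equiv.swap_apply_left, h]
    rcases eq_or_ne x q with rfl | h2
    · rw [Equiv.swap_apply_right, h]
    rw [Equiv.swap_apply_of_ne_of_ne h1 h2]
  rw [h2, Equiv.Perm.sign_swap hne] at h1
  refine he ?_
  simp only [Units.val_neg, Units.val_one, Int.cast_neg, Int.cast_one, neg_mul, one_mul] at h1
  exact self_eq_neg.1 h1

/-- The exponent of the leading monomial of the product of the Vandermonde products of the
blocks. -/
def leadingExponent {n : ℕ} (blk : Fin n → ℕ) : Fin n →₀ ℕ :=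
  Finsupp.equivFunOnFinite.symm (posInBlock blk)

/-- Exponents of minimal sum that are distinct on every block are the positions in the blocks,
permuted by some block-preserving `π`. By antisymmetry the coefficient is then that of the leading
monomial up to sign, so this one coefficient controls all terms of minimal degree. -/
theorem IsBlockAntisymmetric.eq_mapDomain {n : ℕ} {blk : Fin n → ℕ} {P : MvPolynomial (Fin n) ℂ}
    (hP : IsBlockAntisymmetric blk P) {e : Fin n →₀ ℕ} (he : P.coeff e ≠ 0)
    (hsum : ∑ p, e p ≤ ∑ p, posInBlock blk p) :
    content e = content (posInBlock blk) ∧ P.coeff (leadingExponent blk) ≠ 0 := by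
  obtain ⟨π, hπ, h⟩ := exists_perm_of_sum_le (hP.injOn he) hsum
  have h1 : ⇑e = posInBlock blk ∘ π := funext h
  refine ⟨by rw [h1, content_comp_perm], fun h0 => he ?_⟩
  have h2 : e.mapDomain π = leadingExponent blk := by
    apply DFunLike.coe_injective
    rw [coe_mapDomain_perm, h1]
    ext x
    simp [leadingExponent]
  rw [hP.coeff_eq hπ, h2, h0, mul_zero]

/-! ### The products of Vandermonde products -/

theorem sum_take_mono (b : List ℕ) : Monotone fun i => (b.take i).sum := by
  refine monotone_nat_of_le_succ fun i => ?_
  rcases Nat.lt_or_ge i b.length with h | h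
  · rw [List.take_succ_eq_append_getElem h, List.sum_append]; omega
  · rw [List.take_of_length_le h, List.take_of_length_le (by omega)]

/-- Partial sums increase, so the blocks that end before or at `p` are the first ones;
`card_filter_lt_iff` is applied to their indicator function. -/
theorem lt_blockIndex_iff {b : List ℕ} {p i : ℕ} (hi : i < b.length) :
    i < blockIndex b p ↔ (b.take (i + 1)).sum ≤ p := by
  have h := card_filter_lt_iff (n := b.length) (i := 0)
    (f := fun i => if (b.take (i + 1)).sum ≤ p then 1 else 0) (fun i j hij => by
      simp only
      have := sum_take_mono b (by omega : i + 1 ≤ j + 1)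
      simp only at this
      split_ifs <;> omega) hi
  have h2 : ∀ k, (0 < if (b.take (k + 1)).sum ≤ p then 1 else 0) ↔ (b.take (k + 1)).sum ≤ p := by
    intro k; split_ifs <;> simp_all
  simp only [h2] at h
  exact h

theorem blockIndex_mono (b : List ℕ) : Monotone (blockIndex b) := by
  intro p q hpq
  refine Finset.card_le_card fun i hi => ?_
  rw [Finset.mem_filter] at hi ⊢
  exact ⟨hi.1, hi.2.trans hpq⟩

theorem blockIndex_lt {b : List ℕ} {p : ℕ} (hp : p < b.sum) : blockIndex b p < b.length := by
  have hle : blockIndex b p ≤ b.length := by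
    rw [blockIndex]
    exact (Finset.card_filter_le _ _).trans (Finset.card_range _).le
  refine lt_of_le_of_ne hle fun h => ?_
  have h0 : b.length ≠ 0 := fun h0 => by
    rw [List.length_eq_zero_iff.1 h0] at hp
    simp at hp
  have := (lt_blockIndex_iff (b := b) (p := p) (i := b.length - 1) (by omega)).1 (by omega)
  rw [Nat.sub_add_cancel (by omega), List.take_length] at this
  omega

theorem blockIndex_eq_iff {b : List ℕ} {p j : ℕ} (hj : j < b.length) :
    blockIndex b p = j ↔ (b.take j).sum ≤ p ∧ p < (b.take (j + 1)).sum := by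
  have h1 := lt_blockIndex_iff (b := b) (p := p) hj
  rcases j with _ | j
  · simp only [List.take_zero, List.sum_nil, Nat.zero_le, true_and]
    omega
  · have h2 := lt_blockIndex_iff (b := b) (p := p) (i := j) (by omega)
    omega

/-- The `i`-th letters of the blocks are as many as the blocks of size greater than `i`. -/
theorem content_posInBlock {n : ℕ} {b : List ℕ} (hb : b.sum = n) (i : ℕ) :
    content (posInBlock fun p : Fin n => blockIndex b p) i =
      #{j ∈ range b.length | i < b.getD j 0} := by
  subst hb
  have htake : ∀ j, (b.take (j + 1)).sum = (b.take j).sum + b.getD j 0 := by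
    intro j
    rcases Nat.lt_or_ge j b.length with h | h
    · rw [List.take_succ_eq_append_getElem h, List.sum_append, List.getD_eq_getElem _ _ h]; simp
    · rw [List.take_of_length_le h, List.take_of_length_le (by omega),
        List.getD_eq_default _ _ h]; simp
  have hpos : ∀ p : Fin b.sum, posInBlock (fun p : Fin b.sum => blockIndex b p) p =
      p - (b.take (blockIndex b p)).sum := by
    intro p
    have h1 := (blockIndex_eq_iff (blockIndex_lt p.2)).1 rfl
    have h2 : ({q | blockIndex b q = blockIndex b p ∧ q < p} : Finset (Fin b.sum)) =
        ((Finset.Ico (b.take (blockIndex b p)).sum p).attachFin fun x hx =>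
          (Finset.mem_Ico.1 hx).2.trans p.2) := by
      ext q
      rw [Finset.mem_attachFin, Finset.mem_Ico, Finset.mem_filter,
        blockIndex_eq_iff (blockIndex_lt p.2), Fin.lt_def]
      simp only [Finset.mem_univ, true_and]
      omega
    rw [posInBlock, h2, Finset.card_attachFin, Nat.card_Ico]
  rw [content_apply]
  refine Finset.card_bij (fun p _ => blockIndex b p) ?_ ?_ ?_
  · intro p hp
    rw [Finset.mem_filter, hpos] at hp
    have h1 := (blockIndex_eq_iff (blockIndex_lt p.2)).1 rfl
    rw [htake] at h1
    rw [Finset.mem_filter, Finset.mem_range]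
    exact ⟨blockIndex_lt p.2, by omega⟩
  · intro p hp q hq h
    rw [Finset.mem_filter, hpos] at hp hq
    have h1 := (blockIndex_eq_iff (blockIndex_lt p.2)).1 rfl
    have h2 := (blockIndex_eq_iff (blockIndex_lt q.2)).1 rfl
    rw [← h] at hq h2
    exact Fin.ext (by omega)
  · intro j hj
    rw [Finset.mem_filter, Finset.mem_range] at hj
    have h1 := htake j
    have h2 : (b.take (j + 1)).sum ≤ b.sum := by
      have := sum_take_mono b (by omega : j + 1 ≤ b.length)
      simpa using this
    have h3 : blockIndex b ((b.take j).sum + i) = j :=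
      (blockIndex_eq_iff hj.1).2 (by omega)
    refine ⟨⟨(b.take j).sum + i, by omega⟩, ?_, h3⟩
    rw [Finset.mem_filter, hpos]
    simp only [Finset.mem_univ, true_and, h3]
    omega

theorem isBlockAntisymmetric_blockVandermonde (n : ℕ) (b : List ℕ) :
    IsBlockAntisymmetric (fun p : Fin n => blockIndex b p) (blockVandermonde n b) := by
  intro π hπ
  -- Pairs from different blocks receive the factor 1 or -1, according to their order. The block
  -- product then becomes a product over all pairs `p < q` of an antisymmetric function, to which
  -- the general sign rule applies.
  set f : Fin n → Fin n → MvPolynomial (Fin n) ℂ := fun p q =>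
    if blockIndex b p = blockIndex b q then MvPolynomial.X p - MvPolynomial.X q
    else if p < q then 1 else -1 with hf
  have hanti : ∀ p q, f p q = - f q p := by
    intro p q
    simp only [hf]
    by_cases h : blockIndex b p = blockIndex b q
    · rw [if_pos h, if_pos h.symm, neg_sub]
    · rw [if_neg h, if_neg (Ne.symm h)]
      have hne : p ≠ q := fun h' => h (by rw [h'])
      rcases lt_or_gt_of_ne hne with h1 | h1
      · rw [if_pos h1, if_neg h1.not_gt, neg_neg]
      · rw [if_neg h1.not_gt, if_pos h1]
  have hprod : blockVandermonde n b = ∏ p, ∏ q ∈ Finset.Ioi p, f p q := by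
    refine Finset.prod_congr rfl fun p _ => ?_
    rw [← Finset.filter_filter, Finset.prod_filter]
    refine Finset.prod_congr (by ext; simp) fun q hq => ?_
    have hpq := Finset.mem_Ioi.1 hq
    simp only [hf]
    rw [if_pos hpq]
  have hren : MvPolynomial.rename π (blockVandermonde n b) =
      ∏ p, ∏ q ∈ Finset.Ioi p, f (π p) (π q) := by
    rw [hprod, map_prod]
    refine Finset.prod_congr rfl fun p _ => ?_
    rw [map_prod]
    refine Finset.prod_congr rfl fun q hq => ?_
    have hpq := Finset.mem_Ioi.1 hq
    have h1 := hπ p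
    have h2 := hπ q
    simp only at h1 h2
    simp only [hf, h1, h2]
    by_cases h : blockIndex b p = blockIndex b q
    · simp [h]
    · have h3 : blockIndex b p < blockIndex b q :=
        lt_of_le_of_ne (blockIndex_mono b (Fin.le_def.1 hpq.le)) h
      -- The blocks are consecutive intervals preserved by `π`, so elements of different blocks keep
      -- their order and their factor remains 1.
      have h4 : π p < π q := by
        by_contra h5
        have := blockIndex_mono b (Fin.le_def.1 (not_lt.1 h5))
        omega
      simp [h, hpq, h4]
  rw [permuteVariables_apply, hren, Equiv.Perm.prod_Ioi_comp_eq_sign_mul_prod π hanti, ← hprod,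
    MvPolynomial.smul_eq_C_mul]
  simp

theorem blockVandermonde_ne_zero (n : ℕ) (b : List ℕ) : blockVandermonde n b ≠ 0 := by
  refine Finset.prod_ne_zero_iff.2 fun p _ => Finset.prod_ne_zero_iff.2 fun q hq => ?_
  have hpq := (Finset.mem_filter.1 hq).2.1
  exact sub_ne_zero.2 fun h => hpq.ne (MvPolynomial.X_injective h)

/-- The product is homogeneous of degree the number of pairs inside blocks, and counting these pairs
by their larger element gives the sum of the positions. -/
theorem sum_eq_of_coeff_blockVandermonde_ne_zero {n : ℕ} {b : List ℕ} {e : Fin n →₀ ℕ}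
    (he : (blockVandermonde n b).coeff e ≠ 0) :
    ∑ p, e p = ∑ p, posInBlock (fun p : Fin n => blockIndex b p) p := by
  have h : (blockVandermonde n b).IsHomogeneous
      (∑ p : Fin n, ∑ q : Fin n with p < q ∧ blockIndex b p = blockIndex b q, 1) := by
    refine MvPolynomial.IsHomogeneous.prod _ _ _ fun p _ =>
      MvPolynomial.IsHomogeneous.prod _ _ _ fun q _ => ?_
    exact (MvPolynomial.isHomogeneous_X ℂ p).sub (MvPolynomial.isHomogeneous_X ℂ q)
  have h1 := h he
  rw [Finsupp.weight_apply, Finsupp.sum_fintype _ _ (by simp)] at h1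
  simp only [Pi.one_apply, smul_eq_mul, mul_one] at h1
  rw [h1]
  simp only [posInBlock, Finset.card_filter, Finset.sum_filter]
  rw [Finset.sum_comm]
  refine Finset.sum_congr rfl fun p _ => Finset.sum_congr rfl fun q _ => ?_
  simp only [and_comm]

/-! ### Homomorphisms from the irreducible modules -/

/-- The blocks of variables of the polynomial `Δ^{λ'}`. -/
def columnIndex {n : ℕ} (lam : n.Partition) (p : Fin n) : ℕ := blockIndex (conjugateParts lam) p

/-- The generator `Δ^{λ'}` of `V^λ`. -/
def generator {n : ℕ} (lam : n.Partition) : MvPolynomial (Fin n) ℂ :=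
  blockVandermonde n (conjugateParts lam)

theorem sum_conjugateParts {n : ℕ} (lam : n.Partition) : (conjugateParts lam).sum = n := by
  have key : ∀ s : Multiset ℕ, (∀ a ∈ s, a ≤ n) →
      ((List.range n).map fun j => s.countP fun a => j < a).sum = s.sum := by
    intro s
    induction s using Multiset.induction with
    | empty => simp
    | cons a s ih =>
      intro h
      have h1 := ih fun b hb => h b (by simp [hb])
      have h2 := h a (by simp)
      simp only [Multiset.countP_cons, List.sum_map_add, h1, Multiset.sum_cons]
      rw [add_comm, ← List.sum_toFinset _ List.nodup_range, List.toFinset_range,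
        ← Finset.sum_filter, ← Finset.card_eq_sum_ones]
      congr 1
      rw [show {j ∈ range n | j < a} = range a by ext; simp; omega, Finset.card_range]
  rw [conjugateParts, key _ fun a ha => lam.le_of_mem_parts ha, lam.parts_sum]

/-- Position `i` occurs once in every column longer than `i`, and the number of such columns is the
part λ_{i+1}. -/
theorem content_posInBlock_columnIndex {n : ℕ} (lam : n.Partition) :
    content (posInBlock (columnIndex lam)) = shapeContent lam := by
  ext i
  have h := content_posInBlock (sum_conjugateParts lam) i
  unfold columnIndex
  rw [h, shapeContent_apply]
  have hl : (conjugateParts lam).length = n := by simp [conjugateParts]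
  rw [hl]
  refine congrArg _ (Finset.filter_congr fun j hj => ?_)
  rw [List.getD_eq_getElem _ _ (by rw [hl]; exact Finset.mem_range.1 hj)]
  simp [conjugateParts, conjugatePart]

theorem sum_posInBlock_columnIndex {n : ℕ} (lam : n.Partition) :
    ∑ p, posInBlock (columnIndex lam) p = contentWeight (shapeContent lam) := by
  rw [← content_posInBlock_columnIndex, contentWeight_content]

theorem isBlockAntisymmetric_generator {n : ℕ} (lam : n.Partition) :
    IsBlockAntisymmetric (columnIndex lam) (generator lam) :=
  isBlockAntisymmetric_blockVandermonde n _

theorem generator_mem {n : ℕ} (lam : n.Partition) :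
    generator lam ∈ (irreducibleModule lam).toSubmodule :=
  Submodule.subset_span ⟨1, by simp [generator]⟩

/-- The generator, as an element of `V^λ`. -/
def generatorElement {n : ℕ} (lam : n.Partition) : (irreducibleModule lam).toSubmodule :=
  ⟨generator lam, generator_mem lam⟩

theorem generator_ne_zero {n : ℕ} (lam : n.Partition) : generator lam ≠ 0 :=
  blockVandermonde_ne_zero n _

/-- The module spanned by the monomials whose exponents form a word of content `m`. -/
def wordModule (n : ℕ) (m : ℕ →₀ ℕ) : Subrepresentation (permuteVariables n) where
  toSubmodule := MvPolynomial.restrictSupport ℂ {e | content e = m}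
  apply_mem_toSubmodule := by
    classical
    intro g v hv
    rw [MvPolynomial.mem_restrictSupport_iff] at hv ⊢
    rw [permuteVariables_apply, MvPolynomial.support_rename_of_injective g.injective]
    intro e he
    obtain ⟨e', he', rfl⟩ := Finset.mem_image.1 (Finset.mem_coe.1 he)
    change content _ = m
    rw [coe_mapDomain_perm, content_comp_perm]
    exact hv he'

theorem mem_wordModule {n : ℕ} {m : ℕ →₀ ℕ} {P : MvPolynomial (Fin n) ℂ} :
    P ∈ (wordModule n m).toSubmodule ↔ ∀ e, P.coeff e ≠ 0 → content e = m := by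
  change P ∈ MvPolynomial.restrictSupport ℂ _ ↔ _
  rw [MvPolynomial.mem_restrictSupport_iff]
  exact forall_congr' fun e => by rw [Finset.mem_coe, MvPolynomial.mem_support_iff]; rfl

/-- The generator is homogeneous of the minimal degree allowed by antisymmetry, so all its monomials
are rearrangements of the leading one. -/
theorem irreducibleModule_le {n : ℕ} (lam : n.Partition) :
    (irreducibleModule lam).toSubmodule ≤ (wordModule n (shapeContent lam)).toSubmodule := by
  refine Submodule.span_le.2 ?_
  rintro _ ⟨g, rfl⟩
  refine (wordModule n (shapeContent lam)).apply_mem_toSubmodule g (mem_wordModule.2 fun e he => ?_)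
  rw [← content_posInBlock_columnIndex]
  exact ((isBlockAntisymmetric_generator lam).eq_mapDomain he
    (sum_eq_of_coeff_blockVandermonde_ne_zero he).le).1

instance {n : ℕ} (lam : n.Partition) :
    FiniteDimensional ℂ (irreducibleModule lam).toSubmodule :=
  FiniteDimensional.span_of_finite ℂ (Set.finite_range _)

theorem finite_setOf_content_coe_eq (n : ℕ) (m : ℕ →₀ ℕ) :
    {e : Fin n →₀ ℕ | content e = m}.Finite :=
  Set.Finite.preimage (f := fun e : Fin n →₀ ℕ => (e : Fin n → ℕ)) DFunLike.coe_injective.injOn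
    (finite_setOf_content_eq n m)

instance (n : ℕ) (m : ℕ →₀ ℕ) : FiniteDimensional ℂ (wordModule n m).toSubmodule := by
  have := (finite_setOf_content_coe_eq n m).to_subtype
  exact Module.Finite.of_basis (MvPolynomial.basisRestrictSupport ℂ {e : Fin n →₀ ℕ | content e = m})

/-- The group permutes the basis of monomials, so the trace counts the fixed ones. -/
theorem character_wordModule {n : ℕ} (m : ℕ →₀ ℕ) (g : Equiv.Perm (Fin n)) :
    (wordModule n m).toRepresentation.character g = wordCharacter m g := by
  classical
  have := (finite_setOf_content_coe_eq n m).fintype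
  set B : Module.Basis {e : Fin n →₀ ℕ | content e = m} ℂ (wordModule n m).toSubmodule :=
    MvPolynomial.basisRestrictSupport ℂ {e : Fin n →₀ ℕ | content e = m} with hB
  have hrepr : ∀ (v : (wordModule n m).toSubmodule) e, B.repr v e = v.1.coeff e.1 := fun v e => rfl
  have hBe : ∀ e, (B e).1 = MvPolynomial.monomial e.1 1 := by
    intro e
    have : (⟨MvPolynomial.monomial e.1 1, (MvPolynomial.monomial_mem_restrictSupport ℂ).2
        (Or.inl e.2)⟩ : (wordModule n m).toSubmodule) = B e := by
      apply B.repr.injective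
      ext e'
      rw [B.repr_self]
      refine (hrepr _ e').trans ?_
      rw [MvPolynomial.coeff_monomial, Finsupp.single_apply]
      simp only [Subtype.ext_iff]
    rw [← this]
  have key : (wordModule n m).toRepresentation.character g =
      ∑ e : {e : Fin n →₀ ℕ | content e = m},
        if e.1.mapDomain g = e.1 then (1 : ℂ) else 0 := by
    refine (LinearMap.trace_eq_matrix_trace ℂ B _).trans ?_
    rw [Matrix.trace]
    refine Finset.sum_congr rfl fun e _ => ?_
    rw [Matrix.diag_apply, LinearMap.toMatrix_apply]
    refine (hrepr _ e).trans ?_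
    change (MvPolynomial.rename g (B e).1).coeff e.1 = _
    rw [hBe, MvPolynomial.rename_monomial, MvPolynomial.coeff_monomial]
  rw [key, Finset.sum_boole, wordCharacter, ← Set.ncard_coe_finset, Nat.cast_inj]
  refine Set.ncard_congr (fun e _ => ⇑e.1) ?_ ?_ ?_
  · intro e he
    refine ⟨e.2, ?_⟩
    have h1 : e.1.mapDomain g = e.1 := by simpa using he
    have h2 := congrArg (fun x : Fin n →₀ ℕ => (x : Fin n → ℕ)) h1
    simp only [coe_mapDomain_perm] at h2
    nth_rewrite 1 [← h2]
    ext x; simp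
  · intro e e' _ _ h
    exact Subtype.ext (DFunLike.coe_injective h)
  · rintro w ⟨hw, hg⟩
    refine ⟨⟨Finsupp.equivFunOnFinite.symm w, hw⟩, ?_, rfl⟩
    simp only [Finset.coe_filter, Finset.mem_univ, true_and, Set.mem_ofPred_eq]
    apply DFunLike.coe_injective
    rw [coe_mapDomain_perm]
    change w ∘ ⇑g⁻¹ = w
    nth_rewrite 1 [← hg]
    ext x; simp

/-- The image of the generator under a homomorphism. -/
def generatorImage {n : ℕ} (lam : n.Partition) (U : Subrepresentation (permuteVariables n))
    (φ : (irreducibleModule lam).toRepresentation.IntertwiningMap U.toRepresentation) :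
    MvPolynomial (Fin n) ℂ :=
  (φ (generatorElement lam) : U.toSubmodule)

theorem isBlockAntisymmetric_generatorImage {n : ℕ} (lam : n.Partition)
    (U : Subrepresentation (permuteVariables n))
    (φ : (irreducibleModule lam).toRepresentation.IntertwiningMap U.toRepresentation) :
    IsBlockAntisymmetric (columnIndex lam) (generatorImage lam U φ) := by
  intro π hπ
  have h1 := Representation.IntertwiningMap.isIntertwining _ _ φ π (generatorElement lam)
  have h2 : (irreducibleModule lam).toRepresentation π (generatorElement lam) =
      ((Equiv.Perm.sign π : ℤ) : ℂ) • generatorElement lam :=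
    Subtype.ext (isBlockAntisymmetric_generator lam π hπ)
  rw [h2, map_smul] at h1
  exact (congrArg Subtype.val h1).symm

theorem eq_zero_of_generatorImage {n : ℕ} (lam : n.Partition)
    (U : Subrepresentation (permuteVariables n))
    (φ : (irreducibleModule lam).toRepresentation.IntertwiningMap U.toRepresentation)
    (h : generatorImage lam U φ = 0) : φ = 0 := by
  have h0 : φ (generatorElement lam) = 0 := Subtype.ext h
  apply Representation.IntertwiningMap.ext
  refine LinearMap.ext fun v => ?_
  obtain ⟨v, hv⟩ := v
  change φ ⟨v, hv⟩ = 0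
  induction hv using Submodule.span_induction with
  | mem x hx =>
    obtain ⟨g, rfl⟩ := hx
    have h1 := Representation.IntertwiningMap.isIntertwining _ _ φ g (generatorElement lam)
    rw [h0, map_zero] at h1
    exact h1
  | zero => exact map_zero φ
  | add x y hx hy h1 h2 =>
    have := map_add φ ⟨x, hx⟩ ⟨y, hy⟩
    rw [h1, h2, add_zero] at this
    exact this
  | smul a x hx h1 =>
    have := map_smul φ a ⟨x, hx⟩
    rw [h1, smul_zero] at this
    exact this

/-- The image of the generator is antisymmetric in every block, and its monomials have content `m`,
whose weight is at most the minimum. A nonzero image would make `m` equal to the content of λ. -/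
theorem finrank_intertwiningMap_eq_zero {n : ℕ} (lam : n.Partition)
    (U : Subrepresentation (permuteVariables n)) {m : ℕ →₀ ℕ}
    (hU : U.toSubmodule ≤ (wordModule n m).toSubmodule)
    (hw : contentWeight m ≤ contentWeight (shapeContent lam)) (hne : m ≠ shapeContent lam) :
    Module.finrank ℂ
      ((irreducibleModule lam).toRepresentation.IntertwiningMap U.toRepresentation) = 0 := by
  have : Subsingleton
      ((irreducibleModule lam).toRepresentation.IntertwiningMap U.toRepresentation) := by
    refine ⟨fun φ ψ => ?_⟩
    have key : ∀ φ, φ = (0 : (irreducibleModule lam).toRepresentation.IntertwiningMap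
        U.toRepresentation) := by
      intro φ
      refine eq_zero_of_generatorImage lam U φ ?_
      by_contra h
      obtain ⟨e, he⟩ := MvPolynomial.ne_zero_iff.1 h
      have hm := mem_wordModule.1 (hU (φ (generatorElement lam)).2) e he
      have hle : ∑ p, e p ≤ ∑ p, posInBlock (columnIndex lam) p := by
        rw [sum_posInBlock_columnIndex, ← contentWeight_content, hm]
        exact hw
      have := ((isBlockAntisymmetric_generatorImage lam U φ).eq_mapDomain he hle).1
      rw [hm, content_posInBlock_columnIndex] at this
      exact hne this
    rw [key φ, key ψ]
  exact Module.finrank_zero_of_subsingleton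

/-- A homomorphism is determined by the leading coefficient of the image of the generator, so the
dimension is at most one; the inclusion of V^λ attains it. With `U` equal to V^λ this is all that is
needed of irreducibility, and with `U` the module of words it gives the unit diagonal of the
multiplicities. -/
theorem finrank_intertwiningMap_eq_one {n : ℕ} (lam : n.Partition)
    (U : Subrepresentation (permuteVariables n))
    (hU : U.toSubmodule ≤ (wordModule n (shapeContent lam)).toSubmodule)
    (hlam : (irreducibleModule lam).toSubmodule ≤ U.toSubmodule) :
    Module.finrank ℂ
      ((irreducibleModule lam).toRepresentation.IntertwiningMap U.toRepresentation) = 1 := by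
  set L : (irreducibleModule lam).toRepresentation.IntertwiningMap U.toRepresentation →ₗ[ℂ] ℂ :=
    { toFun := fun φ => (generatorImage lam U φ).coeff (leadingExponent (columnIndex lam))
      map_add' := fun φ ψ => MvPolynomial.coeff_add _ _ _
      map_smul' := fun a φ => MvPolynomial.coeff_smul _ _ _ } with hL
  have hinj : Function.Injective L := by
    rw [injective_iff_map_eq_zero]
    intro φ hφ
    refine eq_zero_of_generatorImage lam U φ ?_
    by_contra h
    obtain ⟨e, he⟩ := MvPolynomial.ne_zero_iff.1 h
    have hm := mem_wordModule.1 (hU (φ (generatorElement lam)).2) e he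
    have hle : ∑ p, e p ≤ ∑ p, posInBlock (columnIndex lam) p := by
      rw [sum_posInBlock_columnIndex, ← contentWeight_content, hm]
    exact ((isBlockAntisymmetric_generatorImage lam U φ).eq_mapDomain he hle).2 hφ
  have : Module.Finite ℂ
      ((irreducibleModule lam).toRepresentation.IntertwiningMap U.toRepresentation) :=
    Module.Finite.of_injective L hinj
  have hle := LinearMap.finrank_le_finrank_of_injective hinj
  rw [Module.finrank_self] at hle
  have hpos : 0 < Module.finrank ℂ
      ((irreducibleModule lam).toRepresentation.IntertwiningMap U.toRepresentation) := by
    have : Nontrivial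
        ((irreducibleModule lam).toRepresentation.IntertwiningMap U.toRepresentation) := by
      refine ⟨⟨LinearMap.intertwiningMap_of_isIntertwiningMap _ _
        (Submodule.inclusion hlam) fun g v => rfl, 0, fun h => ?_⟩⟩
      have h1 := congrArg (fun φ => generatorImage lam U φ) h
      exact generator_ne_zero lam h1
    exact (Module.finrank_pos_iff (R := ℂ)).2 this
  omega

/-! ### Scalar products of characters -/

/-- The character `ζ^λ` of `V^λ`. -/
def irreducibleCharacter {n : ℕ} (lam : n.Partition) (g : Equiv.Perm (Fin n)) : ℂ :=
  (irreducibleModule lam).toRepresentation.character g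

theorem irreducibleCharacter_eq_of_partition_eq {n : ℕ} (lam : n.Partition)
    {g h : Equiv.Perm (Fin n)} (hgh : g.partition = h.partition) :
    irreducibleCharacter lam g = irreducibleCharacter lam h := by
  obtain ⟨k, rfl⟩ := isConj_iff.1 (Equiv.Perm.partition_eq_of_isConj.2 hgh)
  exact (Representation.char_conj _ g k).symm

theorem irreducibleCharacter_inv {n : ℕ} (lam : n.Partition) (g : Equiv.Perm (Fin n)) :
    irreducibleCharacter lam g⁻¹ = irreducibleCharacter lam g := by
  refine irreducibleCharacter_eq_of_partition_eq lam (Equiv.Perm.partition_eq_of_isConj.1 ?_)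
  rw [Equiv.Perm.isConj_iff_cycleType_eq, Equiv.Perm.cycleType_inv]

/-- The general formula for the dimension of the space of homomorphisms evaluates one character at
the inverse, which is harmless here because `g` and `g⁻¹` are conjugate. -/
theorem sum_character_mul_irreducibleCharacter {n : ℕ} (lam : n.Partition)
    (U : Subrepresentation (permuteVariables n)) [FiniteDimensional ℂ U.toSubmodule] :
    ∑ g, U.toRepresentation.character g * irreducibleCharacter lam g =
      n.factorial * Module.finrank ℂ
        ((irreducibleModule lam).toRepresentation.IntertwiningMap U.toRepresentation) := by
  have hc : (Nat.card (Equiv.Perm (Fin n)) : ℂ) = n.factorial := by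
    rw [Nat.card_eq_fintype_card, Fintype.card_perm, Fintype.card_fin]
  have hne : (Nat.card (Equiv.Perm (Fin n)) : ℂ) ≠ 0 := by
    rw [hc]; exact_mod_cast n.factorial_ne_zero
  have : Invertible (Nat.card (Equiv.Perm (Fin n)) : ℂ) := invertibleOfNonzero hne
  have h := Representation.card_inv_mul_sum_char_mul_char_eq_finrank
    (irreducibleModule lam).toRepresentation U.toRepresentation
  rw [← h, ← hc, mul_inv_cancel_left₀ hne]
  refine Finset.sum_congr rfl fun g _ => ?_
  rw [← irreducibleCharacter_inv]
  rfl

theorem sum_irreducibleCharacter_mul_of_le {n : ℕ} {lam mu : n.Partition} (hne : lam ≠ mu)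
    (h : contentWeight (shapeContent mu) ≤ contentWeight (shapeContent lam)) :
    ∑ g, irreducibleCharacter mu g * irreducibleCharacter lam g = 0 := by
  refine (sum_character_mul_irreducibleCharacter lam (irreducibleModule mu)).trans ?_
  rw [finrank_intertwiningMap_eq_zero lam _ (irreducibleModule_le mu) h
    fun h' => hne (shapeContent_injective h').symm]
  simp

open Classical in
/-- The characters `ζ^λ` are orthogonal. -/
theorem sum_irreducibleCharacter_mul {n : ℕ} (lam mu : n.Partition) :
    ∑ g, irreducibleCharacter lam g * irreducibleCharacter mu g =
      if lam = mu then (n.factorial : ℂ) else 0 := by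
  split_ifs with h
  · subst h
    refine (sum_character_mul_irreducibleCharacter lam (irreducibleModule lam)).trans ?_
    rw [finrank_intertwiningMap_eq_one lam _ (irreducibleModule_le lam) le_rfl]
    simp
  -- Homomorphisms are known to vanish only towards the module of smaller or equal weight, but the
  -- sum is symmetric, so one direction is enough.
  · rcases le_total (contentWeight (shapeContent lam)) (contentWeight (shapeContent mu)) with h1 | h1
    · exact sum_irreducibleCharacter_mul_of_le (Ne.symm h) h1
    · simp only [mul_comm (irreducibleCharacter lam _)]
      exact sum_irreducibleCharacter_mul_of_le h h1

/-! ### Multiplicities in the modules of words, and Young's rule. -/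

/-- The multiplicity of `V^λ` in the module of words of content `m`. -/
def wordMultiplicity {n : ℕ} (lam : n.Partition) (m : ℕ →₀ ℕ) : ℂ :=
  (n.factorial : ℂ)⁻¹ * ∑ g : Equiv.Perm (Fin n), (wordCharacter m g : ℂ) * irreducibleCharacter lam g

theorem wordMultiplicity_eq_finrank {n : ℕ} (lam : n.Partition) (m : ℕ →₀ ℕ) :
    wordMultiplicity lam m = Module.finrank ℂ ((irreducibleModule lam).toRepresentation.IntertwiningMap
      (wordModule n m).toRepresentation) := by
  have h := sum_character_mul_irreducibleCharacter lam (wordModule n m)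
  simp only [character_wordModule] at h
  rw [wordMultiplicity, h, inv_mul_cancel_left₀ (by exact_mod_cast n.factorial_ne_zero)]

theorem wordMultiplicity_eq_zero {n : ℕ} (lam : n.Partition) {m : ℕ →₀ ℕ}
    (hw : contentWeight m ≤ contentWeight (shapeContent lam)) (hne : m ≠ shapeContent lam) :
    wordMultiplicity lam m = 0 := by
  rw [wordMultiplicity_eq_finrank, finrank_intertwiningMap_eq_zero lam _ le_rfl hw hne,
    Nat.cast_zero]

theorem wordMultiplicity_self {n : ℕ} (lam : n.Partition) :
    wordMultiplicity lam (shapeContent lam) = 1 := by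
  rw [wordMultiplicity_eq_finrank,
    finrank_intertwiningMap_eq_one lam _ le_rfl (irreducibleModule_le lam), Nat.cast_one]

theorem linearIndependent_irreducibleCharacter (n : ℕ) :
    LinearIndependent ℂ (irreducibleCharacter : n.Partition → Equiv.Perm (Fin n) → ℂ) := by
  classical
  rw [Fintype.linearIndependent_iff]
  intro c hc mu
  have h1 : ∑ g, (∑ lam, c lam • irreducibleCharacter lam) g * irreducibleCharacter mu g =
      c mu * n.factorial := by
    simp only [Finset.sum_apply, Pi.smul_apply, smul_eq_mul, Finset.sum_mul]
    rw [Finset.sum_comm]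
    simp only [mul_assoc, ← Finset.mul_sum, sum_irreducibleCharacter_mul]
    simp
  rw [hc] at h1
  simp only [Pi.zero_apply, zero_mul, Finset.sum_const_zero] at h1
  exact (mul_eq_zero.1 h1.symm).resolve_right (by exact_mod_cast n.factorial_ne_zero)

/-- Class functions are combinations of the characters `ζ^λ`. -/
theorem eq_sum_irreducibleCharacter {n : ℕ} {f : Equiv.Perm (Fin n) → ℂ}
    (hf : ∀ g h : Equiv.Perm (Fin n), g.partition = h.partition → f g = f h)
    (g : Equiv.Perm (Fin n)) :
    f g = ∑ lam, ((n.factorial : ℂ)⁻¹ * ∑ h, f h * irreducibleCharacter lam h) *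
      irreducibleCharacter lam g := by
  classical
  set C : Submodule ℂ (Equiv.Perm (Fin n) → ℂ) :=
    { carrier := {f | ∀ g h : Equiv.Perm (Fin n), g.partition = h.partition → f g = f h}
      add_mem' := fun {a b} ha hb g h hgh => by
        rw [Pi.add_apply, Pi.add_apply, ha g h hgh, hb g h hgh]
      zero_mem' := fun _ _ _ => rfl
      smul_mem' := fun x a ha g h hgh => by
        rw [Pi.smul_apply, Pi.smul_apply, ha g h hgh] } with hC
  set z : n.Partition → C := fun lam =>
    ⟨irreducibleCharacter lam, fun g h => irreducibleCharacter_eq_of_partition_eq lam⟩ with hz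
  have hli : LinearIndependent ℂ z :=
    LinearIndependent.of_comp C.subtype (linearIndependent_irreducibleCharacter n)
  -- A class function is determined by its values at one representative per cycle type, so the
  -- independent characters are numerous enough to span. The default value of `rep` is irrelevant,
  -- as only cycle types of actual permutations are compared.
  have hle : Module.finrank ℂ C ≤ Fintype.card n.Partition := by
    set rep : (Fintype.card (Fin n)).Partition → Equiv.Perm (Fin n) := fun mu =>
      if h : ∃ g : Equiv.Perm (Fin n), g.partition = mu then h.choose else 1 with hrep
    have hrep' : ∀ g : Equiv.Perm (Fin n), (rep g.partition).partition = g.partition := by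
      intro g
      have h : ∃ g' : Equiv.Perm (Fin n), g'.partition = g.partition := ⟨g, rfl⟩
      simp only [hrep, dif_pos h]
      exact h.choose_spec
    have hinj : Function.Injective
        ((LinearMap.funLeft ℂ ℂ rep).comp C.subtype) := by
      intro a b hab
      refine Subtype.ext (funext fun g => ?_)
      rw [← a.2 _ _ (hrep' g), ← b.2 _ _ (hrep' g)]
      exact congrFun hab g.partition
    have := LinearMap.finrank_le_finrank_of_injective hinj
    rw [Module.finrank_fintype_fun_eq_card] at this
    refine this.trans (le_of_eq ?_)
    rw [Fintype.card_fin]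
  have hspan := hli.span_eq_top_of_card_eq_finrank' (le_antisymm hli.fintype_card_le_finrank hle)
  have hfm : (⟨f, hf⟩ : C) ∈ Submodule.span ℂ (Set.range z) := by rw [hspan]; trivial
  obtain ⟨c, hc⟩ := (Submodule.mem_span_range_iff_exists_fun ℂ).1 hfm
  have hc' : ∀ h, f h = ∑ lam, c lam * irreducibleCharacter lam h := by
    intro h
    have := congrFun (congrArg Subtype.val hc) h
    refine this.symm.trans ?_
    simp [hz]
  have hcoef : ∀ mu, (n.factorial : ℂ)⁻¹ * ∑ h, f h * irreducibleCharacter mu h = c mu := by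
    intro mu
    have h1 : ∑ h, f h * irreducibleCharacter mu h = c mu * n.factorial := by
      simp only [hc', Finset.sum_mul]
      rw [Finset.sum_comm]
      simp only [mul_assoc, ← Finset.mul_sum, sum_irreducibleCharacter_mul]
      simp
    rw [h1, mul_comm, mul_assoc, mul_inv_cancel₀ (by exact_mod_cast n.factorial_ne_zero), mul_one]
  simp only [hcoef]
  exact hc' g

theorem wordCharacter_eq_of_partition_eq {n : ℕ} (m : ℕ →₀ ℕ) {g h : Equiv.Perm (Fin n)}
    (hgh : g.partition = h.partition) : (wordCharacter m g : ℂ) = wordCharacter m h := by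
  obtain ⟨k, rfl⟩ := isConj_iff.1 (Equiv.Perm.partition_eq_of_isConj.2 hgh)
  rw [← character_wordModule, ← character_wordModule]
  exact (Representation.char_conj _ g k).symm

theorem wordCharacter_eq_sum_wordMultiplicity {n : ℕ} (m : ℕ →₀ ℕ) (g : Equiv.Perm (Fin n)) :
    (wordCharacter m g : ℂ) = ∑ lam, wordMultiplicity lam m * irreducibleCharacter lam g :=
  eq_sum_irreducibleCharacter (fun _ _ => wordCharacter_eq_of_partition_eq m) g

theorem sum_wordMultiplicity_mul {n : ℕ} (m m' : ℕ →₀ ℕ) :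
    ∑ g : Equiv.Perm (Fin n), (wordCharacter m g : ℂ) * wordCharacter m' g =
      n.factorial * ∑ lam : n.Partition, wordMultiplicity lam m * wordMultiplicity lam m' := by
  have h : ∀ lam : n.Partition, ∑ g : Equiv.Perm (Fin n),
      (wordCharacter m g : ℂ) * irreducibleCharacter lam g =
        n.factorial * wordMultiplicity lam m := fun lam => by
    rw [wordMultiplicity, mul_inv_cancel_left₀ (by exact_mod_cast n.factorial_ne_zero)]
  have h1 : ∀ g : Equiv.Perm (Fin n), (wordCharacter m g : ℂ) * wordCharacter m' g =
      ∑ lam : n.Partition, wordMultiplicity lam m' *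
        ((wordCharacter m g : ℂ) * irreducibleCharacter lam g) := by
    intro g
    rw [wordCharacter_eq_sum_wordMultiplicity m', Finset.mul_sum]
    exact Finset.sum_congr rfl fun lam _ => mul_left_comm _ _ _
  simp only [h1]
  rw [Finset.sum_comm, Finset.mul_sum]
  refine Finset.sum_congr rfl fun lam _ => ?_
  rw [← Finset.mul_sum, h]
  ring

/-- Young's rule: the multiplicities of the irreducible modules in the modules of words are the
Kostka numbers. -/
theorem wordMultiplicity_content {n : ℕ} {t : Fin n → ℕ} (ht : Monotone t) (lam : n.Partition) :
    wordMultiplicity lam (content t) = kostka lam t := by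
  classical
  induction h : contentWeight (shapeContent lam) using Nat.strong_induction_on
    generalizing lam t with
  | _ k ih =>
    subst h
    -- `u` is the increasing word whose content is λ. The scalar product of the word characters of
    -- `u` and `t`, computed with multiplicities and with Kostka numbers, isolates the entry at λ.
    set u : Fin n → ℕ := posInBlock (columnIndex lam) ∘ Tuple.sort (posInBlock (columnIndex lam))
      with hu
    have hum : Monotone u := Tuple.monotone_sort _
    have huc : content u = shapeContent lam := by
      rw [hu, content_comp_perm, content_posInBlock_columnIndex]
    have h1 : ∑ mu : n.Partition, wordMultiplicity mu (content u) * wordMultiplicity mu (content t) =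
        ∑ mu : n.Partition, (kostka mu u : ℂ) * kostka mu t := by
      have h2 := sum_wordMultiplicity_mul (n := n) (content u) (content t)
      have h3 := congrArg (Nat.cast (R := ℂ)) (sum_wordCharacter_mul_wordCharacter hum ht)
      push_cast at h3
      rw [h3, mul_comm] at h2
      exact (mul_left_cancel₀ (by exact_mod_cast n.factorial_ne_zero) h2).symm
    rw [← Finset.sum_erase_add _ _ (Finset.mem_univ lam),
      ← Finset.sum_erase_add (a := lam) _ _ (Finset.mem_univ lam)] at h1
    have h4 : ∑ mu ∈ univ.erase lam, wordMultiplicity mu (content u) *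
        wordMultiplicity mu (content t) =
        ∑ mu ∈ univ.erase lam, (kostka mu u : ℂ) * kostka mu t := by
      refine Finset.sum_congr rfl fun mu hmu => ?_
      have hne : content u ≠ shapeContent mu := by
        rw [huc]
        exact fun h => (Finset.mem_erase.1 hmu).1 (shapeContent_injective h).symm
      -- Shapes of smaller weight are covered by induction, for `u` as well as for `t`; for the
      -- other shapes both entries at `u` vanish by triangularity.
      rcases Nat.lt_or_ge (contentWeight (shapeContent mu)) (contentWeight (shapeContent lam))
        with h5 | h5
      · rw [ih _ h5 hum mu rfl, ih _ h5 ht mu rfl]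
      · rw [← huc] at h5
        rw [wordMultiplicity_eq_zero mu h5 hne, kostka_eq_zero hum h5 hne]
        simp
    rw [h4, add_right_inj, kostka_self hum huc, huc, wordMultiplicity_self] at h1
    simpa using h1

theorem wordCharacter_eq_sum_kostka {n : ℕ} {t : Fin n → ℕ} (ht : Monotone t)
    (g : Equiv.Perm (Fin n)) :
    (wordCharacter (content t) g : ℂ) = ∑ lam, (kostka lam t : ℂ) * irreducibleCharacter lam g := by
  rw [wordCharacter_eq_sum_wordMultiplicity]
  simp only [wordMultiplicity_content ht]

/-! ### The coproduct of the fundamental basis -/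

theorem coproduct_eq {f : QSym} {x : QSym ⊗[ℝ] QSym}
    (h : ∀ (a b : ℕ →₀ ℕ) (M : ℕ), (∀ i ∈ a.support, i < M) → tensorCoeff a b x =
      MvPowerSeries.coeff (a + b.mapDomain (· + M)) (f : MvPowerSeries ℕ ℝ)) :
    coproduct f = x := by
  rw [← sub_eq_zero]
  refine eq_zero_of_tensorCoeff fun a b => ?_
  have hM : ∀ i ∈ a.support, i < a.support.sup id + 1 := fun i hi =>
    Nat.lt_succ_of_le (Finset.le_sup (f := id) hi)
  rw [map_sub, isCoproduct_coproduct f a b _ hM, h a b _ hM, sub_self]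

/-- An increasing word in X + Y splits into its letters in X and then its letters in Y. At the
junction the increase is automatically strict, so only the descents inside the two segments impose a
condition. -/
theorem coproduct_fundamental {n : ℕ} (c : Composition n) :
    coproduct (fundamental c) = ∑ ij ∈ antidiagonal n,
      fundamental (segment c 0 ij.1) ⊗ₜ[ℝ] fundamental (segment c ij.1 ij.2) := by
  classical
  refine coproduct_eq fun a b M hM => ?_
  obtain ⟨s, hs, hsa⟩ := exists_content_eq a
  obtain ⟨t, ht, htb⟩ := exists_content_eq b
  generalize a.degree = i at s hs hsa
  generalize b.degree = j at t ht htb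
  subst hsa htb
  have hM' : ∀ p, s p < M := by
    intro p
    refine hM _ ?_
    rw [Finsupp.mem_support_iff, content, Finsupp.finsetSum_apply]
    exact (Finset.sum_pos' (fun _ _ => Nat.zero_le _) ⟨p, Finset.mem_univ _, by simp⟩).ne'
  have hmono : Monotone (Fin.append s fun p => t p + M) := by
    intro p q hpq
    induction p using Fin.addCases with
    | left p =>
      induction q using Fin.addCases with
      | left q => simpa only [Fin.append_left] using hs (Fin.le_def.2 (Fin.le_def.1 hpq))
      | right q => simp only [Fin.append_left, Fin.append_right]; have := hM' p; omega
    | right p =>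
      induction q using Fin.addCases with
      | left q => simp [Fin.le_def] at hpq; omega
      | right q =>
        simp only [Fin.append_right]
        have h1 := Fin.le_def.1 hpq
        simp only [Fin.val_natAdd] at h1
        have h2 := ht (Fin.le_def.2 (by omega : (p : ℕ) ≤ q))
        omega
  rw [content_append, map_sum]
  simp only [fundamental, tensorCoeff_tmul]
  by_cases hn : i + j = n
  · subst hn
    rw [Finset.sum_eq_single (i, j)]
    · rw [coeff_fundamentalSeries _ hs, coeff_fundamentalSeries _ ht,
        coeff_fundamentalSeries _ hmono, if_congr (strictAt_append c hM') rfl rfl, ite_and, ite_mul, one_mul,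
        zero_mul]
    · rintro ⟨k, l⟩ hkl hne
      rw [Finset.HasAntidiagonal.mem_antidiagonal] at hkl
      simp only at hkl
      have : i ≠ k := by
        rintro rfl
        exact hne (by simp; omega)
      rw [coeff_fundamentalSeries_of_ne _ (by rwa [degree_content]), zero_mul]
    · intro h
      exact absurd (by simp) h
  · rw [coeff_fundamentalSeries_of_ne c (by rwa [degree_content])]
    refine Finset.sum_eq_zero ?_
    rintro ⟨k, l⟩ hkl
    rw [Finset.HasAntidiagonal.mem_antidiagonal] at hkl
    simp only at hkl
    by_cases h1 : i = k
    · have h2 : j ≠ l := by omega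
      rw [coeff_fundamentalSeries_of_ne (segment c k l) (by rwa [degree_content]), mul_zero]
    · rw [coeff_fundamentalSeries_of_ne _ (by rwa [degree_content]), zero_mul]

theorem conjugation_fundamental {n : ℕ} (c : Composition n) :
    conjugation (fundamental c) = fundamental (conjugate c) := by
  have h := fundamentalBasis_apply ⟨n, c⟩
  rw [← h, conjugation, Module.Basis.constr_basis]

theorem exponentialSpecialization_fundamental (γ : ℝ) {n : ℕ} (c : Composition n) :
    exponentialSpecialization γ (fundamental c) = γ ^ n / (n.factorial : ℝ) := by
  have h := fundamentalBasis_apply ⟨n, c⟩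
  rw [← h, exponentialSpecialization, Module.Basis.constr_basis]

theorem descentSet_injective (n : ℕ) : Function.Injective (descentSet (n := n)) := by
  intro c d h
  apply (descentEquiv n).injective
  refine Finset.image_injective (fun k l hkl => ?_) h
  exact Fin.ext (Nat.succ_injective hkl)

theorem segment_segment {n : ℕ} (c : Composition n) {a i j : ℕ} (h : i + j ≤ a) :
    segment (segment c 0 a) i j = segment c i j := by
  apply descentSet_injective
  ext d
  simp only [descentSet_segment]
  constructor
  · rintro ⟨h1, h2, -, -, h3⟩
    exact ⟨h1, h2, h3⟩
  · rintro ⟨h1, h2, h3⟩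
    exact ⟨h1, h2, by omega, by omega, h3⟩

/-- Stated for arbitrary expansions of the coproducts because it serves twice: for the fundamental
basis and for products of power sums. -/
theorem specialization_eq {f : QSym} {ι κ : Type*} (s : Finset ι) (u v : ι → QSym)
    (S : ι → Finset κ) (x y : ι → κ → QSym)
    (hf : coproduct f = ∑ i ∈ s, u i ⊗ₜ[ℝ] v i)
    (hu : ∀ i ∈ s, coproduct (u i) = ∑ k ∈ S i, x i k ⊗ₜ[ℝ] y i k) (ω : ThomaSimplex) :
    ω.specialization f = ∑ i ∈ s, ∑ k ∈ S i,
      ω.evalα (x i k) * ω.evalβ (conjugation (y i k)) * exponentialSpecialization ω.γ (v i) := by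
  simp only [ThomaSimplex.specialization, LinearMap.comp_apply, hf, map_sum]
  refine Finset.sum_congr rfl fun i hi => ?_
  rw [TensorProduct.map_tmul, hu i hi]
  simp only [TensorProduct.sum_tmul, map_sum, TensorProduct.map_tmul, LinearMap.comp_apply,
    LinearMap.mul'_apply, LinearMap.id_apply]

theorem specialization_fundamental (ω : ThomaSimplex) {n : ℕ} (c : Composition n) :
    ω.specialization (fundamental c) =
      ∑ t ∈ Finset.Nat.antidiagonalTuple 3 n, ω.γ ^ t 2 / ((t 2).factorial : ℝ) *
        ω.evalα (fundamental (segment c 0 (t 0))) *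
        ω.evalβ (fundamental (conjugate (segment c (t 0) (t 1)))) := by
  rw [specialization_eq _ _ _ _ _ _ (coproduct_fundamental c)
    (fun ij _ => coproduct_fundamental (segment c 0 ij.1)), Finset.sum_sigma']
  -- Two successive cuts give pairs (a, k) and (i, j) with i + j = a; forgetting a leaves the triple
  -- (i, j, k).
  refine Finset.sum_bij' (fun x _ => ![x.2.1, x.2.2, x.1.2])
    (fun t _ => ⟨(t 0 + t 1, t 2), (t 0, t 1)⟩) ?_ ?_ ?_ ?_ ?_
  · rintro ⟨⟨a, k⟩, ⟨i, j⟩⟩ h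
    simp only [Finset.mem_sigma, Finset.HasAntidiagonal.mem_antidiagonal] at h
    rw [Finset.Nat.mem_antidiagonalTuple]
    simp [Fin.sum_univ_three, h.1, h.2]
  · intro t h
    rw [Finset.Nat.mem_antidiagonalTuple, Fin.sum_univ_three] at h
    simp [h]
  · rintro ⟨⟨a, k⟩, ⟨i, j⟩⟩ h
    simp only [Finset.mem_sigma, Finset.HasAntidiagonal.mem_antidiagonal] at h
    simp [h.2]
  · intro t h
    ext i
    fin_cases i <;> rfl
  · rintro ⟨⟨a, k⟩, ⟨i, j⟩⟩ h
    simp only [Finset.mem_sigma, Finset.HasAntidiagonal.mem_antidiagonal] at h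
    simp only [Matrix.cons_val]
    rw [segment_segment c (by omega), segment_segment c (by omega), conjugation_fundamental,
      exponentialSpecialization_fundamental]
    ring

/-! ### The commutative image of `G_σ` -/

theorem mem_descentSet_recoilComposition {n : ℕ} {σ : Equiv.Perm (Fin n)} {d : ℕ} :
    d ∈ descentSet (recoilComposition σ) ↔
      ∃ p q : Fin n, (p : ℕ) + 1 = d ∧ (q : ℕ) = d ∧ σ⁻¹ q < σ⁻¹ p := by
  rw [recoilComposition, permComposition, mem_descentSet_ofDescentSet, permDescents,
    Finset.mem_filter, Finset.mem_range]
  constructor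
  · rintro ⟨-, -, -, h⟩
    exact h
  · rintro ⟨p, q, hp, hq, h⟩
    exact ⟨by omega, by omega, by omega, p, q, hp, hq, h⟩

theorem strictAt_recoilComposition {n : ℕ} {σ : Equiv.Perm (Fin n)} {t : Fin n → ℕ}
    (ht : Monotone t) :
    StrictAt (descentSet (recoilComposition σ)) t ↔ IncreasingOnRuns t σ⁻¹ := by
  constructor
  · intro h p q hpq htpq
    have hne : σ⁻¹ p ≠ σ⁻¹ q := fun h => by
      have := (Equiv.injective _ h); subst this; omega
    by_contra hlt
    have := h p q hpq (mem_descentSet_recoilComposition.2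
      ⟨p, q, hpq, rfl, lt_of_le_of_ne (not_lt.1 hlt) hne.symm⟩)
    omega
  · intro h p q hpq hq
    obtain ⟨p', q', hp', hq', hlt⟩ := mem_descentSet_recoilComposition.1 hq
    obtain rfl : p' = p := Fin.ext (by omega)
    obtain rfl : q' = q := Fin.ext hq'
    refine lt_of_le_of_ne (ht (Fin.le_def.2 (by omega))) fun heq => ?_
    exact lt_asymm hlt (h p' q' hpq heq)

/-- Equal letters are ranked from left to right, so `σ⁻¹` must list the positions of each letter in
increasing order. -/
theorem isStandardization_comp {n : ℕ} {σ : Equiv.Perm (Fin n)} {t : Fin n → ℕ}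
    (ht : Monotone t) : IsStandardization (List.ofFn (t ∘ σ)) σ ↔ IncreasingOnRuns t σ⁻¹ := by
  rw [isStandardization_ofFn]
  constructor
  · intro h p q hpq htpq
    have := h (σ⁻¹ p) (σ⁻¹ q)
    simp only [Function.comp, ← Equiv.Perm.mul_apply, mul_inv_cancel, Equiv.Perm.one_apply] at this
    rcases this.1 (Fin.lt_def.2 (by omega)) with h1 | h1
    · omega
    · exact h1.2
  · intro h p q
    have key : ∀ p q : Fin n, σ p < σ q → (t (σ p) < t (σ q) ∨ (t (σ p) = t (σ q) ∧ p < q)) := by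
      intro p q hlt
      rcases (ht hlt.le).lt_or_eq with h1 | h1
      · exact Or.inl h1
      · right
        refine ⟨h1, ?_⟩
        have := h.lt ht hlt h1
        simpa using this
    refine ⟨key p q, fun hpq => ?_⟩
    by_contra hlt
    rcases (not_lt.1 hlt).lt_or_eq with h1 | h1
    · have := key q p h1
      simp only [Function.comp] at hpq
      omega
    · have := σ.injective h1
      subst this
      simp only [Function.comp] at hpq
      omega

/-- A word that standardizes to `σ` is `t ∘ σ` for its increasing rearrangement `t`, and the
condition on `t` is to increase strictly at the recoils of `σ`. -/
theorem commutativeImage_freeG {n : ℕ} (σ : Equiv.Perm (Fin n)) :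
    commutativeImage (freeG σ) = fundamentalSeries (recoilComposition σ) := by
  classical
  refine QSym_ext (commutativeImage_freeG_mem σ).2 (fundamentalSeries_mem _).2 fun k T => ?_
  have ht := stepSeq_mono T
  by_cases hk : k = n
  · subst hk
    rw [coeff_commutativeImage_freeG σ ht, coeff_fundamentalSeries _ ht]
    exact if_congr ((isStandardization_comp ht).trans (strictAt_recoilComposition ht).symm) rfl rfl
  · rw [coeff_fundamentalSeries_of_ne _ (by rwa [degree_content])]
    refine Finset.sum_eq_zero fun w hw => if_neg ?_
    rintro ⟨hlen, -⟩
    rw [Multiset.mem_toFinset, Multiset.mem_lists_iff] at hw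
    have := congrArg Multiset.card hw
    rw [Finsupp.card_toMultiset] at this
    exact hk ((degree_content _).symm.trans (this.trans hlen))

theorem shuffleWeight_eq (ω : ThomaSimplex) {n : ℕ} (σ : Equiv.Perm (Fin n)) :
    shuffleWeight ω σ = ω.specialization (fundamental (recoilComposition σ)) := by
  rw [shuffleWeight]
  congr 1
  exact Subtype.ext (commutativeImage_freeG σ)

theorem evaluation_fundamental_nonneg {α : ℕ → ℝ} (h0 : ∀ i, 0 ≤ α i) (hs : Summable α) {n : ℕ}
    (c : Composition n) : 0 ≤ evaluation α h0 hs (fundamental c) := by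
  refine tsum_nonneg fun m => mul_nonneg ?_ ?_
  · exact Nat.cast_nonneg' _
  · exact Finset.prod_nonneg fun i _ => pow_nonneg (h0 i) _

theorem ThomaSimplex.γ_nonneg (ω : ThomaSimplex) : 0 ≤ ω.γ := by
  have := ω.sum_le_one
  rw [ThomaSimplex.γ]
  linarith

theorem shuffleWeight_nonneg (ω : ThomaSimplex) {n : ℕ} (σ : Equiv.Perm (Fin n)) :
    0 ≤ shuffleWeight ω σ := by
  rw [shuffleWeight_eq, specialization_fundamental]
  refine Finset.sum_nonneg fun t _ => mul_nonneg (mul_nonneg (div_nonneg ?_ ?_) ?_) ?_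
  · exact pow_nonneg ω.γ_nonneg _
  · exact Nat.cast_nonneg' _
  · exact evaluation_fundamental_nonneg _ _ _
  · exact evaluation_fundamental_nonneg _ _ _

/-! ### The dimensions of the irreducible modules -/

theorem irreducibleCharacter_one {n : ℕ} (lam : n.Partition) :
    irreducibleCharacter lam 1 = (Module.finrank ℂ (irreducibleModule lam).toSubmodule : ℂ) :=
  Representation.char_one _

/-- Words without repetition are permutations, so this is the regular character; Young's rule
applied to it will identify the numbers of standard tableaux with dimensions. -/
theorem wordCharacter_content_val {n : ℕ} (g : Equiv.Perm (Fin n)) :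
    wordCharacter (content fun p : Fin n => (p : ℕ)) g = if g = 1 then n.factorial else 0 := by
  classical
  have hinj : ∀ w : Fin n → ℕ, content w = (content fun p : Fin n => (p : ℕ)) →
      ∃ τ : Equiv.Perm (Fin n), w = fun p => (τ p : ℕ) := by
    intro w hw
    have h1 : content (w ∘ Tuple.sort w) = content fun p : Fin n => (p : ℕ) := by
      rw [content_comp_perm, hw]
    have h2 := content_injOn (Tuple.monotone_sort w) (fun p q h => h) h1
    refine ⟨(Tuple.sort w)⁻¹, funext fun p => ?_⟩
    have := congrFun h2 ((Tuple.sort w)⁻¹ p)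
    simpa using this
  have hset : {w : Fin n → ℕ | content w = (content fun p : Fin n => (p : ℕ)) ∧ w ∘ g = w} =
      (fun (τ : Equiv.Perm (Fin n)) (p : Fin n) => (τ p : ℕ)) '' {τ | g = 1} := by
    ext w
    constructor
    · rintro ⟨h1, h2⟩
      obtain ⟨τ, rfl⟩ := hinj w h1
      refine ⟨τ, Equiv.ext fun p => τ.injective (Fin.ext (congrFun h2 p)), rfl⟩
    · rintro ⟨τ, hg, rfl⟩
      rw [Set.mem_ofPred_eq] at hg
      subst hg
      exact ⟨content_comp_perm (fun p : Fin n => (p : ℕ)) τ, rfl⟩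
  rw [wordCharacter, hset, Set.ncard_image_of_injective]
  · split_ifs with h
    · simp [h, Set.ncard_univ, Nat.card_eq_fintype_card, Fintype.card_perm]
    · simp [h]
  · intro τ τ' h
    exact Equiv.ext fun p => Fin.ext (congrFun h p)

/-- The number of standard tableaux of shape `λ` is the dimension of `V^λ`. -/
theorem kostka_val {n : ℕ} (lam : n.Partition) :
    kostka lam (fun p : Fin n => (p : ℕ)) =
      Module.finrank ℂ (irreducibleModule lam).toSubmodule := by
  classical
  have h := wordMultiplicity_content (t := fun p : Fin n => (p : ℕ)) (fun p q h => h) lam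
  have hne : (n.factorial : ℂ) ≠ 0 := by exact_mod_cast n.factorial_ne_zero
  rw [wordMultiplicity] at h
  simp only [wordCharacter_content_val, Nat.cast_ite, Nat.cast_zero, ite_mul, zero_mul,
    Finset.sum_ite_eq', Finset.mem_univ, if_true] at h
  rw [inv_mul_cancel_left₀ hne, irreducibleCharacter_one] at h
  exact_mod_cast h.symm

theorem finrank_irreducibleModule_pos {n : ℕ} (lam : n.Partition) :
    0 < Module.finrank ℂ (irreducibleModule lam).toSubmodule := by
  rw [Module.finrank_pos_iff]
  exact ⟨⟨generatorElement lam, 0, fun h => generator_ne_zero lam (congrArg Subtype.val h)⟩⟩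

/-! ### Sums of the G_σ over a shape, and normalized characters. -/

/-- A strictly increasing second word imposes nothing on the descents, and its Kostka number is the
dimension. -/
theorem card_increasingOnRuns {n : ℕ} (lam : n.Partition) (t : Fin n → ℕ) :
    {σ : Equiv.Perm (Fin n) | rskShape σ = lam ∧ IncreasingOnRuns t σ⁻¹}.ncard =
      kostka lam t * Module.finrank ℂ (irreducibleModule lam).toSubmodule := by
  rw [← kostka_val, ← card_robinsonSchensted]
  congr 1
  ext σ
  simp only [Set.mem_ofPred_eq, and_congr_right_iff]
  refine fun _ => ⟨fun h => ⟨h, fun p q hpq he => ?_⟩, fun h => h.1⟩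
  exact absurd he (by simp only; omega)

/-- The sum of the commutative images of the `G_σ` over the permutations of shape `λ`. -/
def shapeSum {n : ℕ} (lam : n.Partition) : QSym :=
  ∑ σ : Equiv.Perm (Fin n) with rskShape σ = lam, fundamental (recoilComposition σ)

theorem coeff_shapeSum {n : ℕ} (lam : n.Partition) {t : Fin n → ℕ} (ht : Monotone t) :
    MvPowerSeries.coeff (content t) (shapeSum lam : MvPowerSeries ℕ ℝ) =
      kostka lam t * Module.finrank ℂ (irreducibleModule lam).toSubmodule := by
  classical
  have h := card_increasingOnRuns lam t
  rw [← Nat.cast_mul, ← h, shapeSum]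
  simp only [AddSubmonoidClass.coe_finsetSum, map_sum, fundamental, coeff_fundamentalSeries _ ht,
    strictAt_recoilComposition ht]
  rw [Finset.sum_boole, Finset.filter_filter, ← Set.ncard_coe_finset]
  simp

theorem coeff_shapeSum_of_ne {n : ℕ} (lam : n.Partition) {m : ℕ →₀ ℕ} (hm : m.degree ≠ n) :
    MvPowerSeries.coeff m (shapeSum lam : MvPowerSeries ℕ ℝ) = 0 := by
  simp only [shapeSum, AddSubmonoidClass.coe_finsetSum, map_sum, fundamental]
  exact Finset.sum_eq_zero fun σ _ => coeff_fundamentalSeries_of_ne _ hm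

theorem specialization_shapeSum (ω : ThomaSimplex) {n : ℕ} (lam : n.Partition) :
    ω.specialization (shapeSum lam) =
      ∑ σ : Equiv.Perm (Fin n) with rskShape σ = lam, shuffleWeight ω σ := by
  simp only [shapeSum, map_sum, shuffleWeight_eq]

theorem normalizedCharacter_eq {n : ℕ} (lam : n.Partition) (g : Equiv.Perm (Fin n)) :
    normalizedCharacter lam g = irreducibleCharacter lam g /
      Module.finrank ℂ (irreducibleModule lam).toSubmodule := rfl

theorem wordCharacter_eq_sum_coeff_shapeSum {n : ℕ} {t : Fin n → ℕ} (ht : Monotone t)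
    (g : Equiv.Perm (Fin n)) :
    (wordCharacter (content t) g : ℂ) = ∑ lam : n.Partition, normalizedCharacter lam g *
      (MvPowerSeries.coeff (content t) (shapeSum lam : MvPowerSeries ℕ ℝ) : ℝ) := by
  rw [wordCharacter_eq_sum_kostka ht]
  refine Finset.sum_congr rfl fun lam _ => ?_
  have h := finrank_irreducibleModule_pos lam
  have hne : (Module.finrank ℂ (irreducibleModule lam).toSubmodule : ℂ) ≠ 0 := by
    exact_mod_cast h.ne'
  rw [coeff_shapeSum lam ht, normalizedCharacter_eq]
  push_cast
  field_simp

theorem linearIndependent_normalizedCharacter (n : ℕ) :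
    LinearIndependent ℂ (normalizedCharacter : n.Partition → Equiv.Perm (Fin n) → ℂ) := by
  have h := (linearIndependent_irreducibleCharacter n).units_smul fun lam =>
    (Units.mk0 (Module.finrank ℂ (irreducibleModule lam).toSubmodule : ℂ)
      (by exact_mod_cast (finrank_irreducibleModule_pos lam).ne'))⁻¹
  convert h using 1
  ext lam g
  simp [normalizedCharacter_eq, Units.smul_def, div_eq_inv_mul]

/-- The series whose coefficients are the numbers of words fixed by `g` is
`∑_λ χ^λ(g) ∑_{Λ(σ) = λ} G_σ`, up to commutation of the letters. -/
theorem specialization_eq_sum_normalizedCharacter (ω : ThomaSimplex) {n : ℕ}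
    (g : Equiv.Perm (Fin n)) (f : QSym)
    (hf : ∀ m, MvPowerSeries.coeff m (f : MvPowerSeries ℕ ℝ) = wordCharacter m g) :
    (ω.specialization f : ℂ) = ∑ lam : n.Partition,
      ((∑ σ : Equiv.Perm (Fin n) with rskShape σ = lam, shuffleWeight ω σ : ℝ) : ℂ) *
        normalizedCharacter lam g := by
  have hcoeff : ∀ m, ((MvPowerSeries.coeff m (f : MvPowerSeries ℕ ℝ) : ℝ) : ℂ) =
      ∑ lam : n.Partition, normalizedCharacter lam g *
        (MvPowerSeries.coeff m (shapeSum lam : MvPowerSeries ℕ ℝ) : ℝ) := by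
    intro m
    rw [hf]
    by_cases hm : m.degree = n
    · subst hm
      obtain ⟨t, ht, htm⟩ := exists_content_eq m
      have := wordCharacter_eq_sum_coeff_shapeSum ht g
      rw [htm] at this
      simpa using this
    · have : {w : Fin n → ℕ | content w = m ∧ w ∘ g = w} = ∅ := by
        ext w
        simp only [Set.mem_ofPred_eq, Set.mem_empty_iff_false, iff_false]
        rintro ⟨rfl, -⟩
        exact hm (degree_content w)
      simp [wordCharacter, this, coeff_shapeSum_of_ne _ hm]
  -- Characters are complex valued and `QSym` is real, so the real and imaginary parts of the
  -- identity are specialized separately.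
  have hre : f = ∑ lam : n.Partition, (normalizedCharacter lam g).re • shapeSum lam := by
    apply Subtype.ext
    ext m
    have := congrArg Complex.re (hcoeff m)
    simpa using this
  have him : 0 = ∑ lam : n.Partition, (normalizedCharacter lam g).im • shapeSum lam := by
    apply Subtype.ext
    ext m
    have := congrArg Complex.im (hcoeff m)
    simpa using this
  have hre' := congrArg ω.specialization hre
  have him' := congrArg ω.specialization him
  simp only [map_sum, map_smul, smul_eq_mul, specialization_shapeSum, map_zero] at hre' him'
  apply Complex.ext
  · rw [hre']
    simp [mul_comm]
  · simpa [mul_comm] using him'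

/-! ### Series indexed by words -/

/-- Words are grouped by content. An infinite fibre contributes zero on both sides, so finiteness of
the fibres is not required. -/
theorem tsum_eq_tsum_card_mul {W M : Type*} {S : W → M} {v : M → ℝ}
    (hs : Summable fun w => v (S w)) :
    ∑' w, v (S w) = ∑' m, (Nat.card {w // S w = m} : ℝ) * v m := by
  have hs' : Summable fun x : Σ m, {w // S w = m} => v (S x.2.1) :=
    (Equiv.sigmaFiberEquiv S).summable_iff.2 hs
  have h1 := (Equiv.sigmaFiberEquiv S).tsum_eq fun w => v (S w)
  rw [← h1]
  change ∑' x : Σ m, {w // S w = m}, v (S x.2.1) = _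
  rw [hs'.tsum_sigma]
  refine tsum_congr fun m => ?_
  rw [tsum_congr fun w : {w // S w = m} => congrArg v w.2, tsum_const, nsmul_eq_mul]

theorem summable_and_tsum_prod {κ : Type*} [Fintype κ] {f : κ → ℕ → ℝ} (h0 : ∀ i x, 0 ≤ f i x)
    (hs : ∀ i, Summable (f i)) :
    Summable (fun w : κ → ℕ => ∏ i, f i (w i)) ∧
      ∑' w : κ → ℕ, ∏ i, f i (w i) = ∏ i, ∑' x, f i x := by
  have key : ∀ (n : ℕ) (f : Fin n → ℕ → ℝ), (∀ i x, 0 ≤ f i x) → (∀ i, Summable (f i)) →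
      Summable (fun w : Fin n → ℕ => ∏ i, f i (w i)) ∧
      ∑' w : Fin n → ℕ, ∏ i, f i (w i) = ∏ i, ∑' x, f i x := by
    intro n
    induction n with
    | zero =>
      intro f h0 hs
      exact ⟨(hasSum_fintype _).summable, by simp⟩
    | succ n ih =>
      intro f h0 hs
      obtain ⟨h1, h2⟩ := ih (fun i => f i.succ) (fun i => h0 _) (fun i => hs _)
      have h3 := (hs 0).mul_of_nonneg h1 (h0 0) fun t => Finset.prod_nonneg fun p _ => h0 _ _
      have h4 : ∀ x : ℕ × (Fin n → ℕ), ∏ i, f i (Fin.consEquiv (fun _ => ℕ) x i) =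
          f 0 x.1 * ∏ i : Fin n, f i.succ (x.2 i) := by
        intro x
        simp [Fin.consEquiv, Fin.prod_univ_succ]
      constructor
      · rw [← (Fin.consEquiv fun _ : Fin (n + 1) => ℕ).summable_iff]
        exact h3.congr fun x => (h4 x).symm
      · rw [← (Fin.consEquiv fun _ : Fin (n + 1) => ℕ).tsum_eq]
        simp only [h4]
        rw [Fin.prod_univ_succ, ← h2, (hs 0).tsum_mul_tsum h1 h3]
  set e := Fintype.equivFin κ
  obtain ⟨h1, h2⟩ := key _ (fun i => f (e.symm i)) (fun i => h0 _) (fun i => hs _)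
  have h4 : ∀ w : κ → ℕ, ∏ i, f (e.symm i) (Equiv.arrowCongr e (Equiv.refl ℕ) w i) =
      ∏ i, f i (w i) := by
    intro w
    rw [← e.symm.prod_comp]
    simp
  constructor
  · rw [← (Equiv.arrowCongr e (Equiv.refl ℕ)).summable_iff] at h1
    exact h1.congr h4
  · rw [← (Equiv.arrowCongr e (Equiv.refl ℕ)).tsum_eq] at h2
    rw [tsum_congr h4, e.symm.prod_comp (fun i => ∑' x, f i x)] at h2
    exact h2

theorem summable_pow_of_nonneg {α : ℕ → ℝ} (h0 : ∀ i, 0 ≤ α i) (hs : Summable α) {l : ℕ}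
    (hl : 0 < l) : Summable fun i => α i ^ l := by
  have h1 : ∀ᶠ i in Filter.cofinite, α i ≤ 1 :=
    hs.tendsto_cofinite_zero.eventually (ge_mem_nhds one_pos)
  refine Summable.of_norm_bounded_eventually hs ?_
  filter_upwards [h1] with i hi
  rw [Real.norm_eq_abs, abs_of_nonneg (pow_nonneg (h0 i) _)]
  exact pow_le_of_le_one (h0 i) hi hl.ne'

open Classical in
theorem evaluation_fundamental {α : ℕ → ℝ} (h0 : ∀ i, 0 ≤ α i) (hs : Summable α) {n : ℕ}
    (c : Composition n) : evaluation α h0 hs (fundamental c) =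
      ∑' t : Fin n → ℕ, if Monotone t ∧ StrictAt (descentSet c) t then ∏ p, α (t p) else 0 := by
  have h1 : Summable fun t : {t : Fin n → ℕ // Monotone t ∧ StrictAt (descentSet c) t} =>
      monomialValue α (content t.1) := by
    simp only [monomialValue_content]
    exact (summable_pi_prod h0 hs n).comp_injective Subtype.val_injective
  have h2 := tsum_eq_tsum_card_mul h1
  have h3 : ∑' t : {t : Fin n → ℕ // Monotone t ∧ StrictAt (descentSet c) t},
      monomialValue α (content t.1) = ∑' t : Fin n → ℕ,
        if Monotone t ∧ StrictAt (descentSet c) t then ∏ p, α (t p) else 0 := by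
    simp only [monomialValue_content]
    refine (tsum_subtype {t : Fin n → ℕ | Monotone t ∧ StrictAt (descentSet c) t}
      fun t => ∏ p, α (t p)).trans (tsum_congr fun t => ?_)
    rw [Set.indicator_apply]
    rfl
  rw [← h3, h2]
  refine tsum_congr fun m => ?_
  congr 1
  change ((Set.ncard _ : ℕ) : ℝ) = _
  rw [← Nat.card_coe_set_eq]
  congr 1
  refine Nat.card_congr
    { toFun := fun t => ⟨⟨t.1, t.2.1, t.2.2.1⟩, t.2.2.2⟩
      invFun := fun t => ⟨t.1.1, t.1.2.1, t.1.2.2, t.2⟩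
      left_inv := fun _ => rfl
      right_inv := fun _ => rfl }

/-! ### The antipode -/

/-- The word `k` has to rise after its `d`-th letter if `d ∈ S`, and must not fall otherwise. -/
def RisesAt {n : ℕ} (S : Finset ℕ) (k : Fin n → ℕ) (d : ℕ) : Prop :=
  ∀ p q : Fin n, (p : ℕ) + 1 = q → (q : ℕ) = d → if d ∈ S then k p < k q else k p ≤ k q

theorem monotone_and_strictAt_iff {n : ℕ} (S : Finset ℕ) (k : Fin n → ℕ) :
    (Monotone k ∧ StrictAt S k) ↔ ∀ d, 0 < d → d < n → RisesAt S k d := by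
  constructor
  · rintro ⟨h1, h2⟩ d - - p q hpq rfl
    split_ifs with h
    · exact h2 p q hpq h
    · exact h1 (Fin.le_def.2 (by omega))
  · intro h
    have h3 : ∀ p q : Fin n, (p : ℕ) + 1 = q → k p ≤ k q := by
      intro p q hpq
      have := h q (by omega) q.2 p q hpq rfl
      split_ifs at this
      · exact this.le
      · exact this
    refine ⟨?_, fun p q hpq hq => ?_⟩
    · cases n with
      | zero => exact fun p => p.elim0
      | succ n => exact Fin.monotone_iff_le_succ.2 fun i => h3 _ _ (by simp)
    · have := h q (by omega) q.2 p q hpq rfl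
      rwa [if_pos hq] at this

theorem mem_descentSet_conjugate {n : ℕ} {c : Composition n} {d : ℕ} :
    d ∈ descentSet (conjugate c) ↔ 0 < d ∧ d < n ∧ n - d ∉ descentSet c := by
  rw [conjugate, mem_descentSet_ofDescentSet, Finset.mem_sdiff, Finset.mem_Ioo, reverseComposition,
    mem_descentSet_ofDescentSet, Finset.mem_image]
  constructor
  · rintro ⟨h1, h2, -, h3⟩
    refine ⟨h1, h2, fun h4 => h3 ⟨h1, h2, n - d, h4, by omega⟩⟩
  · rintro ⟨h1, h2, h3⟩
    refine ⟨h1, h2, ⟨h1, h2⟩, ?_⟩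
    rintro ⟨-, -, e, he, rfl⟩
    -- Subtraction is truncated: for `e > n` the difference `n - e` is zero, against `h1`.
    by_cases hen : e ≤ n
    · exact h3 (by rwa [Nat.sub_sub_self hen])
    · omega

/-- Reading `k` backwards turns each condition for the conjugate into the negation of the condition
for `c` at the mirror position, because the negation of a weak inequality is the opposite strict one
and conversely. Hence L_c̄ enumerates the words that fail to rise at every position. -/
theorem monotone_and_strictAt_conjugate_iff {n : ℕ} (c : Composition n) (k : Fin n → ℕ) :
    (Monotone (k ∘ Fin.rev) ∧ StrictAt (descentSet (conjugate c)) (k ∘ Fin.rev)) ↔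
      ∀ d, 0 < d → d < n → ¬ RisesAt (descentSet c) k d := by
  rw [monotone_and_strictAt_iff]
  have key : ∀ d, 0 < d → d < n →
      (RisesAt (descentSet (conjugate c)) (k ∘ Fin.rev) (n - d) ↔
        ¬ RisesAt (descentSet c) k d) := by
    intro d h1 h2
    have e1 : RisesAt (descentSet c) k d ↔ if d ∈ descentSet c
        then k ⟨d - 1, by omega⟩ < k ⟨d, h2⟩ else k ⟨d - 1, by omega⟩ ≤ k ⟨d, h2⟩ := by
      constructor
      · intro h
        exact h ⟨d - 1, by omega⟩ ⟨d, h2⟩ (by simp only; omega) rfl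
      · rintro h p ⟨q, hq⟩ hpq rfl
        rw [show p = ⟨q - 1, by omega⟩ from Fin.ext (by simp only at hpq ⊢; omega)]
        exact h
    have e2 : RisesAt (descentSet (conjugate c)) (k ∘ Fin.rev) (n - d) ↔
        if d ∈ descentSet c then k ⟨d, h2⟩ ≤ k ⟨d - 1, by omega⟩
          else k ⟨d, h2⟩ < k ⟨d - 1, by omega⟩ := by
      have hmem : n - d ∈ descentSet (conjugate c) ↔ d ∉ descentSet c := by
        rw [mem_descentSet_conjugate, Nat.sub_sub_self h2.le]
        exact ⟨fun h => h.2.2, fun h => ⟨by omega, by omega, h⟩⟩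
      have hr1 : Fin.rev (⟨n - d - 1, by omega⟩ : Fin n) = ⟨d, h2⟩ := by
        ext; simp [Fin.val_rev]; omega
      have hr2 : Fin.rev (⟨n - d, by omega⟩ : Fin n) = ⟨d - 1, by omega⟩ := by
        ext; simp [Fin.val_rev]; omega
      have e3 : RisesAt (descentSet (conjugate c)) (k ∘ Fin.rev) (n - d) ↔
          if n - d ∈ descentSet (conjugate c) then k ⟨d, h2⟩ < k ⟨d - 1, by omega⟩
            else k ⟨d, h2⟩ ≤ k ⟨d - 1, by omega⟩ := by
        constructor
        · intro h
          have := h ⟨n - d - 1, by omega⟩ ⟨n - d, by omega⟩ (by simp only; omega) rfl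
          simpa only [Function.comp, hr1, hr2] using this
        · rintro h p q hpq hq
          rw [show q = ⟨n - d, by omega⟩ from Fin.ext hq,
            show p = ⟨n - d - 1, by omega⟩ from Fin.ext (by simp only; omega)]
          simpa only [Function.comp, hr1, hr2] using h
      rw [e3]
      by_cases hd : d ∈ descentSet c
      · rw [if_neg (fun h => (hmem.1 h) hd), if_pos hd]
      · rw [if_pos (hmem.2 hd), if_neg hd]
    rw [e1, e2]
    split_ifs <;> simp
  constructor
  · intro h d h1 h2
    exact (key d h1 h2).1 (h (n - d) (by omega) (by omega))
  · intro h d h1 h2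
    have := (key (n - d) (by omega) (by omega)).2 (h (n - d) (by omega) (by omega))
    rwa [Nat.sub_sub_self h2.le] at this

open Classical in
theorem evaluation_conjugate {α : ℕ → ℝ} (h0 : ∀ i, 0 ≤ α i) (hs : Summable α) {n : ℕ}
    (c : Composition n) : evaluation α h0 hs (fundamental (conjugate c)) =
      ∑' k : Fin n → ℕ, if ∀ d, 0 < d → d < n → ¬ RisesAt (descentSet c) k d
        then ∏ p, α (k p) else 0 := by
  rw [evaluation_fundamental, ← (Equiv.arrowCongr Fin.revPerm (Equiv.refl ℕ)).tsum_eq]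
  refine tsum_congr fun k => ?_
  have h1 : Equiv.arrowCongr Fin.revPerm (Equiv.refl ℕ) k = k ∘ Fin.rev := by
    ext p; simp [Equiv.arrowCongr]
  rw [h1]
  refine if_congr (monotone_and_strictAt_conjugate_iff c k) ?_ rfl
  exact Equiv.prod_comp Fin.revPerm fun p => α (k p)

/-- A word of length `n` is, for no or two consecutive `i`, rising before and falling after its
`i`-th letter. -/
theorem sum_alternating_eq_zero (P : ℕ → Prop) {n : ℕ} (hn : 0 < n) :
    open Classical in
    ∑ i ∈ range (n + 1), (-1 : ℝ) ^ i * (if (∀ d, 0 < d → d < i → P d) ∧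
      (∀ d, i < d → d < n → ¬ P d) then 1 else 0) = 0 := by
  classical
  -- `F i` marks the words that rise before position `i` and fail from `i` on. The given condition
  -- leaves position `i` free, so its indicator is `F i + F (i + 1)` and the alternating sum
  -- telescopes. The constraints `0 < i` and `i ≤ n` make both boundary terms vanish.
  set F : ℕ → ℝ := fun i => if 0 < i ∧ i ≤ n ∧ (∀ d, 0 < d → d < i → P d) ∧
      (∀ d, i ≤ d → d < n → ¬ P d) then 1 else 0 with hF
  have key : ∀ i ∈ range (n + 1), (-1 : ℝ) ^ i * (if (∀ d, 0 < d → d < i → P d) ∧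
      (∀ d, i < d → d < n → ¬ P d) then 1 else 0) =
      (-1) ^ i * F i - (-1) ^ (i + 1) * F (i + 1) := by
    intro i hi
    have hin : i ≤ n := by rw [Finset.mem_range] at hi; omega
    have h : (if (∀ d, 0 < d → d < i → P d) ∧
        (∀ d, i < d → d < n → ¬ P d) then (1 : ℝ) else 0) = F i + F (i + 1) := by
      by_cases hA : (∀ d, 0 < d → d < i → P d) ∧ (∀ d, i < d → d < n → ¬ P d)
      · rw [if_pos hA]
        by_cases h1 : 0 < i ∧ (i < n → ¬ P i)
        · have e1 : F i = 1 := if_pos ⟨h1.1, hin, hA.1, fun d hd hdn => by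
            rcases hd.eq_or_lt with rfl | hd
            · exact h1.2 hdn
            · exact hA.2 d hd hdn⟩
          have e2 : F (i + 1) = 0 := if_neg fun h =>
            h1.2 (by omega) (h.2.2.1 i h1.1 (by omega))
          rw [e1, e2]; norm_num
        · have e1 : F i = 0 := if_neg fun h => h1 ⟨h.1, h.2.2.2 i le_rfl⟩
          have e2 : F (i + 1) = 1 := by
            refine if_pos ⟨by omega, ?_, fun d hd hdi => ?_, fun d hd hdn => hA.2 d (by omega) hdn⟩
            · by_contra hlt
              exact h1 ⟨by omega, fun h => absurd h (by omega)⟩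
            · rcases (Nat.lt_succ_iff.1 hdi).eq_or_lt with rfl | hlt
              · by_contra hP
                exact h1 ⟨hd, fun _ => hP⟩
              · exact hA.1 d hd hlt
          rw [e1, e2]; norm_num
      · rw [if_neg hA]
        have e1 : F i = 0 := if_neg fun h => hA ⟨h.2.2.1, fun d hd => h.2.2.2 d hd.le⟩
        have e2 : F (i + 1) = 0 := if_neg fun h =>
          hA ⟨fun d h1 h2 => h.2.2.1 d h1 (by omega), fun d hd => h.2.2.2 d (by omega)⟩
        rw [e1, e2]; norm_num
    rw [h, pow_succ]
    ring
  rw [Finset.sum_congr rfl key, Finset.sum_range_sub']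
  have e1 : F 0 = 0 := if_neg fun h => lt_irrefl _ h.1
  have e2 : F (n + 1) = 0 := if_neg fun h => by omega
  rw [e1, e2]; simp

theorem risesAt_segment_zero {i j : ℕ} (c : Composition (i + j)) (s : Fin i → ℕ) (t : Fin j → ℕ)
    {d : ℕ} (hd0 : 0 < d) (hd : d < i) :
    RisesAt (descentSet (segment c 0 i)) s d ↔ RisesAt (descentSet c) (Fin.append s t) d := by
  have hmem : d ∈ descentSet (segment c 0 i) ↔ d ∈ descentSet c := by
    rw [descentSet_segment]; simp [hd0, hd]
  constructor
  · intro h p q hpq hq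
    have := h ⟨p, by omega⟩ ⟨q, by omega⟩ hpq hq
    have e1 : Fin.append s t p = s ⟨p, by omega⟩ := Fin.append_left s t ⟨p, by omega⟩
    have e2 : Fin.append s t q = s ⟨q, by omega⟩ := Fin.append_left s t ⟨q, by omega⟩
    rw [e1, e2]
    simpa only [hmem] using this
  · intro h p q hpq hq
    have := h (Fin.castAdd j p) (Fin.castAdd j q) hpq hq
    simpa only [hmem, Fin.append_left] using this

theorem risesAt_segment {i j : ℕ} (c : Composition (i + j)) (s : Fin i → ℕ) (t : Fin j → ℕ)
    {d : ℕ} (hd0 : 0 < d) (hd : d < j) :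
    RisesAt (descentSet (segment c i j)) t d ↔
      RisesAt (descentSet c) (Fin.append s t) (i + d) := by
  have hmem : d ∈ descentSet (segment c i j) ↔ i + d ∈ descentSet c := by
    rw [descentSet_segment, add_comm i d]; simp [hd0, hd]
  constructor
  · intro h p q hpq hq
    have := h ⟨p - i, by omega⟩ ⟨q - i, by omega⟩ (by simp only; omega) (by simp only; omega)
    have hap : ∀ (r : Fin (i + j)) (hr : r.val - i < j), i ≤ r.val →
        t ⟨r - i, hr⟩ = Fin.append s t r := by
      intro r hr hir
      rw [← Fin.append_right s t]
      exact congrArg _ (Fin.ext (by simp; omega))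
    have e1 := hap p (by omega) (by omega)
    have e2 := hap q (by omega) (by omega)
    rw [e1, e2] at this
    simpa only [hmem] using this
  · intro h p q hpq hq
    have := h (Fin.natAdd i p) (Fin.natAdd i q) (by simp; omega) (by simp; omega)
    simpa only [hmem, Fin.append_right] using this

open Classical in
-- A product of two sums over words is a sum over their concatenations, with no condition at the
-- junction `i`.
theorem evaluation_mul_evaluation_conjugate {α : ℕ → ℝ} (h0 : ∀ i, 0 ≤ α i) (hs : Summable α)
    {n i j : ℕ} (h : i + j = n) (c : Composition n) :
    evaluation α h0 hs (fundamental (segment c 0 i)) *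
        evaluation α h0 hs (fundamental (conjugate (segment c i j))) =
      ∑' k : Fin n → ℕ, (if (∀ d, 0 < d → d < i → RisesAt (descentSet c) k d) ∧
        (∀ d, i < d → d < n → ¬ RisesAt (descentSet c) k d) then 1 else 0) * ∏ p, α (k p) := by
  subst h
  rw [evaluation_fundamental, evaluation_conjugate]
  have hsum : ∀ (m : ℕ) (Q : (Fin m → ℕ) → Prop) [DecidablePred Q],
      Summable fun t : Fin m → ℕ => if Q t then ∏ p, α (t p) else 0 := by
    intro m Q _
    refine Summable.of_nonneg_of_le (fun t => ?_) (fun t => ?_) (summable_pi_prod h0 hs m)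
    · split_ifs
      · exact Finset.prod_nonneg fun p _ => h0 _
      · exact le_rfl
    · split_ifs
      · exact le_rfl
      · exact Finset.prod_nonneg fun p _ => h0 _
  have hnn : ∀ (m : ℕ) (Q : (Fin m → ℕ) → Prop) [DecidablePred Q] (t : Fin m → ℕ),
      0 ≤ if Q t then ∏ p, α (t p) else 0 := by
    intro m Q _ t
    split_ifs
    · exact Finset.prod_nonneg fun p _ => h0 _
    · exact le_rfl
  have hs1 := hsum i fun t => Monotone t ∧ StrictAt (descentSet (segment c 0 i)) t
  have hs2 := hsum j fun t => ∀ d, 0 < d → d < j → ¬ RisesAt (descentSet (segment c i j)) t d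
  refine (hs1.tsum_mul_tsum hs2 (hs1.mul_of_nonneg hs2 (hnn i _) (hnn j _))).trans ?_
  rw [← (Fin.appendEquiv i j).tsum_eq]
  refine tsum_congr fun x => ?_
  obtain ⟨s, t⟩ := x
  change _ = (if (∀ d, 0 < d → d < i → RisesAt (descentSet c) (Fin.append s t) d) ∧
        (∀ d, i < d → d < i + j → ¬ RisesAt (descentSet c) (Fin.append s t) d) then (1 : ℝ) else 0) *
          ∏ p, α (Fin.append s t p)
  have e1 : (Monotone s ∧ StrictAt (descentSet (segment c 0 i)) s) ↔
      ∀ d, 0 < d → d < i → RisesAt (descentSet c) (Fin.append s t) d := by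
    rw [monotone_and_strictAt_iff]
    exact forall_congr' fun d => forall_congr' fun h1 => forall_congr' fun h2 =>
      risesAt_segment_zero c s t h1 h2
  have e2 : (∀ d, 0 < d → d < j → ¬ RisesAt (descentSet (segment c i j)) t d) ↔
      ∀ d, i < d → d < i + j → ¬ RisesAt (descentSet c) (Fin.append s t) d := by
    constructor
    · intro h d h1 h2
      have := h (d - i) (by omega) (by omega)
      rwa [risesAt_segment c s t (by omega) (by omega), Nat.add_sub_cancel' h1.le] at this
    · intro h d h1 h2
      rw [risesAt_segment c s t h1 h2]
      exact h (i + d) (by omega) (by omega)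
  rw [if_congr e1 rfl rfl, if_congr e2 rfl rfl, Fin.prod_univ_add]
  simp only [Fin.append_left, Fin.append_right, ite_and]
  split_ifs <;> simp

/-- The antipode identity evaluated at an alphabet: for each word separately, the cut positions
compatible with it cancel by signs. -/
theorem sum_evaluation_mul_evaluation_conjugate {α : ℕ → ℝ} (h0 : ∀ i, 0 ≤ α i) (hs : Summable α)
    {n : ℕ} (hn : 0 < n) (c : Composition n) :
    ∑ ij ∈ antidiagonal n, evaluation α h0 hs (fundamental (segment c 0 ij.1)) *
      ((-1) ^ ij.2 * evaluation α h0 hs (fundamental (conjugate (segment c ij.1 ij.2)))) = 0 := by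
  classical
  have h1 : ∀ ij ∈ antidiagonal n, evaluation α h0 hs (fundamental (segment c 0 ij.1)) *
      ((-1) ^ ij.2 * evaluation α h0 hs (fundamental (conjugate (segment c ij.1 ij.2)))) =
      ∑' k : Fin n → ℕ, (-1) ^ n * ((-1) ^ ij.1 *
        (if (∀ d, 0 < d → d < ij.1 → RisesAt (descentSet c) k d) ∧
        (∀ d, ij.1 < d → d < n → ¬ RisesAt (descentSet c) k d) then 1 else 0) * ∏ p, α (k p)) := by
    intro ij hij
    rw [Finset.HasAntidiagonal.mem_antidiagonal] at hij
    rw [mul_left_comm, evaluation_mul_evaluation_conjugate h0 hs hij, ← tsum_mul_left]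
    refine tsum_congr fun k => ?_
    have : (-1 : ℝ) ^ ij.2 = (-1) ^ n * (-1) ^ ij.1 := by
      rw [← hij, pow_add, mul_comm, ← mul_assoc, ← mul_pow]; simp
    rw [this]
    ring
  rw [Finset.sum_congr rfl h1, ← Summable.tsum_finsetSum]
  · refine (tsum_congr (g := fun _ => 0) fun k => ?_).trans tsum_zero
    rw [← Finset.mul_sum, ← Finset.sum_mul, Finset.Nat.sum_antidiagonal_eq_sum_range_succ_mk]
    simp only
    rw [sum_alternating_eq_zero (fun d => RisesAt (descentSet c) k d) hn]
    simp
  · intro ij _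
    refine Summable.mul_left _ ?_
    refine Summable.of_norm_bounded (summable_pi_prod h0 hs n) fun k => ?_
    have hp : 0 ≤ ∏ p, α (k p) := Finset.prod_nonneg fun p _ => h0 _
    rw [norm_mul, norm_mul, Real.norm_of_nonneg hp, norm_pow]
    split_ifs <;> simp [hp]

/-! ### Homogeneous quasi-symmetric functions -/

theorem mem_span_fundamental {n : ℕ} {f : QSym}
    (hf : ∀ m : ℕ →₀ ℕ, m.degree ≠ n → MvPowerSeries.coeff m (f : MvPowerSeries ℕ ℝ) = 0) :
    f ∈ Submodule.span ℝ (Set.range (fundamental : Composition n → QSym)) := by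
  classical
  set r := fundamentalBasis.repr f with hr
  have hfr : f = ∑ x ∈ r.support, r x • fundamental x.2 := by
    conv_lhs => rw [← fundamentalBasis.linearCombination_repr f, Finsupp.linearCombination_apply]
    simp only [Finsupp.sum, fundamentalBasis_apply, hr]
  have hfn : f = ∑ x ∈ r.support with x.1 = n, r x • fundamental x.2 := by
    apply Subtype.ext
    ext m
    have h1 := congrArg (fun g : QSym => MvPowerSeries.coeff m (g : MvPowerSeries ℕ ℝ)) hfr
    simp only [AddSubmonoidClass.coe_finsetSum, map_sum, Submodule.coe_smul, map_smul, smul_eq_mul,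
      fundamental] at h1 ⊢
    by_cases hm : m.degree = n
    · rw [h1, Finset.sum_filter_of_ne]
      intro x _ hx
      by_contra hne
      rw [coeff_fundamentalSeries_of_ne _ (by rw [hm]; exact Ne.symm hne), mul_zero] at hx
      exact hx rfl
    · rw [hf m hm]
      refine (Finset.sum_eq_zero fun x hx => ?_).symm
      rw [coeff_fundamentalSeries_of_ne _ (by rw [(Finset.mem_filter.1 hx).2]; exact hm), mul_zero]
  rw [hfn]
  refine Submodule.sum_mem _ fun x hx => Submodule.smul_mem _ _ (Submodule.subset_span ?_)
  obtain ⟨k, c⟩ := x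
  obtain rfl : k = n := (Finset.mem_filter.1 hx).2
  exact ⟨c, rfl⟩

theorem eq_of_homogeneous {n : ℕ} {f : QSym}
    (hf : ∀ m : ℕ →₀ ℕ, m.degree ≠ n → MvPowerSeries.coeff m (f : MvPowerSeries ℕ ℝ) = 0)
    {φ ψ : QSym →ₗ[ℝ] ℝ} (h : ∀ c : Composition n, φ (fundamental c) = ψ (fundamental c)) :
    φ f = ψ f := by
  have hs := mem_span_fundamental hf
  refine LinearMap.eqOn_span (s := Set.range (fundamental : Composition n → QSym)) ?_ hs
  rintro _ ⟨c, rfl⟩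
  exact h c

/-- Every `L_c` of degree `n` has coefficient 1 at x_0 x_1 ⋯ x_{n-1}, so on degree `n` the
specialization is proportional to this coefficient. -/
theorem exponentialSpecialization_eq (γ : ℝ) {n : ℕ} {f : QSym}
    (hf : ∀ m : ℕ →₀ ℕ, m.degree ≠ n → MvPowerSeries.coeff m (f : MvPowerSeries ℕ ℝ) = 0) :
    exponentialSpecialization γ f = γ ^ n / (n.factorial : ℝ) *
      MvPowerSeries.coeff (content fun p : Fin n => (p : ℕ)) (f : MvPowerSeries ℕ ℝ) := by
  classical
  refine eq_of_homogeneous hf (ψ := (γ ^ n / (n.factorial : ℝ)) •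
    (MvPowerSeries.coeff (content fun p : Fin n => (p : ℕ))).comp QSym.subtype) fun c => ?_
  rw [exponentialSpecialization_fundamental]
  change _ = γ ^ n / (n.factorial : ℝ) * MvPowerSeries.coeff _ (fundamentalSeries c)
  rw [coeff_fundamentalSeries c fun p q h => h, if_pos, mul_one]
  intro p q hpq _
  omega

/-! ### Products of power sums -/

section PowerProduct

variable {ι : Type*}

/-- The families of letters indexed by `I`, extended by zero, whose monomial `∏ x_{w_i}^{l_i}` has
exponent `m`. -/
def letterFamilies (l : ι → ℕ+) (I : Finset ι) (m : ℕ →₀ ℕ) : Set (ι → ℕ) :=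
  {w | (∀ i ∉ I, w i = 0) ∧ ∑ i ∈ I, Finsupp.single (w i) (l i : ℕ) = m}

theorem mem_support_of_letterFamilies {l : ι → ℕ+} {I : Finset ι} {m : ℕ →₀ ℕ} {w : ι → ℕ}
    (hw : w ∈ letterFamilies l I m) {i : ι} (hi : i ∈ I) : (l i : ℕ) ≤ m (w i) := by
  rw [← hw.2, Finsupp.finsetSum_apply]
  have := Finset.single_le_sum (f := fun j => Finsupp.single (w j) (l j : ℕ) (w i))
    (fun _ _ => Nat.zero_le _) hi
  simpa using this

theorem finite_letterFamilies [Finite ι] (l : ι → ℕ+) (I : Finset ι) (m : ℕ →₀ ℕ) :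
    (letterFamilies l I m).Finite := by
  classical
  refine (Set.Finite.pi' fun _ : ι => (insert 0 m.support).finite_toSet).subset fun w hw i => ?_
  by_cases hi : i ∈ I
  · have h1 := mem_support_of_letterFamilies hw hi
    have h2 := (l i).pos
    simp only [Finset.coe_insert, Set.mem_insert_iff, Finset.mem_coe, Finsupp.mem_support_iff]
    omega
  · simp [hw.1 i hi]

theorem degree_of_letterFamilies {l : ι → ℕ+} {I : Finset ι} {m : ℕ →₀ ℕ} {w : ι → ℕ}
    (hw : w ∈ letterFamilies l I m) : m.degree = ∑ i ∈ I, (l i : ℕ) := by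
  rw [← hw.2, map_sum]
  simp

/-- The product `∏_{i ∈ I} p_{l_i}` of power sums. -/
def powerProductSeries (l : ι → ℕ+) (I : Finset ι) : MvPowerSeries ℕ ℝ := fun m =>
  ((letterFamilies l I m).ncard : ℝ)

theorem coeff_powerProductSeries (l : ι → ℕ+) (I : Finset ι) (m : ℕ →₀ ℕ) :
    MvPowerSeries.coeff m (powerProductSeries l I) = ((letterFamilies l I m).ncard : ℝ) := rfl

theorem coeff_powerProductSeries_of_ne (l : ι → ℕ+) (I : Finset ι) {m : ℕ →₀ ℕ}
    (hm : m.degree ≠ ∑ i ∈ I, (l i : ℕ)) :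
    MvPowerSeries.coeff m (powerProductSeries l I) = 0 := by
  have : letterFamilies l I m = ∅ := Set.eq_empty_of_forall_notMem fun w hw =>
    hm (degree_of_letterFamilies hw)
  rw [coeff_powerProductSeries, this]
  simp

theorem ncard_letterFamilies_le [Finite ι] (l : ι → ℕ+) (I : Finset ι) {r : ℕ} (a i j : Fin r → ℕ)
    (hi : StrictMono i) (hj : StrictMono j) :
    (letterFamilies l I (∑ k, Finsupp.single (i k) (a k))).ncard ≤
      (letterFamilies l I (∑ k, Finsupp.single (j k) (a k))).ncard := by
  classical
  rcases isEmpty_or_nonempty (Fin r) with hr | hr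
  · simp
  -- Renaming the letters `i k` as `j k` maps one set of families injectively to the other. The
  -- arbitrary values of `invFun` outside the range of `i` do not matter, since only letters of the
  -- monomial occur.
  set φ : ℕ → ℕ := j ∘ Function.invFun i with hφ
  have hφi : ∀ k, φ (i k) = j k := fun k => by
    rw [hφ, Function.comp, Function.leftInverse_invFun hi.injective k]
  refine Set.ncard_le_ncard_of_injOn (fun w x => if x ∈ I then φ (w x) else 0) ?_ ?_
    (finite_letterFamilies l I _)
  · rintro w ⟨-, h2⟩
    refine ⟨fun x hx => if_neg hx, ?_⟩
    have h3 := congrArg (Finsupp.mapDomain φ) h2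
    simp only [Finsupp.mapDomain_finsetSum, Finsupp.mapDomain_single, hφi] at h3
    rw [← h3]
    exact Finset.sum_congr rfl fun x hx => by simp only [if_pos hx]
  · intro w hw w' hw' h
    have hrange : ∀ v ∈ letterFamilies l I (∑ k, Finsupp.single (i k) (a k)), ∀ x ∈ I,
        ∃ k, i k = v x := by
      intro v hv x hx
      have h1 := mem_support_of_letterFamilies hv hx
      have h2 := (l x).pos
      by_contra hne
      push Not at hne
      rw [Finsupp.finsetSum_apply, Finset.sum_eq_zero fun k _ => by simp [hne k]] at h1
      omega
    ext x
    by_cases hx : x ∈ I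
    · have h1 := congrFun h x
      simp only [if_pos hx] at h1
      obtain ⟨k, hk⟩ := hrange w hw x hx
      obtain ⟨k', hk'⟩ := hrange w' hw' x hx
      rw [← hk, ← hk', hφi, hφi] at h1
      rw [← hk, ← hk', hj.injective h1]
    · rw [hw.1 x hx, hw'.1 x hx]

/-- The product `∏_{i ∈ I} p_{l_i}` of power sums, as a quasi-symmetric function. -/
def powerProduct [Finite ι] (l : ι → ℕ+) (I : Finset ι) : QSym :=
  ⟨powerProductSeries l I,
    ⟨∑ i ∈ I, (l i : ℕ), fun _ hm => coeff_powerProductSeries_of_ne l I hm.ne'⟩,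
    fun _ a i j hi hj => congrArg Nat.cast
      (le_antisymm (ncard_letterFamilies_le l I a i j hi hj)
        (ncard_letterFamilies_le l I a j i hj hi))⟩

theorem coeff_powerProduct [Finite ι] (l : ι → ℕ+) (I : Finset ι) (m : ℕ →₀ ℕ) :
    MvPowerSeries.coeff m (powerProduct l I : MvPowerSeries ℕ ℝ) =
      ((letterFamilies l I m).ncard : ℝ) := rfl

theorem coeff_powerProduct_of_ne [Finite ι] (l : ι → ℕ+) (I : Finset ι) (m : ℕ →₀ ℕ)
    (hm : m.degree ≠ ∑ i ∈ I, (l i : ℕ)) :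
    MvPowerSeries.coeff m (powerProduct l I : MvPowerSeries ℕ ℝ) = 0 :=
  coeff_powerProductSeries_of_ne l I hm

theorem add_mapDomain_inj {a a' b b' : ℕ →₀ ℕ} {M : ℕ} (ha : ∀ i ∈ a.support, i < M)
    (ha' : ∀ i ∈ a'.support, i < M)
    (h : a + b.mapDomain (· + M) = a' + b'.mapDomain (· + M)) : a = a' ∧ b = b' := by
  have hz : ∀ (c : ℕ →₀ ℕ), (∀ i ∈ c.support, i < M) → ∀ x, c (x + M) = 0 := by
    intro c hc x
    by_contra hne
    have := hc _ (Finsupp.mem_support_iff.2 hne)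
    omega
  have hge : ∀ (c : ℕ →₀ ℕ) x, x < M → c.mapDomain (· + M) x = 0 := by
    intro c x hx
    refine Finsupp.mapDomain_of_notMem_range _ _ ?_
    rintro ⟨y, rfl⟩
    simp at hx
  have hsh : ∀ (c : ℕ →₀ ℕ) x, c.mapDomain (· + M) (x + M) = c x := fun c x =>
    Finsupp.mapDomain_apply (add_left_injective M) c x
  constructor
  · ext x
    by_cases hx : x < M
    · have := DFunLike.congr_fun h x
      simpa [hge _ _ hx] using this
    · obtain ⟨y, rfl⟩ := Nat.exists_eq_add_of_le (not_lt.1 hx)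
      rw [add_comm M y, hz a ha, hz a' ha']
  · ext x
    have := DFunLike.congr_fun h (x + M)
    simpa [hsh, hz a ha, hz a' ha'] using this

open Classical in
-- `J` is the set of indices whose letter lies in the first alphabet. Each power sum takes its
-- letter in one of the two alphabets, which is the primitivity of power sums.
theorem ncard_letterFamilies_add [Finite ι] (l : ι → ℕ+) (I : Finset ι) {a b : ℕ →₀ ℕ} {M : ℕ}
    (ha : ∀ i ∈ a.support, i < M) :
    (letterFamilies l I (a + b.mapDomain (· + M))).ncard =
      ∑ J ∈ I.powerset, (letterFamilies l J a).ncard * (letterFamilies l (I \ J) b).ncard := by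
  set m := a + b.mapDomain (· + M) with hm
  have hfin := finite_letterFamilies l I m
  rw [Set.ncard_eq_toFinset_card _ hfin,
    Finset.card_eq_sum_card_fiberwise (f := fun w => {i ∈ I | w i < M}) (t := I.powerset)
      fun w _ => Finset.mem_powerset.2 (Finset.filter_subset _ _)]
  refine Finset.sum_congr rfl fun J hJ => ?_
  rw [Finset.mem_powerset] at hJ
  rw [← Set.ncard_prod, ← Set.ncard_coe_finset]
  have hsplit : ∀ u : ι → ℕ →₀ ℕ, ∑ i ∈ I, u i = ∑ i ∈ J, u i + ∑ i ∈ I \ J, u i := fun u => by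
    rw [add_comm, Finset.sum_sdiff hJ]
  symm
  refine Set.ncard_congr (fun x _ i => if i ∈ J then x.1 i else if i ∈ I then x.2 i + M else 0)
    ?_ ?_ ?_
  · rintro ⟨u, v⟩ ⟨hu, hv⟩
    rw [Finset.mem_coe, Finset.mem_filter, Set.Finite.mem_toFinset]
    refine ⟨⟨fun i hi => ?_, ?_⟩, ?_⟩
    · simp only [if_neg fun h => hi (hJ h), if_neg hi]
    · rw [hsplit, hm, ← hu.2, ← hv.2, Finsupp.mapDomain_finsetSum]
      congr 1
      · exact Finset.sum_congr rfl fun i hi => by simp only [if_pos hi]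
      · refine Finset.sum_congr rfl fun i hi => ?_
        rw [Finset.mem_sdiff] at hi
        simp only [if_neg hi.2, if_pos hi.1, Finsupp.mapDomain_single]
    · ext i
      rw [Finset.mem_filter]
      constructor
      · rintro ⟨h1, h2⟩
        by_contra hi
        simp only [if_neg hi, if_pos h1] at h2
        omega
      · intro hi
        refine ⟨hJ hi, ?_⟩
        simp only [if_pos hi]
        have h1 := mem_support_of_letterFamilies hu hi
        have h2 := (l i).pos
        exact ha _ (Finsupp.mem_support_iff.2 (h2.trans_le h1).ne')
  · rintro ⟨u, v⟩ ⟨u', v'⟩ ⟨hu, hv⟩ ⟨hu', hv'⟩ h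
    refine Prod.ext (funext fun i => ?_) (funext fun i => ?_)
    · by_cases hi : i ∈ J
      · have := congrFun h i
        simpa [hi] using this
      · exact (hu.1 i hi).trans (hu'.1 i hi).symm
    · by_cases hi : i ∈ I \ J
      · have := congrFun h i
        rw [Finset.mem_sdiff] at hi
        simpa [hi.1, hi.2] using this
      · exact (hv.1 i hi).trans (hv'.1 i hi).symm
  · intro w hw
    rw [Finset.mem_coe, Finset.mem_filter, Set.Finite.mem_toFinset] at hw
    obtain ⟨⟨h1, h2⟩, h3⟩ := hw
    have hlt : ∀ i ∈ J, w i < M := fun i hi => by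
      rw [← h3, Finset.mem_filter] at hi
      exact hi.2
    have hge : ∀ i ∈ I \ J, M ≤ w i := fun i hi => by
      rw [← h3, Finset.mem_sdiff, Finset.mem_filter] at hi
      by_contra hlt
      exact hi.2 ⟨hi.1, by omega⟩
    have h4 : ∑ i ∈ J, Finsupp.single (w i) (l i : ℕ) = a ∧
        ∑ i ∈ I \ J, Finsupp.single (w i - M) (l i : ℕ) = b := by
      refine add_mapDomain_inj (M := M) (fun x hx => ?_) ha ?_
      · obtain ⟨i, hi, hix⟩ := Finset.mem_biUnion.1 (Finsupp.support_finsetSum hx)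
        have := Finsupp.support_single_subset hix
        rw [Finset.mem_singleton] at this
        rw [this]
        exact hlt i hi
      · rw [← hm, ← h2, hsplit, Finsupp.mapDomain_finsetSum]
        congr 1
        refine Finset.sum_congr rfl fun i hi => ?_
        rw [Finsupp.mapDomain_single, Nat.sub_add_cancel (hge i hi)]
    refine ⟨⟨fun i => if i ∈ J then w i else 0, fun i => if i ∈ I \ J then w i - M else 0⟩,
      ⟨⟨fun i hi => if_neg hi, ?_⟩, ⟨fun i hi => if_neg hi, ?_⟩⟩, ?_⟩
    · rw [← h4.1]
      exact Finset.sum_congr rfl fun i hi => by simp only [if_pos hi]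
    · rw [← h4.2]
      exact Finset.sum_congr rfl fun i hi => by simp only [if_pos hi]
    · ext i
      by_cases hi : i ∈ J
      · simp [hi]
      · by_cases hi' : i ∈ I
        · have := hge i (Finset.mem_sdiff.2 ⟨hi', hi⟩)
          simp [hi, hi', this]
        · simp [hi, hi', h1 i hi']

open Classical in
theorem coproduct_powerProduct [Finite ι] (l : ι → ℕ+) (I : Finset ι) :
    coproduct (powerProduct l I) =
      ∑ J ∈ I.powerset, powerProduct l J ⊗ₜ[ℝ] powerProduct l (I \ J) := by
  refine coproduct_eq fun a b M hM => ?_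
  rw [map_sum, coeff_powerProduct, ncard_letterFamilies_add l I hM]
  simp only [tensorCoeff_tmul, coeff_powerProduct]
  push_cast
  rfl

theorem evaluation_powerProduct [Finite ι] {α : ℕ → ℝ} (h0 : ∀ i, 0 ≤ α i) (hs : Summable α) (l : ι → ℕ+)
    (I : Finset ι) :
    evaluation α h0 hs (powerProduct l I) = ∏ i ∈ I, ∑' x, α x ^ (l i : ℕ) := by
  classical
  obtain ⟨h1, h2⟩ := summable_and_tsum_prod (κ := I) (f := fun i x => α x ^ (l i : ℕ))
    (fun i x => pow_nonneg (h0 x) _) (fun i => summable_pow_of_nonneg h0 hs (l i).pos)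
  have hv : ∀ w : I → ℕ, monomialValue α (∑ i : I, Finsupp.single (w i) (l i : ℕ)) =
      ∏ i : I, α (w i) ^ (l i : ℕ) := by
    intro w
    rw [monomialValue, ← Finsupp.prod_finsetSum_index]
    · simp
    · simp
    · intro i a b; exact pow_add _ _ _
  have h3 : Summable fun w : I → ℕ => monomialValue α (∑ i : I, Finsupp.single (w i) (l i : ℕ)) :=
    h1.congr fun w => (hv w).symm
  rw [← Finset.prod_coe_sort, ← h2, ← tsum_congr hv, tsum_eq_tsum_card_mul h3]
  refine tsum_congr fun m => ?_
  rw [coeff_powerProduct, ← Nat.card_coe_set_eq]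
  congr 2
  refine Nat.card_congr
    { toFun := fun w => ⟨fun i => w.1 i, ?_⟩
      invFun := fun w => ⟨fun i => if h : i ∈ I then w.1 ⟨i, h⟩ else 0, fun i hi => dif_neg hi, ?_⟩
      left_inv := ?_
      right_inv := ?_ }
  · rw [Finset.sum_coe_sort I fun i => Finsupp.single (w.1 i) (l i : ℕ)]
    exact w.2.2
  · refine (Finset.sum_coe_sort I _).symm.trans (Eq.trans ?_ w.2)
    exact Finset.sum_congr rfl fun i _ => by simp only [dif_pos i.2]
  · intro w
    apply Subtype.ext
    ext i
    by_cases hi : i ∈ I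
    · simp [hi]
    · simp [hi, w.2.1 i hi]
  · intro w
    apply Subtype.ext
    ext i
    simp

end PowerProduct

/-! ### Specializations of products of power sums -/

/-- The linear form `L_c ↦ (-1)^n L_{c̄}(α)`, for `c` of size `n`. -/
def signedConjugateEvaluation (α : ℕ → ℝ) (h0 : ∀ i, 0 ≤ α i) (hs : Summable α) : QSym →ₗ[ℝ] ℝ :=
  fundamentalBasis.constr ℝ fun x => (-1) ^ x.1 * evaluation α h0 hs (fundamental (conjugate x.2))

theorem signedConjugateEvaluation_fundamental {α : ℕ → ℝ} (h0 : ∀ i, 0 ≤ α i) (hs : Summable α)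
    {n : ℕ} (c : Composition n) : signedConjugateEvaluation α h0 hs (fundamental c) =
      (-1) ^ n * evaluation α h0 hs (fundamental (conjugate c)) := by
  have h := fundamentalBasis_apply ⟨n, c⟩
  rw [← h, signedConjugateEvaluation, Module.Basis.constr_basis]

theorem signedConjugateEvaluation_eq {α : ℕ → ℝ} (h0 : ∀ i, 0 ≤ α i) (hs : Summable α)
    {n : ℕ} {f : QSym}
    (hf : ∀ m : ℕ →₀ ℕ, m.degree ≠ n → MvPowerSeries.coeff m (f : MvPowerSeries ℕ ℝ) = 0) :
    signedConjugateEvaluation α h0 hs f = (-1) ^ n * evaluation α h0 hs (conjugation f) := by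
  refine eq_of_homogeneous hf
    (ψ := ((-1 : ℝ) ^ n) • (evaluation α h0 hs ∘ₗ conjugation)) fun c => ?_
  rw [signedConjugateEvaluation_fundamental, ← conjugation_fundamental]
  rfl

/-- The convolution of the evaluation and its signed conjugate vanishes in positive degree. -/
theorem antipode_evaluation_eq_zero {α : ℕ → ℝ} (h0 : ∀ i, 0 ≤ α i) (hs : Summable α)
    {n : ℕ} (hn : 0 < n) {f : QSym}
    (hf : ∀ m : ℕ →₀ ℕ, m.degree ≠ n → MvPowerSeries.coeff m (f : MvPowerSeries ℕ ℝ) = 0) :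
    LinearMap.mul' ℝ ℝ (TensorProduct.map (evaluation α h0 hs)
      (signedConjugateEvaluation α h0 hs) (coproduct f)) = 0 := by
  refine eq_of_homogeneous hf
    (φ := LinearMap.mul' ℝ ℝ ∘ₗ TensorProduct.map (evaluation α h0 hs)
      (signedConjugateEvaluation α h0 hs) ∘ₗ coproduct) (ψ := 0) fun c => ?_
  rw [LinearMap.comp_apply, LinearMap.comp_apply, coproduct_fundamental, map_sum, map_sum,
    LinearMap.zero_apply, ← sum_evaluation_mul_evaluation_conjugate h0 hs hn c]
  refine Finset.sum_congr rfl fun ij _ => ?_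
  rw [TensorProduct.map_tmul, LinearMap.mul'_apply, signedConjugateEvaluation_fundamental]

theorem powerProduct_empty {ι : Type*} [Finite ι] (l : ι → ℕ+) :
    powerProduct l ∅ = fundamental (ofDescentSet 0 ∅) := by
  classical
  apply Subtype.ext
  ext m
  by_cases hm : m.degree = 0
  · have hm0 : m = content (Fin.elim0 : Fin 0 → ℕ) := by
      simpa [content, Finsupp.degree_eq_zero_iff] using hm
    have h1 : letterFamilies l ∅ m = {fun _ => 0} := by
      ext w
      rw [letterFamilies, hm0]
      simp [content, funext_iff]
    rw [coeff_powerProduct, h1, Set.ncard_singleton, hm0]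
    change _ = MvPowerSeries.coeff _ (fundamentalSeries _)
    have h2 : StrictAt (descentSet (ofDescentSet 0 ∅)) (Fin.elim0 : Fin 0 → ℕ) := fun p => p.elim0
    rw [coeff_fundamentalSeries _ fun p => p.elim0, if_pos h2]
    simp
  · rw [coeff_powerProduct_of_ne l ∅ m (by simpa using hm)]
    exact (coeff_fundamentalSeries_of_ne _ hm).symm

/-- The signed conjugate is the convolution inverse of the evaluation, and power sums are primitive,
so it must send each power sum to its opposite. The sign (-1)^l of the degree then leaves
(-1)^(l-1). -/
theorem evaluation_conjugation_powerProduct {ι : Type*} [Finite ι] {α : ℕ → ℝ} (h0 : ∀ i, 0 ≤ α i)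
    (hs : Summable α) (l : ι → ℕ+) (I : Finset ι) :
    evaluation α h0 hs (conjugation (powerProduct l I)) =
      ∏ i ∈ I, (-1) ^ ((l i : ℕ) - 1) * ∑' x, α x ^ (l i : ℕ) := by
  classical
  have hneg : ∀ J : Finset ι, evaluation α h0 hs (conjugation (powerProduct l J)) =
      (-1) ^ (∑ i ∈ J, (l i : ℕ)) * signedConjugateEvaluation α h0 hs (powerProduct l J) := by
    intro J
    rw [signedConjugateEvaluation_eq h0 hs (coeff_powerProduct_of_ne l J), ← mul_assoc, ← mul_pow]
    simp
  have key : signedConjugateEvaluation α h0 hs (powerProduct l I) =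
      ∏ i ∈ I, -∑' x, α x ^ (l i : ℕ) := by
    induction I using Finset.strongInduction with
    | H I ih =>
      rcases I.eq_empty_or_nonempty with rfl | hI
      · rw [powerProduct_empty, signedConjugateEvaluation_fundamental, evaluation_fundamental,
          Finset.prod_empty, pow_zero, one_mul]
        rw [tsum_eq_single (Fin.elim0 : Fin 0 → ℕ) fun t ht => absurd (Subsingleton.elim _ _) ht,
          if_pos ⟨fun p => p.elim0, fun p => p.elim0⟩]
        simp
      · have hpos : 0 < ∑ i ∈ I, (l i : ℕ) := Finset.sum_pos (fun i _ => (l i).pos) hI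
        have h1 := antipode_evaluation_eq_zero h0 hs hpos (coeff_powerProduct_of_ne l I)
        rw [coproduct_powerProduct, map_sum, map_sum] at h1
        simp only [TensorProduct.map_tmul, LinearMap.mul'_apply, evaluation_powerProduct] at h1
        -- The product of the `p_i + (-p_i)` expands over the same subsets as the convolution, and
        -- both sums are zero. By induction all terms agree except that of the empty subset, which
        -- is the value sought.
        have h2 := Finset.prod_add (fun i => ∑' x, α x ^ (l i : ℕ))
          (fun i => -∑' x, α x ^ (l i : ℕ)) I
        simp only [add_neg_cancel] at h2
        obtain ⟨i, hi⟩ := hI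
        rw [Finset.prod_eq_zero hi rfl, ← h1,
          ← Finset.add_sum_erase _ _ (Finset.empty_mem_powerset I),
          ← Finset.add_sum_erase (a := ∅) _ _ (Finset.empty_mem_powerset I)] at h2
        have h3 : ∀ J ∈ I.powerset.erase ∅,
            signedConjugateEvaluation α h0 hs (powerProduct l (I \ J)) =
              ∏ i ∈ I \ J, -∑' x, α x ^ (l i : ℕ) := by
          intro J hJ
          rw [Finset.mem_erase, Finset.mem_powerset] at hJ
          refine ih _ (Finset.sdiff_ssubset hJ.2 (Finset.nonempty_iff_ne_empty.2 hJ.1))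
        rw [Finset.sum_congr rfl fun J hJ => by rw [h3 J hJ], add_left_inj] at h2
        simpa using h2
  rw [hneg, key, ← Finset.prod_pow_eq_pow_sum, ← Finset.prod_mul_distrib]
  refine Finset.prod_congr rfl fun i _ => ?_
  have : (-1 : ℝ) ^ (l i : ℕ) = -(-1) ^ ((l i : ℕ) - 1) := by
    conv_lhs => rw [← Nat.sub_add_cancel (l i).pos, pow_succ]
    ring
  rw [this]
  ring

theorem content_val_apply {n : ℕ} (x : ℕ) :
    (content fun p : Fin n => (p : ℕ)) x = if x < n then 1 else 0 := by
  rw [content_apply]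
  split_ifs with h
  · rw [Finset.card_eq_one]
    refine ⟨⟨x, h⟩, ?_⟩
    ext p
    simp [Fin.ext_iff]
  · rw [Finset.card_eq_zero, Finset.filter_eq_empty_iff]
    intro p _ hp
    omega

/-- Only the coefficient of a squarefree monomial matters. A power sum of degree at least two kills
it; otherwise it counts the n! ways to distribute the letters, which cancel the denominator. -/
theorem exponentialSpecialization_powerProduct {ι : Type*} [Finite ι] (γ : ℝ) (l : ι → ℕ+)
    (I : Finset ι) :
    exponentialSpecialization γ (powerProduct l I) =
      ∏ i ∈ I, if (l i : ℕ) = 1 then γ else 0 := by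
  classical
  rw [exponentialSpecialization_eq γ (coeff_powerProduct_of_ne l I), coeff_powerProduct]
  by_cases h : ∀ i ∈ I, (l i : ℕ) = 1
  · have hn : ∑ i ∈ I, (l i : ℕ) = #I := by
      rw [Finset.sum_congr rfl h]; simp
    rw [Finset.prod_congr rfl fun i hi => if_pos (h i hi), Finset.prod_const, hn]
    have hcard : (letterFamilies l I (content fun p : Fin #I => (p : ℕ))).ncard =
        (#I).factorial := by
      have h1 := wordCharacter_content_val (1 : Equiv.Perm (Fin #I))
      rw [if_pos rfl, wordCharacter] at h1
      rw [← h1]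
      set e := I.equivFin
      symm
      refine Set.ncard_congr (fun w _ i => if hi : i ∈ I then w (e ⟨i, hi⟩) else 0) ?_ ?_ ?_
      · rintro w ⟨hw, -⟩
        refine ⟨fun i hi => dif_neg hi, ?_⟩
        rw [← hw, content, ← e.sum_comp, ← Finset.sum_coe_sort]
        refine Finset.sum_congr rfl fun i _ => ?_
        simp only [dif_pos i.2, h i i.2]
      · intro w w' _ _ hww
        ext p
        have := congrFun hww (e.symm p)
        simpa using this
      · rintro u ⟨hu1, hu2⟩
        refine ⟨fun p => u (e.symm p), ⟨?_, rfl⟩, ?_⟩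
        · rw [← hu2, content, ← e.sum_comp, ← Finset.sum_coe_sort I]
          refine Finset.sum_congr rfl fun i _ => ?_
          simp [h i i.2]
        · ext i
          by_cases hi : i ∈ I
          · simp [hi]
          · simp [hi, hu1 i hi]
    rw [hcard, div_mul_cancel₀ _ (by exact_mod_cast (#I).factorial_ne_zero)]
  · push Not at h
    obtain ⟨i, hi, hne⟩ := h
    rw [Finset.prod_eq_zero hi (if_neg hne)]
    have hempty : letterFamilies l I (content fun p : Fin (∑ i ∈ I, (l i : ℕ)) => (p : ℕ)) = ∅ := by
      refine Set.eq_empty_of_forall_notMem fun w hw => ?_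
      have h1 := mem_support_of_letterFamilies hw hi
      rw [content_val_apply] at h1
      have h2 := (l i).pos
      split_ifs at h1 <;> omega
    rw [hempty]
    simp

/-- Both sides expand over chains K ⊆ J ⊆ I: the factors in K are evaluated at α, those in J \ K at
β with a sign, and those in I \ J at γE. -/
theorem specialization_powerProduct (ω : ThomaSimplex) {ι : Type*} [Finite ι] (l : ι → ℕ+)
    (I : Finset ι) :
    ω.specialization (powerProduct l I) = ∏ i ∈ I, powerSum ω (l i) := by
  classical
  rw [specialization_eq _ _ _ _ _ _ (coproduct_powerProduct l I)
    (fun J _ => coproduct_powerProduct l J)]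
  have h : ∀ i, powerSum ω (l i) = (∑' x, ω.α x ^ (l i : ℕ) +
      (-1) ^ ((l i : ℕ) - 1) * ∑' x, ω.β x ^ (l i : ℕ)) + if (l i : ℕ) = 1 then ω.γ else 0 :=
    fun i => rfl
  simp only [h]
  rw [Finset.prod_add]
  refine Finset.sum_congr rfl fun J _ => ?_
  rw [Finset.prod_add, Finset.sum_mul]
  refine Finset.sum_congr rfl fun K _ => ?_
  rw [ThomaSimplex.evalα, ThomaSimplex.evalβ, evaluation_powerProduct,
    evaluation_conjugation_powerProduct, exponentialSpecialization_powerProduct]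

/-! ### The cycles of a permutation -/

section Cycles

variable {n : ℕ} (g : Equiv.Perm (Fin n))

/-- The cycles of a permutation: the nontrivial ones and the fixed points. -/
abbrev CycleIndex : Type := {c // c ∈ g.cycleFactorsFinset} ⊕ {p : Fin n // g p = p}

/-- The cycle that contains a point. -/
def cycleIndex (p : Fin n) : CycleIndex g :=
  if h : g p = p then Sum.inr ⟨p, h⟩
  else Sum.inl ⟨g.cycleOf p, Equiv.Perm.cycleOf_mem_cycleFactorsFinset_iff.2
    (Equiv.Perm.mem_support.2 h)⟩

theorem card_cycleFactor_pos (c : {c // c ∈ g.cycleFactorsFinset}) : 0 < #c.1.support :=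
  zero_lt_two.trans_le (Equiv.Perm.mem_cycleFactorsFinset_iff.1 c.2).1.two_le_card_support

/-- The length of a cycle. -/
def cycleLength : CycleIndex g → ℕ+ :=
  Sum.elim (fun c => ⟨#c.1.support, card_cycleFactor_pos g c⟩) fun _ => 1

theorem cycleIndex_eq_inl_iff (p : Fin n) (c : {c // c ∈ g.cycleFactorsFinset}) :
    cycleIndex g p = Sum.inl c ↔ p ∈ c.1.support := by
  constructor
  · intro h
    by_cases hp : g p = p
    · simp [cycleIndex, hp] at h
    · rw [cycleIndex, dif_neg hp, Sum.inl.injEq] at h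
      rw [← h, Equiv.Perm.mem_support_cycleOf_iff]
      exact ⟨Equiv.Perm.SameCycle.refl g p, Equiv.Perm.mem_support.2 hp⟩
  · intro h
    have hp : g p ≠ p := Equiv.Perm.mem_support.1
      (Equiv.Perm.mem_cycleFactorsFinset_support_le c.2 h)
    rw [cycleIndex, dif_neg hp, Sum.inl.injEq]
    exact Subtype.ext (Equiv.Perm.cycle_is_cycleOf h c.2).symm

theorem cycleIndex_eq_inr_iff (p : Fin n) (q : {p : Fin n // g p = p}) :
    cycleIndex g p = Sum.inr q ↔ p = q := by
  constructor
  · intro h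
    by_cases hp : g p = p
    · rw [cycleIndex, dif_pos hp, Sum.inr.injEq] at h
      rw [← h]
    · simp [cycleIndex, hp] at h
  · rintro rfl
    rw [cycleIndex, dif_pos q.2]

theorem card_cycleIndex (q : CycleIndex g) : #{p | cycleIndex g p = q} = (cycleLength g q : ℕ) := by
  rcases q with c | x
  · simp only [cycleIndex_eq_inl_iff]
    rw [Finset.filter_mem_eq_inter, Finset.univ_inter]
    rfl
  · simp only [cycleIndex_eq_inr_iff]
    rw [Finset.filter_eq', if_pos (mem_univ _), Finset.card_singleton]
    rfl

theorem cycleIndex_surjective : Function.Surjective (cycleIndex g) := by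
  intro q
  have h := (cycleLength g q).pos
  rw [← card_cycleIndex, Finset.card_pos] at h
  obtain ⟨p, hp⟩ := h
  exact ⟨p, (Finset.mem_filter.1 hp).2⟩

theorem cycleIndex_eq_iff (p q : Fin n) :
    cycleIndex g p = cycleIndex g q ↔ g.SameCycle p q := by
  by_cases hp : g p = p
  · rw [eq_comm, show cycleIndex g p = Sum.inr ⟨p, hp⟩ from dif_pos hp, cycleIndex_eq_inr_iff]
    constructor
    · rintro rfl
      exact Equiv.Perm.SameCycle.refl g _
    · rintro ⟨i, hi⟩
      rw [← hi]
      exact Equiv.Perm.zpow_apply_eq_self_of_apply_eq_self hp i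
  · rw [eq_comm, show cycleIndex g p = Sum.inl ⟨g.cycleOf p,
      Equiv.Perm.cycleOf_mem_cycleFactorsFinset_iff.2 (Equiv.Perm.mem_support.2 hp)⟩ from
        dif_neg hp, cycleIndex_eq_inl_iff, Equiv.Perm.mem_support_cycleOf_iff' hp]

/-- A word is fixed by `g` when it is constant on the cycles, hence it is a choice of one letter per
cycle, each counted with the length of the cycle. -/
theorem ncard_letterFamilies_cycleLength (m : ℕ →₀ ℕ) :
    (letterFamilies (cycleLength g) univ m).ncard = wordCharacter m g := by
  rw [wordCharacter]
  refine Set.ncard_congr (fun v _ => v ∘ cycleIndex g) ?_ ?_ ?_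
  · rintro v ⟨-, hv⟩
    refine ⟨?_, ?_⟩
    · rw [← hv, content, ← Finset.sum_fiberwise univ (cycleIndex g)]
      refine Finset.sum_congr rfl fun q _ => ?_
      rw [Finset.sum_congr rfl (g := fun _ => Finsupp.single (v q) 1)
        (fun p hp => by rw [Function.comp, (Finset.mem_filter.1 hp).2]), Finset.sum_const,
        card_cycleIndex]
      simp
    · ext p
      exact congrArg v ((cycleIndex_eq_iff g _ _).2
        (Equiv.Perm.sameCycle_apply_left.2 (Equiv.Perm.SameCycle.refl g p)))
  · intro v v' _ _ h
    exact (cycleIndex_surjective g).injective_comp_right h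
  · rintro w ⟨hw1, hw2⟩
    have hpow : ∀ (k : ℕ) p, w ((g ^ k) p) = w p := by
      intro k
      induction k with
      | zero => exact fun p => rfl
      | succ k ih =>
        intro p
        rw [pow_succ, Equiv.Perm.mul_apply, ih]
        exact congrFun hw2 p
    have hcomp : (w ∘ Function.surjInv (cycleIndex_surjective g)) ∘ cycleIndex g = w := by
      ext p
      have h1 := Function.surjInv_eq (cycleIndex_surjective g) (cycleIndex g p)
      rw [cycleIndex_eq_iff] at h1
      obtain ⟨k, hk⟩ := h1.exists_nat_pow_eq
      have h2 := hpow k (Function.surjInv (cycleIndex_surjective g) (cycleIndex g p))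
      rw [hk] at h2
      exact h2.symm
    refine ⟨w ∘ Function.surjInv (cycleIndex_surjective g), ⟨fun i hi => absurd (mem_univ i) hi, ?_⟩,
      hcomp⟩
    rw [← hw1]
    conv_rhs => rw [← hcomp, content, ← Finset.sum_fiberwise univ (cycleIndex g)]
    refine Finset.sum_congr rfl fun q _ => ?_
    rw [Finset.sum_congr rfl (g := fun _ => Finsupp.single
      ((w ∘ Function.surjInv (cycleIndex_surjective g)) q) 1)
      (fun p hp => by rw [Function.comp, (Finset.mem_filter.1 hp).2]), Finset.sum_const,
      card_cycleIndex]
    simp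

theorem prod_cycleLength {M : Type*} [CommMonoid M] (f : ℕ → M) :
    ∏ q, f (cycleLength g q) = (g.partition.parts.map f).prod := by
  rw [Fintype.prod_sum_type, Equiv.Perm.parts_partition, Multiset.map_add, Multiset.prod_add,
    Equiv.Perm.cycleType_def, Multiset.map_map, Multiset.map_replicate, Multiset.prod_replicate]
  congr 1
  · exact Finset.prod_coe_sort g.cycleFactorsFinset fun c => f #c.support
  · change ∏ _q : {p : Fin n // g p = p}, f 1 = _
    rw [Finset.prod_const, Finset.card_univ]
    congr 1
    rw [Fintype.card_subtype, ← Finset.card_compl]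
    congr 1
    ext p
    simp

end Cycles

/-! ### The expansion of the extremal character. -/

theorem extremalCharacter_eq_specialization (ω : ThomaSimplex) {n : ℕ} (g : Equiv.Perm (Fin n)) :
    extremalCharacter ω g = ω.specialization (powerProduct (cycleLength g) univ) := by
  rw [specialization_powerProduct, prod_cycleLength]
  rfl

theorem extremalCharacter_eq_sum (ω : ThomaSimplex) {n : ℕ} (g : Equiv.Perm (Fin n)) :
    (extremalCharacter ω g : ℂ) = ∑ lam : n.Partition,
      ((∑ σ : Equiv.Perm (Fin n) with rskShape σ = lam, shuffleWeight ω σ : ℝ) : ℂ) *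
        normalizedCharacter lam g := by
  rw [extremalCharacter_eq_specialization]
  refine specialization_eq_sum_normalizedCharacter ω g _ fun m => ?_
  rw [coeff_powerProduct, ncard_letterFamilies_cycleLength]

theorem powerSum_one (ω : ThomaSimplex) : powerSum ω 1 = 1 := by
  simp [powerSum, ThomaSimplex.γ]

theorem extremalCharacter_one (ω : ThomaSimplex) (n : ℕ) :
    extremalCharacter ω (1 : Equiv.Perm (Fin n)) = 1 := by
  rw [extremalCharacter, Equiv.Perm.parts_partition]
  simp [powerSum_one]

theorem normalizedCharacter_one {n : ℕ} (lam : n.Partition) : normalizedCharacter lam 1 = 1 := by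
  rw [normalizedCharacter_eq, irreducibleCharacter_one, div_self]
  exact_mod_cast (finrank_irreducibleModule_pos lam).ne'

/-- Evaluate the expansion at the identity, where χ^ω and all normalized characters equal 1. -/
theorem sum_shuffleWeight (ω : ThomaSimplex) (n : ℕ) :
    ∑ σ : Equiv.Perm (Fin n), shuffleWeight ω σ = 1 := by
  have h := extremalCharacter_eq_sum ω (1 : Equiv.Perm (Fin n))
  simp only [normalizedCharacter_one, mul_one, extremalCharacter_one] at h
  rw [← Complex.ofReal_sum, Finset.sum_fiberwise] at h
  exact_mod_cast h.symm

/-- Existence is `extremalCharacter_eq_sum`; uniqueness is the linear independence of the normalized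
characters, applied to the difference of two expansions. -/
theorem isCharacterExpansion_iff (ω : ThomaSimplex) {n : ℕ} (P : n.Partition → ℝ) :
    IsCharacterExpansion ω P ↔
      ∀ lam, P lam = ∑ σ : Equiv.Perm (Fin n) with rskShape σ = lam, shuffleWeight ω σ := by
  constructor
  · intro h lam
    have h1 := Fintype.linearIndependent_iff.1 (linearIndependent_normalizedCharacter n)
      (fun lam => (P lam : ℂ) -
        ((∑ σ : Equiv.Perm (Fin n) with rskShape σ = lam, shuffleWeight ω σ : ℝ) : ℂ)) ?_ lam
    · exact_mod_cast sub_eq_zero.1 h1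
    · ext g
      have h2 := (h g).symm.trans (extremalCharacter_eq_sum ω g)
      simp only [Finset.sum_apply, Pi.smul_apply, smul_eq_mul, sub_mul, Finset.sum_sub_distrib, h2,
        sub_self, Pi.zero_apply]
  · intro h g
    rw [extremalCharacter_eq_sum]
    exact Finset.sum_congr rfl fun lam _ => by rw [h lam]

end

end ThomaShuffle

open ThomaShuffle in
theorem proposition2p1 (ω : ThomaSimplex) (n : ℕ) :
    ((∀ σ : Equiv.Perm (Fin n), 0 ≤ shuffleWeight ω σ) ∧
      ∑ σ : Equiv.Perm (Fin n), shuffleWeight ω σ = 1) ∧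
    (∀ P : n.Partition → ℝ, IsCharacterExpansion ω P ↔
      ∀ lam, P lam = ∑ σ : Equiv.Perm (Fin n) with rskShape σ = lam, shuffleWeight ω σ) ∧
    (∀ σ : Equiv.Perm (Fin n), shuffleWeight ω σ =
      ∑ t ∈ Finset.Nat.antidiagonalTuple 3 n, ω.γ ^ t 2 / ((t 2).factorial : ℝ) *
        ω.evalα (fundamental (segment (recoilComposition σ) 0 (t 0))) *
        ω.evalβ (fundamental (conjugate (segment (recoilComposition σ) (t 0) (t 1))))) := by
  refine ⟨⟨shuffleWeight_nonneg ω, sum_shuffleWeight ω n⟩, isCharacterExpansion_iff ω, fun σ => ?_⟩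
  rw [shuffleWeight_eq, specialization_fundamental]
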